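/- **Theorem (local asymptotic equivalence of the $SU(2)$-covariant and the heterodyne measurement).** Let $\frac12<\mu\le 1$, let $\rho^{\mathbf 0}=\mathrm{diag}(\mu,1-\mu)$ on $\mathbb C^2$ (basis $|\!\uparrow\rangle,|\!\downarrow\rangle$), and for $\mathbf u=(u_x,u_y)\in\mathbb R^2$ put $U(\mathbf u)=\exp(i(u_x\sigma_x+u_y\sigma_y))$ and $\rho^{\mathbf u}=U(\mathbf u)\rho^{\mathbf 0}U(\mathbf u)^*$. For a bounded interval $I\subset\mathbb R$ let $B_n(I)=\{\rho^{\mathbf v/\sqrt n}:\mathbf v\in I^2\}$. Decompose $(\mathbb C^2)^{\otimes n}=\bigoplus_{j}\mathcal H_j\otimes\mathcal H^j_n$, $j\in\{\frac n2,\frac n2-1,\dots\}$, $j\ge 0$, where $\mathcal H_j$ is the irreducible representation of $SU(2)$ of spin $j$, with its standard basis $|j,m\rangle$, $m=-j,\dots,j$ (the ladder operators have non-negative coefficients), and $u^{\otimes n}$ acts on the $j$-th summand as $U_j(u)\otimes\mathbf 1$ for $u\in SU(2)$. Consider two measurements on $n$ qubits in the state $\rho^{\otimes n}$, with outcomes in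 the qubit states. Both begin with the "which block" measurement, which gives $j$. * *Covariant measurement $M_n$.* In the block $j$ measure a direction $\vec s\in S^2$ with the operator density $(2j+1)\,|j,\vec s\rangle\langle j,\vec s|\otimes\mathbf 1$ with respect to the uniform probability measure on $S^2$. Here $|j,\vec s\rangle=U_j(g)|j,j\rangle$, where $g\in SU(2)$ maps $|\!\uparrow\rangle$ to the spin state of direction $\vec s$. The outcome is $\frac12\big(\mathbf 1+\frac{2j}{n}\,\vec s\cdot\vec\sigma\big)$. * *Heterodyne-type measurement $H_n$.* In the block $j$ apply the isometry $V_j:|j,m\rangle\mapsto|j-m\rangle$ into the quantum oscillator with energy eigenbasis $|0\rangle,|1\rangle,\dots$, and then measure $\mathbf u\in\mathbb R^2$ with the operator density $$h(\mathbf u)=\frac{2\mu-1}{\pi}\,\big|\sqrt{2\mu-1}\,\alpha_{\mathbf u}\big\rangle\big\langle\sqrt{2\mu-1}\,\alpha_{\mathbf u}\big|,\qquad \alpha_{\mathbf u}=-u_y+iu_x,$$ with respect to Lebesgue measure, where $|z\rangle=e^{-|z|^2/2}\sum_{k\ge0}\frac{z^k}{\sqrt{k!}}|k\rangle$ is the coherent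 state. The outcome is $U\big(\tfrac{\mathbf u}{\sqrt n}\big)\,\mathrm{diag}\big(\tfrac12+\tfrac jn,\tfrac12-\tfrac jn\big)\,U\big(\tfrac{\mathbf u}{\sqrt n}\big)^*$. Let $P(M_n,\rho)$ and $P(H_n,\rho)$ be the laws of the outcomes. Then for all $n$ and all $\rho\in B_n(I)$ they are probability measures, and $$\lim_{n\to\infty}\ \sup_{\rho\in B_n(I)}\big\|P(M_n,\rho)-P(H_n,\rho)\big\|_1=0,$$ where $\|\cdot\|_1$ is the total variation norm. -/

import Mathlib

open MeasureTheory Filter Topology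
open scoped ENNReal Matrix

noncomputable section

namespace QubitLAN

/-! ### Qubit states -/

/-- Operators on `ℂ²` in the basis `|↑⟩ = e₀`, `|↓⟩ = e₁`. -/
abbrev QubitOp : Type := Matrix (Fin 2) (Fin 2) ℂ

/-- The space of measurement outcomes (qubit operators) carries its Borel `σ`-algebra. -/
instance : MeasurableSpace QubitOp := borel _

instance : BorelSpace QubitOp := ⟨rfl⟩

def σx : QubitOp := !![0, 1; 1, 0]
def σy : QubitOp := !![0, -Complex.I; Complex.I, 0]
def σz : QubitOp := !![1, 0; 0, -1]

/-- `U(u) = exp (i (uₓ σₓ + u_y σ_y))`. -/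
def U (u : ℝ × ℝ) : QubitOp :=
  NormedSpace.exp (Complex.I • ((u.1 : ℂ) • σx + (u.2 : ℂ) • σy))

/-- `ρ⁰ = diag (μ, 1 - μ)`. -/
def rho0 (μ : ℝ) : QubitOp := !![(μ : ℂ), 0; 0, 1 - (μ : ℂ)]

/-- `ρᵘ = U(u) ρ⁰ U(u)*`. -/
def rho (μ : ℝ) (u : ℝ × ℝ) : QubitOp := U u * rho0 μ * (U u)ᴴ

/-- The local family `B_n(I) = {ρ^{v/√n} : v ∈ I²}`. -/
def localFamily (μ : ℝ) (I : Set ℝ) (n : ℕ) : Set QubitOp :=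
  {ρ | ∃ v ∈ I ×ˢ I, ρ = rho μ ((√(n : ℝ))⁻¹ • v)}

/-! ### The space `(ℂ²)^{⊗n}` and its total spin -/

/-- Operators on `(ℂ²)^{⊗n}` in the product basis, which is indexed by `Fin n → Fin 2`. -/
abbrev SpinOp (n : ℕ) : Type := Matrix (Fin n → Fin 2) (Fin n → Fin 2) ℂ

/-- `A₁ ⊗ ⋯ ⊗ Aₙ`. -/
def tensorOp {n : ℕ} (A : Fin n → QubitOp) : SpinOp n :=
  Matrix.of fun x y => ∏ i, A i (x i) (y i)

/-- `A^{⊗n}`. -/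
def tensorPow (n : ℕ) (A : QubitOp) : SpinOp n := tensorOp fun _ => A

/-- `∑ₖ 1 ⊗ ⋯ ⊗ A ⊗ ⋯ ⊗ 1`, with `A` in the `k`-th position. -/
def collective (n : ℕ) (A : QubitOp) : SpinOp n :=
  ∑ k : Fin n, tensorOp (Function.update (fun _ => 1) k A)

/-- Total spin along `z`, normalised to have eigenvalues `-n/2, …, n/2`. -/
def Sz (n : ℕ) : SpinOp n := collective n ((1 / 2 : ℂ) • σz)

/-- Total raising operator `S₊ = Sₓ + i S_y`. -/
def Splus (n : ℕ) : SpinOp n :=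
  collective n ((1 / 2 : ℂ) • (σx + Complex.I • σy))

/-- Total lowering operator `S₋ = Sₓ - i S_y`. -/
def Sminus (n : ℕ) : SpinOp n :=
  collective n ((1 / 2 : ℂ) • (σx - Complex.I • σy))

/-! ### Blocks

The decomposition is `(ℂ²)^{⊗n} = ⨁_j H_j ⊗ H_n^j`. The total spin `j` is encoded by `d = 2j`,
and the basis vector `|j, j - k⟩` of `H_j ≅ ℂ^{d+1}` by `k ∈ {0, …, d}`. -/

/-- The subspace `|j, j⟩ ⊗ H_n^j` of highest weight vectors of spin `j = d/2`:
`S_z ψ = j ψ` and `S₊ ψ = 0`. -/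
def highestWeight (n d : ℕ) : Submodule ℂ (EuclideanSpace ℂ (Fin n → Fin 2)) :=
  Module.End.eigenspace (Matrix.toEuclideanCLM (𝕜 := ℂ) (Sz n)).toLinearMap ((d : ℂ) / 2) ⊓
    LinearMap.ker (Matrix.toEuclideanCLM (𝕜 := ℂ) (Splus n)).toLinearMap

/-- The operator `|j, j⟩⟨j, j| ⊗ 1`: the orthogonal projection onto `|j, j⟩ ⊗ H_n^j`. -/
def highestProj (n d : ℕ) : SpinOp n :=
  (Matrix.toEuclideanCLM (𝕜 := ℂ)).symm (highestWeight n d).starProjection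

/-- The norm of `S₋ᵏ |j, j⟩`, so that `S₋ᵏ |j, j⟩ = ladderNorm d k • |j, j - k⟩`. It is the product
of the coefficients `√(j - m + 1) √(j + m)` for `m = j, j - 1, …, j - k + 1`. -/
def ladderNorm (d k : ℕ) : ℝ := √((k.factorial : ℝ) * (d.descFactorial k : ℝ))

/-- The operator `|j, j - k⟩⟨j, j - k'| ⊗ 1` on `(ℂ²)^{⊗n}`. -/
def blockUnit (n d k k' : ℕ) : SpinOp n :=
  (((ladderNorm d k)⁻¹ * (ladderNorm d k')⁻¹ : ℝ) : ℂ) •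
    (Sminus n ^ k * highestProj n d * Splus n ^ k')

/-- The operator `A ⊗ 1` on the block `H_j ⊗ H_n^j` (and `0` on the other blocks), for an operator
`A` on `H_j`. -/
def amplify (n d : ℕ) (A : Matrix (Fin (d + 1)) (Fin (d + 1)) ℂ) : SpinOp n :=
  ∑ k, ∑ k', A k k' • blockUnit n d k k'

/-! ### Block-wise measurements -/

/-- The law of the outcome of the following measurement on `n` qubits, each of them in the state
`ρ`: find the block `j`, measure in this block with the operator density `m (2j)` with respect to
`ν`, and report the estimate `est (2j) x`, where `x` is the result. The values of `2j` are
`n - 2l`, `l = 0, …, ⌊n/2⌋`. -/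
def outcomeLaw {X : Type} [MeasurableSpace X] (ν : Measure X) (n : ℕ)
    (m : ℕ → X → SpinOp n) (est : ℕ → X → QubitOp) (ρ : QubitOp) : Measure QubitOp :=
  ∑ l ∈ Finset.range (n / 2 + 1),
    Measure.map (est (n - 2 * l))
      (ν.withDensity fun x =>
        ENNReal.ofReal (Matrix.trace (tensorPow n ρ * m (n - 2 * l) x)).re)

/-! ### The covariant measurement -/

/-- The uniform probability distribution on the unit sphere in polar coordinates `(θ, φ)`, that is
`sin θ dθ dφ / (4π)` on `(0, π) × (0, 2π)`. -/
def sphereMeasure : Measure (ℝ × ℝ) :=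
  (volume.restrict (Set.Ioo 0 Real.pi ×ˢ Set.Ioo 0 (2 * Real.pi))).withDensity
    fun s => ENNReal.ofReal (Real.sin s.1 / (4 * Real.pi))

/-- The inverse `U(s)*` of the rotation `U(s)`: the element of `SU(2)` which maps `|↑⟩` to the spin
state `|s⟩ = cos (θ/2) |↑⟩ + e^{iφ} sin (θ/2) |↓⟩` of direction `s`. -/
def rotFromUp (s : ℝ × ℝ) : QubitOp :=
  !![(Real.cos (s.1 / 2) : ℂ), -Complex.exp (-Complex.I * s.2) * (Real.sin (s.1 / 2) : ℂ);
     Complex.exp (Complex.I * s.2) * (Real.sin (s.1 / 2) : ℂ), (Real.cos (s.1 / 2) : ℂ)]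

/-- `m_{j,n}(s) = (2j+1) U_j(s)* |j⟩⟨j| U_j(s) ⊗ 1`. By the definition of the blocks, `U^{⊗n}` acts
on `H_j ⊗ H_n^j` as `U_j ⊗ 1`. -/
def covDensity (n d : ℕ) (s : ℝ × ℝ) : SpinOp n :=
  ((d : ℂ) + 1) •
    (tensorPow n (rotFromUp s) * highestProj n d * (tensorPow n (rotFromUp s))ᴴ)

/-- The estimate `(1 + (2j/n) s·σ) / 2`. -/
def covEstimate (n d : ℕ) (s : ℝ × ℝ) : QubitOp :=
  (1 / 2 : ℂ) • (1 + ((d : ℂ) / (n : ℂ)) •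
    (((Real.sin s.1 * Real.cos s.2 : ℝ) : ℂ) • σx +
     ((Real.sin s.1 * Real.sin s.2 : ℝ) : ℂ) • σy +
     ((Real.cos s.1 : ℝ) : ℂ) • σz))

/-- `P(M_n, ρ)`. -/
def covLaw (n : ℕ) (ρ : QubitOp) : Measure QubitOp :=
  outcomeLaw sphereMeasure n (covDensity n) (covEstimate n) ρ

/-! ### The oscillator and the heterodyne measurement -/

/-- The Hilbert space of the oscillator, in the energy eigenbasis `|0⟩, |1⟩, …`. -/
abbrev Oscillator : Type := lp (fun _ : ℕ => ℂ) 2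

theorem memlp_coherent (z : ℂ) :
    Memℓp (fun k : ℕ => (Real.exp (-‖z‖ ^ 2 / 2) : ℂ) * z ^ k / (√(k.factorial : ℝ) : ℂ)) 2 := by
  rw [memℓp_gen_iff (by norm_num)]
  have h := (Real.summable_pow_div_factorial (‖z‖ ^ 2)).mul_left (Real.exp (-‖z‖ ^ 2 / 2) ^ 2)
  refine h.congr fun k => ?_
  have hk : (0 : ℝ) ≤ (k.factorial : ℝ) := by positivity
  simp only [ENNReal.toReal_ofNat, Real.rpow_two, norm_div, norm_mul, norm_pow,
    Complex.norm_real, Real.norm_eq_abs, div_pow, mul_pow, sq_abs, Real.sq_sqrt hk]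
  ring

/-- The coherent vector `|z⟩ = D(z)|0⟩ = e^{-|z|²/2} ∑ₖ zᵏ/√k! |k⟩`. -/
def coherent (z : ℂ) : Oscillator :=
  ⟨fun k => (Real.exp (-‖z‖ ^ 2 / 2) : ℂ) * z ^ k / (√(k.factorial : ℝ) : ℂ), memlp_coherent z⟩

/-- `α_u = -u_y + i uₓ`. -/
def alpha (u : ℝ × ℝ) : ℂ := -(u.2 : ℂ) + Complex.I * (u.1 : ℂ)

/-- The density of the heterodyne measurement with respect to Lebesgue measure on `ℝ²`:
`h(u) = ((2μ-1)/π) |z⟩⟨z|` with `z = √(2μ-1) α_u`. -/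
def heterodyne (μ : ℝ) (u : ℝ × ℝ) : Oscillator →L[ℂ] Oscillator :=
  (((2 * μ - 1) / Real.pi : ℝ) : ℂ) •
    InnerProductSpace.rankOne ℂ (coherent ((√(2 * μ - 1) : ℂ) * alpha u))
      (coherent ((√(2 * μ - 1) : ℂ) * alpha u))

/-- The isometry `V_j : |j, m⟩ ↦ |j - m⟩` from `H_j` to the oscillator. -/
def V (d : ℕ) : EuclideanSpace ℂ (Fin (d + 1)) →L[ℂ] Oscillator :=
  LinearMap.toContinuousLinearMap
    { toFun := fun x => ∑ k, x k • lp.single 2 (k : ℕ) (1 : ℂ)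
      map_add' := fun x y => by simp [add_smul, Finset.sum_add_distrib]
      map_smul' := fun c x => by simp [Finset.smul_sum, smul_smul] }

/-- `V_j* h(u) V_j ⊗ 1` on the block of spin `j`. -/
def hetDensity (μ : ℝ) (n d : ℕ) (u : ℝ × ℝ) : SpinOp n :=
  amplify n d ((Matrix.toEuclideanCLM (𝕜 := ℂ)).symm
    ((V d).adjoint ∘L heterodyne μ u ∘L V d))

/-- The estimate `U(u/√n) diag (1/2 + j/n, 1/2 - j/n) U(u/√n)*`. -/
def hetEstimate (n d : ℕ) (u : ℝ × ℝ) : QubitOp :=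
  U ((√(n : ℝ))⁻¹ • u) *
    !![1 / 2 + (d : ℂ) / 2 / (n : ℂ), 0; 0, 1 / 2 - (d : ℂ) / 2 / (n : ℂ)] *
    (U ((√(n : ℝ))⁻¹ • u))ᴴ

/-- `P(H_n, ρ)`. -/
def hetLaw (μ : ℝ) (n : ℕ) (ρ : QubitOp) : Measure QubitOp :=
  outcomeLaw volume n (hetDensity μ n) (hetEstimate n) ρ

/-! ### Total variation -/

/-- `‖P - Q‖₁`, the total mass of `|P - Q|`, as the supremum over two-set measurable partitions of
`|P(A) - Q(A)| + |P(Aᶜ) - Q(Aᶜ)|`. -/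
def tvNorm {Ω : Type} [MeasurableSpace Ω] (P Q : Measure Ω) : ℝ≥0∞ :=
  ⨆ (A : Set Ω) (_ : MeasurableSet A),
    ((P A - Q A) + (Q A - P A)) + ((P Aᶜ - Q Aᶜ) + (Q Aᶜ - P Aᶜ))

end QubitLAN

end

noncomputable section

namespace QubitLAN

/-! ### Algebra of tensor powers -/

/-! Both measurements reduce to one irreducible block. With `d = 2j = n - 2l`, the trace of `A^{⊗n}`
against `X ⊗ 1` on the block is `mult * det(A)^l * tr(X Sym^d A)` (`trace_tensorPow_highestProj`,
`trace_tensorPow_amplify`). So for a rotated state the two block laws carry the same `blockWeight`,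
and their densities are values of the same quadratic form `symForm`, that of the symmetric power of
the state. Only the vectors differ: a spin coherent vector for the covariant measurement, a
truncated oscillator coherent vector for the heterodyne one.

Sphere and plane are identified by letting `s` correspond to the `u` for which `U (u / √n)` is the
rotation taking the north pole to `s`. Under this identification the two estimates agree exactly
(`hetEstimate_sphereToPlane`). The total variation norm is therefore at most twice a weighted sum of
`L¹` distances between densities on the plane (`tvNorm_covLaw_hetLaw_le`).

Consider blocks with `d / n` near `2μ - 1`, and divide the densities by `μ ^ d`. The covariant
density is, up to the Jacobian and the factor `d + 1`, the `d`-th power of a qubit expectation of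
the form `1 + t / n`, so it tends to a Gaussian. For the heterodyne density, the overlap of the two
coherent vectors tends to `1` (`tendsto_sum_overlapTerm`), and the symmetric power of the state has
largest eigenvalue `μ ^ d`, so one vector may replace the other (`sq_symForm_sub_le`); the limit is
the same Gaussian. Both families of coherent vectors resolve the identity, so both masses equal the
trace of the symmetric power (`lintegral_covariant`, `lintegral_heterodyne`). Relative to `μ ^ d`
this trace tends to the mass of the Gaussian, and Scheffé's lemma upgrades pointwise to `L¹`
convergence (`tendsto_blockDist`). Letting the local parameter vary with the filter and covering a
compact set makes this uniform (`exists_forall_blockDist_lt`).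

The other blocks have small total probability. The multiplicities are differences of binomial
coefficients (`mult_add_card`), so the law of the block label is at most a binomial law divided by
`2μ - 1`, and Chebyshev's inequality applies (`sum_blockWeight_tail_le`). -/

theorem tensorOp_mul {n : ℕ} (A B : Fin n → QubitOp) :
    tensorOp A * tensorOp B = tensorOp (A * B) := by
  ext x y
  simp only [tensorOp, Matrix.mul_apply, Matrix.of_apply, Pi.mul_apply]
  rw [Finset.prod_univ_sum]
  simp [Finset.prod_mul_distrib]

theorem tensorOp_one {n : ℕ} : tensorOp (1 : Fin n → QubitOp) = 1 := by
  ext x y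
  simp only [tensorOp, Matrix.of_apply, Pi.one_apply, Matrix.one_apply]
  by_cases h : x = y
  · simp [h]
  · obtain ⟨i, hi⟩ := Function.ne_iff.mp h
    rw [if_neg h]
    exact Finset.prod_eq_zero (Finset.mem_univ i) (by simp [hi])

theorem tensorOp_conjTranspose {n : ℕ} (A : Fin n → QubitOp) :
    (tensorOp A)ᴴ = tensorOp fun i => (A i)ᴴ := by
  ext x y
  simp [tensorOp, Matrix.conjTranspose_apply]

theorem tensorPow_mul (n : ℕ) (A B : QubitOp) :
    tensorPow n A * tensorPow n B = tensorPow n (A * B) := tensorOp_mul _ _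

theorem tensorPow_conjTranspose (n : ℕ) (A : QubitOp) :
    (tensorPow n A)ᴴ = tensorPow n Aᴴ := tensorOp_conjTranspose _

/-- The operator `A` on the `k`-th tensor factor. -/
def site {n : ℕ} (k : Fin n) (A : QubitOp) : SpinOp n :=
  tensorOp (Function.update (fun _ => 1) k A)

theorem collective_eq (n : ℕ) (A : QubitOp) : collective n A = ∑ k, site k A := rfl

theorem site_apply {n : ℕ} (k : Fin n) (A : QubitOp) (x y : Fin n → Fin 2) :
    site k A x y =
      A (x k) (y k) * ∏ i ∈ Finset.univ.erase k, (1 : QubitOp) (x i) (y i) := by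
  simp only [site, tensorOp, Matrix.of_apply]
  rw [← Finset.mul_prod_erase _ _ (Finset.mem_univ k)]
  congr 1
  · simp
  · refine Finset.prod_congr rfl fun i hi => ?_
    rw [Function.update_of_ne (Finset.ne_of_mem_erase hi)]

theorem site_add {n : ℕ} (k : Fin n) (A B : QubitOp) : site k (A + B) = site k A + site k B := by
  ext x y; simp [site_apply, add_mul]

theorem site_smul {n : ℕ} (k : Fin n) (c : ℂ) (A : QubitOp) : site k (c • A) = c • site k A := by
  ext x y; simp [site_apply, mul_assoc]

theorem site_sub {n : ℕ} (k : Fin n) (A B : QubitOp) : site k (A - B) = site k A - site k B := by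
  ext x y; simp [site_apply, sub_mul]

theorem site_zero {n : ℕ} (k : Fin n) : site k (0 : QubitOp) = 0 := by
  ext x y; simp [site_apply]

theorem site_one {n : ℕ} (k : Fin n) : site k (1 : QubitOp) = 1 := by
  rw [site, Function.update_eq_self_iff.mpr rfl]; exact tensorOp_one

theorem site_mul {n : ℕ} (k : Fin n) (A B : QubitOp) : site k A * site k B = site k (A * B) := by
  rw [site, site, tensorOp_mul, site]
  congr 1
  ext1 i
  by_cases h : i = k
  · subst h; simp
  · simp [h]

theorem site_commute {n : ℕ} {k j : Fin n} (h : k ≠ j) (A B : QubitOp) :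
    Commute (site k A) (site j B) := by
  rw [Commute, SemiconjBy, site, site, tensorOp_mul, tensorOp_mul]
  congr 1
  ext1 i
  by_cases h1 : i = k
  · subst h1; simp [h]
  · simp [h1]

theorem site_conjTranspose {n : ℕ} (k : Fin n) (A : QubitOp) : (site k A)ᴴ = site k Aᴴ := by
  rw [site, tensorOp_conjTranspose, site]
  congr 1
  ext1 i
  by_cases h : i = k
  · subst h; simp
  · simp [h]

theorem collective_conjTranspose (n : ℕ) (A : QubitOp) : (collective n A)ᴴ = collective n Aᴴ := by
  simp [collective_eq, Matrix.conjTranspose_sum, site_conjTranspose]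

theorem collective_smul (n : ℕ) (c : ℂ) (A : QubitOp) :
    collective n (c • A) = c • collective n A := by
  simp [collective_eq, site_smul, Finset.smul_sum]

/-- Operators on different sites commute, so only the diagonal terms of the double sum survive. -/
theorem collective_commutator (n : ℕ) (A B : QubitOp) :
    collective n A * collective n B - collective n B * collective n A =
      collective n (A * B - B * A) := by
  simp only [collective_eq, site_sub, ← site_mul, Finset.sum_sub_distrib, Finset.sum_mul,
    Finset.mul_sum]
  rw [Finset.sum_comm (γ := Fin n), ← Finset.sum_sub_distrib, ← Finset.sum_sub_distrib]
  refine Finset.sum_congr rfl fun i _ => ?_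
  rw [← Finset.sum_sub_distrib]
  refine Finset.sum_eq_single_of_mem i (Finset.mem_univ i) fun j _ hj => ?_
  rw [(site_commute hj.symm A B).eq, sub_self]

/-- Since `E² = 0`, each factor `1 + E` is the exponential of `E`, and exponentials of commuting
nilpotents multiply. This is the passage from tensor powers of unitriangular matrices to the ladder
operators. -/
theorem tensorPow_one_add_of_mul_self_eq_zero (n : ℕ) {E : QubitOp} (hE : E * E = 0) :
    tensorPow n (1 + E) = IsNilpotent.exp (collective n E) ∧ IsNilpotent (collective n E) := by
  -- Induction on the set of sites that carry the factor `1 + E`.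
  have key : ∀ s : Finset (Fin n),
      tensorOp (fun i => if i ∈ s then 1 + E else 1) = IsNilpotent.exp (∑ k ∈ s, site k E) ∧
        IsNilpotent (∑ k ∈ s, site k E) := by
    intro s
    induction s using Finset.induction_on with
    | empty => simpa [IsNilpotent.exp_zero, Pi.one_def] using tensorOp_one (n := n)
    | insert a s ha ih =>
      have hsq : site a E ^ 2 = 0 := by rw [pow_two, site_mul, hE, site_zero]
      have hnil : IsNilpotent (site a E) := ⟨2, hsq⟩
      have hcomm : Commute (site a E) (∑ k ∈ s, site k E) :=
        Commute.sum_right _ _ _ fun k hk => site_commute (by rintro rfl; exact ha hk) _ _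
      rw [Finset.sum_insert ha, IsNilpotent.exp_add_of_commute hcomm hnil ih.2, ← ih.1]
      refine ⟨?_, hcomm.isNilpotent_add hnil ih.2⟩
      have hexp : IsNilpotent.exp (site a E) = site a (1 + E) := by
        rw [IsNilpotent.exp_eq_sum hsq]
        simp [Finset.sum_range_succ, site_add, site_one]
      rw [hexp, site, tensorOp_mul]
      congr 1
      ext1 i
      by_cases h : i = a
      · subst h; simp [ha]
      · simp [h]
  simpa [collective_eq, tensorPow] using key Finset.univ

/-- `wt x` is the number of spins down in the product basis vector `x`. -/
def wt {n : ℕ} (x : Fin n → Fin 2) : ℕ := ∑ i, (x i : ℕ)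

theorem tensorPow_diagonal (n : ℕ) (a b : ℂ) (x y : Fin n → Fin 2) :
    tensorPow n !![a, 0; 0, b] x y = if x = y then a ^ (n - wt x) * b ^ wt x else 0 := by
  simp only [tensorPow, tensorOp, Matrix.of_apply]
  split_ifs with h
  · subst h
    have h1 : ∀ j : Fin 2, (!![a, 0; 0, b] : QubitOp) j j = a ^ (1 - (j : ℕ)) * b ^ (j : ℕ) := by
      intro j; fin_cases j <;> simp
    refine (Finset.prod_congr rfl fun i _ => h1 (x i)).trans ?_
    rw [Finset.prod_mul_distrib,
      Finset.prod_pow_eq_pow_sum, Finset.prod_pow_eq_pow_sum, wt]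
    congr 2
    have : ∑ i, (1 - (x i : ℕ)) + ∑ i, (x i : ℕ) = n := by
      rw [← Finset.sum_add_distrib]
      rw [Finset.sum_congr rfl (g := fun _ => 1)]
      · simp
      · intro i _; have := (x i).isLt; omega
    omega
  · obtain ⟨i, hi⟩ := Function.ne_iff.mp h
    refine Finset.prod_eq_zero (Finset.mem_univ i) ?_
    have : ∀ j k : Fin 2, j ≠ k → (!![a, 0; 0, b] : QubitOp) j k = 0 := by
      intro j k hjk; fin_cases j <;> fin_cases k <;> simp_all
    exact this _ _ hi

theorem wt_le {n : ℕ} (x : Fin n → Fin 2) : wt x ≤ n := by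
  calc wt x ≤ ∑ _i : Fin n, 1 := Finset.sum_le_sum fun i _ => by have := (x i).isLt; omega
    _ = n := by simp

/-! ### Total spin operators in the product basis -/

theorem Sz_apply (n : ℕ) (x y : Fin n → Fin 2) :
    Sz n x y = if x = y then (n : ℂ) / 2 - wt x else 0 := by
  simp only [Sz, collective_eq, Matrix.sum_apply, site_apply]
  split_ifs with h
  · subst h
    have h1 : ∀ j : Fin 2, ((1 / 2 : ℂ) • σz) j j = 1 / 2 - ((j : ℕ) : ℂ) := by
      intro j; fin_cases j <;> simp [σz]; norm_num
    rw [Finset.sum_congr rfl fun k _ => by rw [h1, Finset.prod_congr rfl fun i _ =>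
      Matrix.one_apply_eq (x i), Finset.prod_const_one, mul_one], Finset.sum_sub_distrib]
    simp [wt, div_eq_mul_inv]
  · refine Finset.sum_eq_zero fun k _ => ?_
    obtain ⟨i, hi⟩ := Function.ne_iff.mp h
    by_cases hk : i = k
    · have : ∀ j k : Fin 2, j ≠ k → ((1 / 2 : ℂ) • σz) j k = 0 := by
        intro j k hjk; fin_cases j <;> fin_cases k <;> simp_all [σz]
      subst hk
      rw [this _ _ hi, zero_mul]
    · rw [Finset.prod_eq_zero (Finset.mem_erase.2 ⟨hk, Finset.mem_univ i⟩), mul_zero]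
      simp [hi]

/-- The qubit raising operator. -/
def σp : QubitOp := !![0, 1; 0, 0]

/-- The qubit lowering operator. -/
def σm : QubitOp := !![0, 0; 1, 0]

theorem Splus_eq (n : ℕ) : Splus n = collective n σp := by
  rw [Splus]; congr 1
  ext i j; fin_cases i <;> fin_cases j <;> simp [σx, σy, σp]; norm_num

theorem Sminus_eq (n : ℕ) : Sminus n = collective n σm := by
  rw [Sminus]; congr 1
  ext i j; fin_cases i <;> fin_cases j <;> simp [σx, σy, σm]; norm_num

theorem Splus_conjTranspose (n : ℕ) : (Splus n)ᴴ = Sminus n := by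
  rw [Splus_eq, Sminus_eq, collective_conjTranspose]; congr 1
  ext i j; fin_cases i <;> fin_cases j <;> simp [σp, σm]

theorem Splus_mul_Sminus (n : ℕ) :
    Splus n * Sminus n = Sminus n * Splus n + (2 : ℂ) • Sz n := by
  rw [← sub_eq_iff_eq_add', Splus_eq, Sminus_eq, collective_commutator, Sz, ← collective_smul]
  congr 1
  ext i j; fin_cases i <;> fin_cases j <;> simp [σp, σm, σz]

theorem tensorPow_upper (n : ℕ) (c : ℂ) :
    tensorPow n !![1, c; 0, 1] = IsNilpotent.exp (c • Splus n) ∧ IsNilpotent (c • Splus n) := by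
  have h : (c • σp) * (c • σp) = 0 := by
    ext i j; fin_cases i <;> fin_cases j <;> simp [σp]
  have h2 : (!![1, c; 0, 1] : QubitOp) = 1 + c • σp := by
    ext i j; fin_cases i <;> fin_cases j <;> simp [σp]
  rw [Splus_eq, ← collective_smul, h2]
  exact tensorPow_one_add_of_mul_self_eq_zero n h

theorem tensorPow_lower (n : ℕ) (c : ℂ) :
    tensorPow n !![1, 0; c, 1] = IsNilpotent.exp (c • Sminus n) ∧ IsNilpotent (c • Sminus n) := by
  have h : (c • σm) * (c • σm) = 0 := by
    ext i j; fin_cases i <;> fin_cases j <;> simp [σm]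
  have h2 : (!![1, 0; c, 1] : QubitOp) = 1 + c • σm := by
    ext i j; fin_cases i <;> fin_cases j <;> simp [σm]
  rw [Sminus_eq, ← collective_smul, h2]
  exact tensorPow_one_add_of_mul_self_eq_zero n h

/-! ### The projections onto highest weight vectors -/

theorem highestProj_mulVec_mem (n d : ℕ) (v : (Fin n → Fin 2) → ℂ) :
    WithLp.toLp 2 (highestProj n d *ᵥ v) ∈ highestWeight n d := by
  have h : WithLp.toLp 2 (highestProj n d *ᵥ v) =
      (highestWeight n d).starProjection (WithLp.toLp 2 v) := by
    rw [← Matrix.toEuclideanCLM_toLp (𝕜 := ℂ), highestProj, StarAlgEquiv.apply_symm_apply]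
  rw [h]
  exact Submodule.starProjection_apply_mem _ _

theorem mem_highestWeight_iff {n d : ℕ} {v : (Fin n → Fin 2) → ℂ} :
    WithLp.toLp 2 v ∈ highestWeight n d ↔
      Sz n *ᵥ v = ((d : ℂ) / 2) • v ∧ Splus n *ᵥ v = 0 := by
  rw [highestWeight, Submodule.mem_inf, Module.End.mem_eigenspace_iff, LinearMap.mem_ker]
  simp only [ContinuousLinearMap.coe_coe, Matrix.toEuclideanCLM_toLp, ← WithLp.toLp_smul]
  rw [(WithLp.toLp_injective 2).eq_iff, WithLp.toLp_eq_zero]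

theorem highestProj_conjTranspose (n d : ℕ) : (highestProj n d)ᴴ = highestProj n d := by
  have h : star (highestWeight n d).starProjection = (highestWeight n d).starProjection :=
    isSelfAdjoint_starProjection _
  rw [← Matrix.star_eq_conjTranspose, highestProj]
  exact ((Matrix.toEuclideanCLM (𝕜 := ℂ)).symm.map_star' _).symm.trans (by rw [h]; rfl)

theorem Splus_mul_highestProj (n d : ℕ) : Splus n * highestProj n d = 0 := by
  refine Matrix.toLin'.injective (LinearMap.ext fun v => ?_)
  have := (mem_highestWeight_iff.1 (highestProj_mulVec_mem n d v)).2
  simpa using this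

theorem Sz_mul_highestProj (n d : ℕ) :
    Sz n * highestProj n d = ((d : ℂ) / 2) • highestProj n d := by
  refine Matrix.toLin'.injective (LinearMap.ext fun v => ?_)
  have := (mem_highestWeight_iff.1 (highestProj_mulVec_mem n d v)).1
  simpa [Matrix.smul_mulVec] using this

theorem exp_mul_eq_of_mul_eq_zero {n : ℕ} {N P : SpinOp n} (hN : IsNilpotent N) (h : N * P = 0) :
    IsNilpotent.exp N * P = P := by
  have := IsNilpotent.exp_smul_eq_sum (A := SpinOp n) (M := SpinOp n) (a := N) (m := P) (k := 1)
    (by simpa using h) hN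
  simpa using this

/-- The tensor power is the exponential of `c • Splus n`, and `Splus n` annihilates highest weight
vectors. -/
theorem upper_mul_highestProj (n d : ℕ) (c : ℂ) :
    tensorPow n !![1, c; 0, 1] * highestProj n d = highestProj n d := by
  rw [(tensorPow_upper n c).1]
  exact exp_mul_eq_of_mul_eq_zero (tensorPow_upper n c).2 (by simp [Splus_mul_highestProj])

theorem highestProj_mul_lower (n d : ℕ) (c : ℂ) :
    highestProj n d * tensorPow n !![1, 0; c, 1] = highestProj n d := by
  have := congrArg Matrix.conjTranspose (upper_mul_highestProj n d (star c))
  rw [Matrix.conjTranspose_mul, highestProj_conjTranspose, tensorPow_conjTranspose] at this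
  convert this using 3
  ext i j; fin_cases i <;> fin_cases j <;> simp

/-- The eigenvalue equation for `Sz n` forces every nonzero row `x` of the projection to have
exactly `l` spins down. -/
theorem diagonal_mul_highestProj {n l : ℕ} (hl : 2 * l ≤ n) (a b : ℂ) :
    tensorPow n !![a, 0; 0, b] * highestProj n (n - 2 * l) =
      (a ^ (n - l) * b ^ l) • highestProj n (n - 2 * l) := by
  ext x y
  have h := congrFun (congrFun (Sz_mul_highestProj n (n - 2 * l)) x) y
  simp only [Matrix.mul_apply, Sz_apply, Matrix.smul_apply, ite_mul, zero_mul,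
    Finset.sum_ite_eq, Finset.mem_univ, if_true, tensorPow_diagonal, smul_eq_mul] at h ⊢
  by_cases h0 : highestProj n (n - 2 * l) x y = 0
  · simp [h0]
  · have h1 := mul_right_cancel₀ h0 h
    rw [Nat.cast_sub hl] at h1
    push_cast at h1
    have h2 : (wt x : ℂ) = l := by linear_combination -h1
    rw [Nat.cast_injective h2]

/-- The multiplicity `dim H_n^j` of the block with `d = 2j`. -/
def mult (n d : ℕ) : ℕ := Module.finrank ℂ (highestWeight n d)

theorem trace_highestProj (n d : ℕ) : Matrix.trace (highestProj n d) = mult n d := by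
  have h : LinearMap.trace ℂ _ (highestWeight n d).starProjection.toLinearMap =
      (Module.finrank ℂ (highestWeight n d) : ℂ) := by
    apply LinearMap.IsProj.trace
    exact ⟨fun x => Submodule.starProjection_apply_mem _ x,
      fun x hx => Submodule.starProjection_eq_self_iff.2 hx⟩
  rw [mult, ← h]
  have h2 : (highestWeight n d).starProjection =
      Matrix.toEuclideanCLM (𝕜 := ℂ) (highestProj n d) := by
    rw [highestProj, StarAlgEquiv.apply_symm_apply]
  rw [h2, Matrix.coe_toEuclideanCLM_eq_toEuclideanLin, Matrix.toEuclideanLin_eq_toLin_orthonormal,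
    Matrix.trace_toLin_eq]

/-- Gauss decomposition: write `A` as lower unitriangular times diagonal times upper unitriangular.
The projection absorbs both unitriangular factors, one of them after a cyclic permutation, and the
diagonal factor acts as a scalar. -/
theorem trace_tensorPow_highestProj {n l : ℕ} (hl : 2 * l ≤ n) (A : QubitOp) :
    Matrix.trace (tensorPow n A * highestProj n (n - 2 * l)) =
      mult n (n - 2 * l) * A 0 0 ^ (n - 2 * l) * A.det ^ l := by
  have key : ∀ A : QubitOp, A 0 0 ≠ 0 →
      Matrix.trace (tensorPow n A * highestProj n (n - 2 * l)) =
        mult n (n - 2 * l) * A 0 0 ^ (n - 2 * l) * A.det ^ l := by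
    intro A hA
    have hdec : A = !![1, 0; A 1 0 / A 0 0, 1] * !![A 0 0, 0; 0, A.det / A 0 0] *
        !![1, A 0 1 / A 0 0; 0, 1] := by
      ext i j
      fin_cases i <;> fin_cases j <;> simp [Matrix.det_fin_two, Matrix.mul_apply,
        Fin.sum_univ_two] <;> field_simp
      ring
    conv_lhs => rw [hdec]
    rw [← tensorPow_mul, ← tensorPow_mul, mul_assoc, upper_mul_highestProj, mul_assoc,
      Matrix.trace_mul_comm, mul_assoc, highestProj_mul_lower, diagonal_mul_highestProj hl,
      Matrix.trace_smul, trace_highestProj, smul_eq_mul]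
    have : n - l = (n - 2 * l) + l := by omega
    rw [this, pow_add, div_pow]
    field_simp
  -- The decomposition needs a nonzero corner entry. Both sides are continuous in a perturbation of
  -- that entry, and the good values of `t` are dense.
  let F : ℂ → QubitOp := fun t => A + !![t, 0; 0, 0]
  have hF : Continuous F := by
    refine continuous_const.add (continuous_matrix fun i j => ?_)
    fin_cases i <;> fin_cases j <;> simp <;> fun_prop
  have hT : Continuous fun t => Matrix.trace (tensorPow n (F t) * highestProj n (n - 2 * l)) := by
    refine Continuous.matrix_trace (Continuous.matrix_mul (continuous_matrix fun i j => ?_)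
      continuous_const)
    simp only [tensorPow, tensorOp, Matrix.of_apply]
    exact continuous_finsetProd _ fun k _ => hF.matrix_elem _ _
  have hR : Continuous fun t =>
      (mult n (n - 2 * l) : ℂ) * F t 0 0 ^ (n - 2 * l) * (F t).det ^ l :=
    (continuous_const.mul ((hF.matrix_elem 0 0).pow _)).mul (hF.matrix_det.pow _)
  have hd : Dense {t : ℂ | t ≠ -A 0 0} := dense_compl_singleton _
  have := Continuous.ext_on hd hT hR (fun t ht => key _ (by
    simp only [F, Matrix.add_apply]
    simp
    intro h; exact ht (by linear_combination h)))
  have h0 := congrFun this 0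
  have hF0 : F 0 = A := by
    ext i j; fin_cases i <;> fin_cases j <;> simp [F]
  simpa only [hF0] using h0

/-! ### Symmetric powers of qubit operators -/

/-- The product vector `b ⊗ ⋯ ⊗ b`. -/
def productVec (n : ℕ) (b : Fin 2 → ℂ) : (Fin n → Fin 2) → ℂ := fun y => ∏ i, b (y i)

theorem tensorPow_mulVec_productVec (n : ℕ) (A : QubitOp) (b : Fin 2 → ℂ) :
    tensorPow n A *ᵥ productVec n b = productVec n (A *ᵥ b) := by
  ext x
  simp only [Matrix.mulVec, dotProduct, productVec, tensorPow, tensorOp, Matrix.of_apply]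
  rw [Finset.prod_univ_sum]
  simp [Finset.prod_mul_distrib]

theorem productVec_apply (n : ℕ) (b : Fin 2 → ℂ) (y : Fin n → Fin 2) :
    productVec n b y = b 0 ^ (n - wt y) * b 1 ^ wt y := by
  have h := congrFun (tensorPow_mulVec_productVec n !![b 0, 0; 0, b 1] (fun _ => 1)) y
  have h1 : (!![b 0, 0; 0, b 1] : QubitOp) *ᵥ (fun _ => 1) = b := by
    ext i; fin_cases i <;> simp [Matrix.mulVec, dotProduct]
  rw [h1] at h
  rw [← h]
  simp [Matrix.mulVec, dotProduct, tensorPow_diagonal, productVec]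

/-- Compare coefficients in the expansion of `(1 + X) ^ n` as a product over sites. -/
theorem card_wt_eq (n k : ℕ) :
    (Finset.univ.filter fun y : Fin n → Fin 2 => wt y = k).card = n.choose k := by
  have h : ((1 : Polynomial ℕ) + Polynomial.X) ^ n =
      ∑ y : Fin n → Fin 2, Polynomial.X ^ wt y := by
    have h1 : ((1 : Polynomial ℕ) + Polynomial.X) ^ n =
        ∏ _i : Fin n, ∑ j : Fin 2, Polynomial.X ^ (j : ℕ) := by simp
    rw [h1, Finset.prod_univ_sum]
    simp [Finset.prod_pow_eq_pow_sum, wt]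
  have h2 := congrArg (fun p => Polynomial.coeff p k) h
  simp only [Polynomial.coeff_one_add_X_pow, Polynomial.finsetSum_coeff,
    Polynomial.coeff_X_pow] at h2
  rw [Finset.card_filter, ← Nat.cast_id (n.choose k), h2]
  exact Finset.sum_congr rfl fun y _ => by simp [eq_comm]

/-- The spin coherent vector `b^{⊗d}` in the basis of the symmetric subspace. -/
def spinCoherent (d : ℕ) (b : Fin 2 → ℂ) : Fin (d + 1) → ℂ :=
  fun k => (√(d.choose k : ℝ) : ℂ) * (b 0 ^ (d - (k : ℕ)) * b 1 ^ (k : ℕ))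

theorem ofReal_sqrt_mul_self {x : ℝ} (hx : 0 ≤ x) : ((√x : ℝ) : ℂ) * (√x : ℝ) = x := by
  rw [← Complex.ofReal_mul, Real.mul_self_sqrt hx]

theorem sqrt_choose_ne_zero {d k : ℕ} (h : k ≤ d) : ((√(d.choose k : ℝ) : ℝ) : ℂ) ≠ 0 := by
  rw [Complex.ofReal_ne_zero, Real.sqrt_ne_zero']
  exact_mod_cast Nat.choose_pos h

/-- The adjoint of the embedding of the symmetric subspace. -/
def symEmb (d : ℕ) : Matrix (Fin (d + 1)) (Fin d → Fin 2) ℂ :=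
  Matrix.of fun k y => if wt y = k then ((√(d.choose k : ℝ) : ℝ) : ℂ)⁻¹ else 0

/-- The `d`-th symmetric power of `A`. -/
def symPow (d : ℕ) (A : QubitOp) : Matrix (Fin (d + 1)) (Fin (d + 1)) ℂ :=
  symEmb d * tensorPow d A * (symEmb d)ᴴ

theorem symEmb_mulVec_productVec (d : ℕ) (b : Fin 2 → ℂ) :
    symEmb d *ᵥ productVec d b = spinCoherent d b := by
  ext k
  simp only [Matrix.mulVec, dotProduct, symEmb, Matrix.of_apply, ite_mul, zero_mul,
    productVec_apply, spinCoherent]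
  rw [← Finset.sum_filter, Finset.sum_congr (g := fun _ => ((√(d.choose k : ℝ) : ℝ) : ℂ)⁻¹ *
    (b 0 ^ (d - (k : ℕ)) * b 1 ^ (k : ℕ))) rfl fun y hy => by rw [(Finset.mem_filter.1 hy).2],
    Finset.sum_const, card_wt_eq, nsmul_eq_mul, ← mul_assoc]
  congr 1
  have h := ofReal_sqrt_mul_self (x := (d.choose k : ℝ)) (by positivity)
  have h0 := sqrt_choose_ne_zero (d := d) (k := k) (by omega)
  rw [mul_inv_eq_iff_eq_mul₀ h0, h]
  simp

theorem symEmb_conjTranspose_mulVec_spinCoherent (d : ℕ) (b : Fin 2 → ℂ) :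
    (symEmb d)ᴴ *ᵥ spinCoherent d b = productVec d b := by
  ext y
  simp only [Matrix.mulVec, dotProduct, symEmb, Matrix.conjTranspose_apply, Matrix.of_apply,
    productVec_apply, spinCoherent]
  have hy : wt y < d + 1 := by have := wt_le y; omega
  rw [Finset.sum_eq_single (⟨wt y, hy⟩ : Fin (d + 1))]
  · have h0 := sqrt_choose_ne_zero (d := d) (k := wt y) (by omega)
    simp only [if_true, star_inv₀, RCLike.star_def, Complex.conj_ofReal]
    field_simp
  · intro k _ hk
    rw [if_neg, star_zero, zero_mul]
    intro h; exact hk (Fin.ext h.symm)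
  · simp

theorem symPow_mulVec_spinCoherent (d : ℕ) (A : QubitOp) (b : Fin 2 → ℂ) :
    symPow d A *ᵥ spinCoherent d b = spinCoherent d (A *ᵥ b) := by
  rw [symPow, ← Matrix.mulVec_mulVec, symEmb_conjTranspose_mulVec_spinCoherent,
    ← Matrix.mulVec_mulVec, tensorPow_mulVec_productVec, symEmb_mulVec_productVec]

theorem star_spinCoherent_dotProduct (d : ℕ) (a b : Fin 2 → ℂ) :
    star (spinCoherent d a) ⬝ᵥ spinCoherent d b = (star a ⬝ᵥ b) ^ d := by
  have h : star a ⬝ᵥ b = star (a 1) * b 1 + star (a 0) * b 0 := by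
    simp [dotProduct, Fin.sum_univ_two, add_comm]
  rw [h, add_pow, dotProduct, Finset.sum_range]
  refine Finset.sum_congr rfl fun k _ => ?_
  have h := ofReal_sqrt_mul_self (x := (d.choose k : ℝ)) (by positivity)
  simp only [spinCoherent, Pi.star_apply, star_mul', RCLike.star_def, Complex.conj_ofReal,
    map_pow, mul_pow]
  push_cast at h
  linear_combination ((starRingEnd ℂ) (a 0) ^ (d - (k : ℕ)) * (starRingEnd ℂ) (a 1) ^ (k : ℕ) *
    (b 0 ^ (d - (k : ℕ)) * b 1 ^ (k : ℕ))) * h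

theorem eq_zero_of_sum_pow_mul_eq_zero {N : ℕ} {a : ℕ → ℂ}
    (h : ∀ x : ℂ, ∑ k ∈ Finset.range N, x ^ k * a k = 0) {k : ℕ} (hk : k < N) : a k = 0 := by
  let p : Polynomial ℂ := ∑ k ∈ Finset.range N, Polynomial.monomial k (a k)
  have hp : p = 0 := Polynomial.funext fun x => by
    simp only [p, Polynomial.eval_finsetSum, Polynomial.eval_monomial, Polynomial.eval_zero]
    rw [← h x]
    exact Finset.sum_congr rfl fun k _ => mul_comm _ _
  have := congrArg (fun p => Polynomial.coeff p k) hp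
  simpa [p, Polynomial.finsetSum_coeff, Polynomial.coeff_monomial, hk] using this

/-- The spin coherent vectors of `(1, x)` already determine a matrix: an entry of the image is a
polynomial in `x` whose coefficients are the matrix entries times nonzero roots of binomial
coefficients. Multiplicativity of `symPow` thus needs no separate argument about symmetric
subspaces. -/
theorem matrix_eq_of_mulVec_spinCoherent {d : ℕ} {M N : Matrix (Fin (d + 1)) (Fin (d + 1)) ℂ}
    (h : ∀ b, M *ᵥ spinCoherent d b = N *ᵥ spinCoherent d b) : M = N := by
  ext i j
  rw [← sub_eq_zero]
  have h1 : ∀ x : ℂ, ∑ k ∈ Finset.range (d + 1), x ^ k * (if hk : k < d + 1 then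
      (M i ⟨k, hk⟩ - N i ⟨k, hk⟩) * ((√(d.choose k : ℝ) : ℝ) : ℂ) else 0) = 0 := by
    intro x
    have := congrFun (h ![1, x]) i
    simp only [Matrix.mulVec, dotProduct, spinCoherent] at this
    rw [← sub_eq_zero, ← Finset.sum_sub_distrib] at this
    rw [Finset.sum_range, ← this]
    refine Finset.sum_congr rfl fun k _ => ?_
    rw [dif_pos k.isLt]
    simp
    ring
  have h2 := eq_zero_of_sum_pow_mul_eq_zero h1 j.isLt
  rw [dif_pos j.isLt] at h2
  exact (mul_eq_zero.1 h2).resolve_right (sqrt_choose_ne_zero (by omega))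

theorem symPow_mul (d : ℕ) (A B : QubitOp) : symPow d A * symPow d B = symPow d (A * B) :=
  matrix_eq_of_mulVec_spinCoherent fun b => by
    rw [← Matrix.mulVec_mulVec]; simp only [symPow_mulVec_spinCoherent, Matrix.mulVec_mulVec]

theorem symPow_one (d : ℕ) : symPow d 1 = 1 :=
  matrix_eq_of_mulVec_spinCoherent fun b => by simp [symPow_mulVec_spinCoherent]

theorem symPow_conjTranspose (d : ℕ) (A : QubitOp) : (symPow d A)ᴴ = symPow d Aᴴ := by
  rw [symPow, symPow, Matrix.conjTranspose_mul, Matrix.conjTranspose_mul,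
    Matrix.conjTranspose_conjTranspose, tensorPow_conjTranspose, Matrix.mul_assoc]

theorem symPow_diagonal (d : ℕ) (a b : ℂ) :
    symPow d !![a, 0; 0, b] = Matrix.diagonal fun k : Fin (d + 1) => a ^ (d - (k : ℕ)) * b ^ (k : ℕ) :=
  matrix_eq_of_mulVec_spinCoherent fun c => by
    rw [symPow_mulVec_spinCoherent]
    ext k
    rw [Matrix.mulVec_diagonal]
    simp [spinCoherent, Matrix.mulVec, dotProduct, mul_pow]
    try ring

/-! ### Traces of block operators -/

theorem exp_smul_eq_sum_range {n N : ℕ} {S : SpinOp n} (h : S ^ N = 0) (c : ℂ) :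
    IsNilpotent.exp (c • S) =
      ∑ k ∈ Finset.range N, (c ^ k * ((k.factorial : ℂ))⁻¹) • S ^ k := by
  rw [IsNilpotent.exp_eq_sum (k := N) (by rw [smul_pow, h, smul_zero])]
  refine Finset.sum_congr rfl fun k _ => ?_
  ext x y
  simp [smul_pow, Rat.smul_def]
  ring

theorem ladderNorm_eq (d k : ℕ) : ladderNorm d k = k.factorial * √(d.choose k : ℝ) := by
  rw [ladderNorm, Nat.descFactorial_eq_factorial_mul_choose]
  push_cast
  rw [← mul_assoc, Real.sqrt_mul (by positivity), Real.sqrt_mul_self (by positivity)]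

/-- Generating functions: multiply `A` by an upper unitriangular matrix with entry `y` on the left
and a lower one with entry `x` on the right. Expanding the exponentials in
`trace_tensorPow_highestProj` produces all the ladder traces as coefficients. The determinant is
unchanged, and the `d`-th power of the new corner entry is a matrix element of `symPow d A` between
spin coherent vectors, which expands into the entries of `symPow d A`. -/
theorem trace_tensorPow_ladder {n l d : ℕ} (hl : 2 * l ≤ n) (hd : d = n - 2 * l) (A : QubitOp)
    (k k' : Fin (d + 1)) :
    Matrix.trace (tensorPow n A *
        (Sminus n ^ (k : ℕ) * highestProj n d * Splus n ^ (k' : ℕ))) =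
      (mult n d * A.det ^ l) * (ladderNorm d k * ladderNorm d k' * symPow d A k' k) := by
  obtain ⟨N₁, hN₁⟩ : ∃ N, Sminus n ^ N = 0 := by simpa [IsNilpotent] using (tensorPow_lower n 1).2
  obtain ⟨N₂, hN₂⟩ : ∃ N, Splus n ^ N = 0 := by simpa [IsNilpotent] using (tensorPow_upper n 1).2
  -- One truncation order beyond the nilpotency indices of both ladder operators and beyond the
  -- dimension `d + 1` of the block.
  set N := N₁ + N₂ + (d + 1) with hN
  have hm : Sminus n ^ N = 0 := pow_eq_zero_of_le (by omega) hN₁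
  have hp : Splus n ^ N = 0 := pow_eq_zero_of_le (by omega) hN₂
  set β : ℕ → ℕ → ℂ := fun k k' => ((k.factorial : ℂ))⁻¹ * ((k'.factorial : ℂ))⁻¹ *
    Matrix.trace (tensorPow n A * (Sminus n ^ k * highestProj n d * Splus n ^ k')) with hβ
  set γ : ℕ → ℕ → ℂ := fun k k' => (mult n d * A.det ^ l) *
    (if h : k < d + 1 ∧ k' < d + 1 then ((√(d.choose k : ℝ) : ℝ) : ℂ) *
      ((√(d.choose k' : ℝ) : ℝ) : ℂ) * symPow d A ⟨k', h.2⟩ ⟨k, h.1⟩ else 0) with hγ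
  have hβs : ∀ x y : ℂ, ∑ k ∈ Finset.range N, x ^ k * ∑ k' ∈ Finset.range N, y ^ k' * β k k' =
      mult n d * (star ![1, star y] ⬝ᵥ A *ᵥ ![1, x]) ^ d * A.det ^ l := by
    intro x y
    have h1 := trace_tensorPow_highestProj hl (!![1, y; 0, 1] * A * !![1, 0; x, 1])
    have h2 : (!![1, y; 0, 1] * A * !![1, 0; x, 1] : QubitOp).det = A.det := by
      rw [Matrix.det_mul, Matrix.det_mul]; simp
    have h3 : (!![1, y; 0, 1] * A * !![1, 0; x, 1] : QubitOp) 0 0 =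
        star ![1, star y] ⬝ᵥ A *ᵥ ![1, x] := by
      simp [Matrix.mul_apply, dotProduct, Matrix.mulVec, Matrix.vecMul, Fin.sum_univ_two]
      ring
    rw [← hd, h2, h3, ← tensorPow_mul, ← tensorPow_mul, mul_assoc, mul_assoc, Matrix.trace_mul_comm,
      (tensorPow_lower n x).1, (tensorPow_upper n y).1, exp_smul_eq_sum_range hm,
      exp_smul_eq_sum_range hp] at h1
    rw [← h1]
    simp only [Finset.mul_sum, Finset.sum_mul, Matrix.trace_sum, hβ, Matrix.smul_mul,
      Matrix.mul_smul, Matrix.trace_smul, smul_eq_mul]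
    rw [Finset.sum_comm]
    refine Finset.sum_congr rfl fun k _ => Finset.sum_congr rfl fun k' _ => ?_
    simp only [mul_assoc]
    ring
  have hγs : ∀ x y : ℂ, ∑ k ∈ Finset.range N, x ^ k * ∑ k' ∈ Finset.range N, y ^ k' * γ k k' =
      mult n d * (star ![1, star y] ⬝ᵥ A *ᵥ ![1, x]) ^ d * A.det ^ l := by
    intro x y
    have hsub : Finset.range (d + 1) ⊆ Finset.range N := by
      intro i; simp only [Finset.mem_range]; omega
    rw [← star_spinCoherent_dotProduct, ← symPow_mulVec_spinCoherent]
    rw [← Finset.sum_subset hsub, Finset.sum_range]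
    · simp only [dotProduct, Matrix.mulVec, Finset.mul_sum (s := Finset.univ), Finset.sum_mul]
      rw [Finset.sum_comm]
      refine Finset.sum_congr rfl fun k _ => ?_
      rw [← Finset.sum_subset hsub, Finset.sum_range]
      · rw [Finset.mul_sum]
        refine Finset.sum_congr rfl fun k' _ => ?_
        simp only [hγ]
        rw [dif_pos ⟨k.isLt, k'.isLt⟩]
        simp [spinCoherent]
        ring
      · intro k' _ hk'
        rw [Finset.mem_range] at hk'
        simp only [hγ]
        rw [dif_neg (fun h => hk' h.2), mul_zero, mul_zero]
    · intro k _ hk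
      rw [Finset.mem_range] at hk
      rw [Finset.sum_eq_zero, mul_zero]
      intro k' _
      simp only [hγ]
      rw [dif_neg (fun h => hk h.1), mul_zero, mul_zero]
  have hk := k.isLt
  have hk' := k'.isLt
  have key : β k k' - γ k k' = 0 := by
    -- Equality of polynomials in two variables, resolved one variable at a time.
    refine eq_zero_of_sum_pow_mul_eq_zero (N := N) (a := fun k' => β k k' - γ k k')
      (fun y => ?_) (by omega)
    refine eq_zero_of_sum_pow_mul_eq_zero (N := N)
      (a := fun k => ∑ k' ∈ Finset.range N, y ^ k' * (β k k' - γ k k')) (fun x => ?_)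
      (k := (k : ℕ)) (by omega)
    simp only [mul_sub, Finset.sum_sub_distrib]
    rw [hβs, hγs, sub_self]
  simp only [hβ, hγ] at key
  rw [dif_pos ⟨hk, hk'⟩, sub_eq_zero] at key
  rw [ladderNorm_eq, ladderNorm_eq]
  have f1 : ((k : ℕ).factorial : ℂ) ≠ 0 := by exact_mod_cast (k : ℕ).factorial_ne_zero
  have f2 : ((k' : ℕ).factorial : ℂ) ≠ 0 := by exact_mod_cast (k' : ℕ).factorial_ne_zero
  field_simp at key
  rw [key]
  push_cast
  ring

/-- The normalisations in `blockUnit` cancel the ladder norms of `trace_tensorPow_ladder`. -/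
theorem trace_tensorPow_amplify {n l : ℕ} (hl : 2 * l ≤ n) (A : QubitOp)
    (X : Matrix (Fin (n - 2 * l + 1)) (Fin (n - 2 * l + 1)) ℂ) :
    Matrix.trace (tensorPow n A * amplify n (n - 2 * l) X) =
      (mult n (n - 2 * l) * A.det ^ l) * Matrix.trace (X * symPow (n - 2 * l) A) := by
  rw [amplify]
  have hX : Matrix.trace (X * symPow (n - 2 * l) A) =
      ∑ k, ∑ k', X k k' * symPow (n - 2 * l) A k' k := by
    simp only [Matrix.trace, Matrix.diag_apply, Matrix.mul_apply]
  simp only [hX, Finset.mul_sum, Matrix.trace_sum, Matrix.mul_smul, Matrix.trace_smul, blockUnit,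
    trace_tensorPow_ladder hl rfl, smul_eq_mul]
  refine Finset.sum_congr rfl fun k _ => Finset.sum_congr rfl fun k' _ => ?_
  have h : ∀ k : Fin (n - 2 * l + 1), (ladderNorm (n - 2 * l) k : ℂ) ≠ 0 := by
    intro k
    rw [ladderNorm_eq]
    push_cast
    exact mul_ne_zero (by exact_mod_cast (k : ℕ).factorial_ne_zero)
      (sqrt_choose_ne_zero (by omega))
  have h1 := h k
  have h2 := h k'
  push_cast
  field_simp

/-! ### Outcome densities of the two measurements in a block -/

/-- The quadratic form of the symmetric power of `B ρ⁰ B*`. -/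
def symForm (d : ℕ) (μ : ℝ) (B : QubitOp) (x : Fin (d + 1) → ℂ) : ℝ :=
  ∑ k : Fin (d + 1), μ ^ (d - (k : ℕ)) * (1 - μ) ^ (k : ℕ) * ‖(symPow d Bᴴ *ᵥ x) k‖ ^ 2

theorem star_dotProduct_symPow (d : ℕ) (μ : ℝ) (B : QubitOp) (x : Fin (d + 1) → ℂ) :
    star x ⬝ᵥ symPow d (B * rho0 μ * Bᴴ) *ᵥ x = symForm d μ B x := by
  rw [← symPow_mul, ← symPow_mul, ← Matrix.mulVec_mulVec, ← Matrix.mulVec_mulVec,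
    Matrix.dotProduct_mulVec, rho0, symPow_diagonal]
  have h : star x ᵥ* symPow d B = star (symPow d Bᴴ *ᵥ x) := by
    rw [Matrix.star_mulVec, ← symPow_conjTranspose, Matrix.conjTranspose_conjTranspose]
  rw [h, symForm, dotProduct]
  push_cast
  refine Finset.sum_congr rfl fun k _ => ?_
  rw [Matrix.mulVec_diagonal, Pi.star_apply, ← Complex.conj_mul', RCLike.star_def]
  ring

/-- `symPow` sends spin coherent vectors to spin coherent vectors, so the weighted sum is a binomial
expansion. -/
theorem symForm_spinCoherent (d : ℕ) (μ : ℝ) (B : QubitOp) (b : Fin 2 → ℂ) :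
    symForm d μ B (spinCoherent d b) =
      (μ * ‖(Bᴴ *ᵥ b) 0‖ ^ 2 + (1 - μ) * ‖(Bᴴ *ᵥ b) 1‖ ^ 2) ^ d := by
  rw [symForm, symPow_mulVec_spinCoherent, add_comm (μ * _), add_pow, Finset.sum_range]
  refine Finset.sum_congr rfl fun k _ => ?_
  simp only [spinCoherent, norm_mul, norm_pow, mul_pow, Complex.norm_real, Real.norm_eq_abs,
    sq_abs]
  rw [Real.sq_sqrt (by positivity)]
  ring

/-- The weight of the block with `d = n - 2 l`. -/
def blockWeight (μ : ℝ) (n l : ℕ) : ℝ := mult n (n - 2 * l) * (μ * (1 - μ)) ^ l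

/-- By cyclicity the rotation moves from the projection to the state. The corner entry of the
rotated qubit state is its expectation in the first column of `rotFromUp s`, and the `d`-th power of
that is the form at the spin coherent vector. -/
theorem trace_covDensity {n l : ℕ} (hl : 2 * l ≤ n) {μ : ℝ} {B : QubitOp} (hB : B * Bᴴ = 1)
    (s : ℝ × ℝ) :
    (Matrix.trace (tensorPow n (B * rho0 μ * Bᴴ) * covDensity n (n - 2 * l) s)).re =
      blockWeight μ n l * ((((n - 2 * l : ℕ) : ℝ) + 1) *
        symForm (n - 2 * l) μ B (spinCoherent (n - 2 * l) fun i => rotFromUp s i 0)) := by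
  set A := B * rho0 μ * Bᴴ with hA
  have hdetB : B.det * Bᴴ.det = 1 := by rw [← Matrix.det_mul, hB, Matrix.det_one]
  have hdetA : A.det = μ * (1 - μ) := by
    rw [hA, Matrix.det_mul, Matrix.det_mul, mul_right_comm, hdetB, one_mul, rho0,
      Matrix.det_fin_two]
    simp
  have hdetg : (rotFromUp s).det = 1 := by
    rw [rotFromUp, Matrix.det_fin_two_of]
    have h1 : Complex.exp (-Complex.I * s.2) * Complex.exp (Complex.I * s.2) = 1 := by
      rw [← Complex.exp_add]; simp
    have h2 : ((Real.cos (s.1 / 2) : ℝ) : ℂ) ^ 2 + ((Real.sin (s.1 / 2) : ℝ) : ℂ) ^ 2 = 1 := by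
      exact_mod_cast Real.cos_sq_add_sin_sq (s.1 / 2)
    linear_combination h2 + ((Real.sin (s.1 / 2) : ℝ) : ℂ) ^ 2 * h1
  have h0 : ((rotFromUp s)ᴴ * A * rotFromUp s) 0 0 =
      star (fun i => rotFromUp s i 0) ⬝ᵥ A *ᵥ fun i => rotFromUp s i 0 := by
    simp [Matrix.mul_apply, dotProduct, Matrix.mulVec, Fin.sum_univ_two]
    ring
  have h1 := trace_tensorPow_highestProj hl ((rotFromUp s)ᴴ * A * rotFromUp s)
  rw [h0, ← star_spinCoherent_dotProduct, ← symPow_mulVec_spinCoherent, hA,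
    star_dotProduct_symPow, ← hA, Matrix.det_mul, Matrix.det_mul, Matrix.det_conjTranspose, hdetg,
    star_one, one_mul, mul_one, hdetA] at h1
  rw [covDensity, Matrix.mul_smul, Matrix.trace_smul, ← mul_assoc, Matrix.trace_mul_comm,
    tensorPow_conjTranspose, ← mul_assoc, ← mul_assoc, tensorPow_mul, tensorPow_mul, h1,
    smul_eq_mul, blockWeight, ← Complex.ofReal_re (_ * (_ * _))]
  congr 1
  push_cast
  ring

/-- The vector `V_j* |z⟩`. -/
def truncCoherent (d : ℕ) (z : ℂ) : Fin (d + 1) → ℂ := fun k => coherent z k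

theorem inner_V_single (d : ℕ) (k : Fin (d + 1)) (x : Oscillator) :
    inner ℂ (V d (EuclideanSpace.single k 1)) x = x k := by
  have : V d (EuclideanSpace.single k 1) = lp.single 2 (k : ℕ) (1 : ℂ) := by
    simp only [V, LinearMap.coe_toContinuousLinearMap', LinearMap.coe_mk, AddHom.coe_mk]
    rw [Finset.sum_eq_single k]
    · simp
    · intro j _ hj; simp [hj]
    · simp
  rw [this, lp.inner_single_left]
  simp

/-- The adjoint of `V d` only cuts off the coefficients beyond `d`, so compressing the rank-one
density gives the rank-one operator of the truncated coherent vector. -/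
theorem trace_hetDensity {n l : ℕ} (hl : 2 * l ≤ n) {μ : ℝ} {B : QubitOp} (hB : B * Bᴴ = 1)
    (u : ℝ × ℝ) :
    (Matrix.trace (tensorPow n (B * rho0 μ * Bᴴ) * hetDensity μ n (n - 2 * l) u)).re =
      blockWeight μ n l * ((2 * μ - 1) / Real.pi * symForm (n - 2 * l) μ B
        (truncCoherent (n - 2 * l) ((√(2 * μ - 1) : ℂ) * alpha u))) := by
  set A := B * rho0 μ * Bᴴ with hA
  have hdetB : B.det * Bᴴ.det = 1 := by rw [← Matrix.det_mul, hB, Matrix.det_one]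
  have hdetA : A.det = μ * (1 - μ) := by
    rw [hA, Matrix.det_mul, Matrix.det_mul, mul_right_comm, hdetB, one_mul, rho0,
      Matrix.det_fin_two]
    simp
  rw [hetDensity, trace_tensorPow_amplify hl, hdetA, blockWeight]
  set d := n - 2 * l with hd
  set z := (√(2 * μ - 1) : ℂ) * alpha u with hz
  have hX : ∀ k k' : Fin (d + 1), (Matrix.toEuclideanCLM (𝕜 := ℂ)).symm
      ((V d).adjoint ∘L heterodyne μ u ∘L V d) k k' = (((2 * μ - 1) / Real.pi : ℝ) : ℂ) *
        (truncCoherent d z k * star (truncCoherent d z k')) := by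
    intro k k'
    set Y := (Matrix.toEuclideanCLM (𝕜 := ℂ)).symm
      ((V d).adjoint ∘L heterodyne μ u ∘L V d) with hY
    have h1 : Y k k' = inner ℂ (EuclideanSpace.single k (1 : ℂ))
        (Matrix.toEuclideanCLM (𝕜 := ℂ) Y (EuclideanSpace.single k' 1)) := by
      rw [EuclideanSpace.inner_single_left]
      simp [Matrix.ofLp_toEuclideanCLM]
    rw [h1, hY, StarAlgEquiv.apply_symm_apply]
    simp only [ContinuousLinearMap.comp_apply, ContinuousLinearMap.adjoint_inner_right]
    rw [inner_V_single, heterodyne]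
    simp only [_root_.smul_apply, InnerProductSpace.rankOne_apply, lp.coeFn_smul,
      Pi.smul_apply, smul_eq_mul]
    rw [← inner_conj_symm, inner_V_single]
    simp only [truncCoherent, RCLike.star_def, ← hz]
    ring
  have h2 : Matrix.trace ((Matrix.toEuclideanCLM (𝕜 := ℂ)).symm
      ((V d).adjoint ∘L heterodyne μ u ∘L V d) * symPow d A) =
      (((2 * μ - 1) / Real.pi : ℝ) : ℂ) * symForm d μ B (truncCoherent d z) := by
    rw [← star_dotProduct_symPow, ← hA, Matrix.trace, dotProduct]
    simp only [Matrix.diag_apply, Matrix.mul_apply, hX, Matrix.mulVec, dotProduct, Finset.mul_sum,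
      Pi.star_apply]
    rw [Finset.sum_comm]
    exact Finset.sum_congr rfl fun k _ => Finset.sum_congr rfl fun k' _ => by ring
  rw [h2, ← Complex.ofReal_re (_ * (_ / _ * _))]
  congr 1
  push_cast
  ring

/-! ### Multiplicities of the blocks -/

theorem star_dotProduct_self {ι : Type*} [Fintype ι] (v : ι → ℂ) :
    star v ⬝ᵥ v = ((∑ i, ‖v i‖ ^ 2 : ℝ) : ℂ) := by
  simp [dotProduct, Complex.conj_mul']

theorem Splus_apply_eq_zero {n : ℕ} {x y : Fin n → Fin 2} (h : wt y ≠ wt x + 1) :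
    Splus n x y = 0 := by
  have h1 : Sz n * Splus n - Splus n * Sz n = Splus n := by
    rw [Splus_eq, Sz, collective_commutator]
    congr 1
    ext i j; fin_cases i <;> fin_cases j <;> simp [σp, σz]
    norm_num
  have h2 := congrFun (congrFun h1 x) y
  simp only [Matrix.sub_apply, Matrix.mul_apply, Sz_apply, ite_mul, mul_ite, zero_mul, mul_zero,
    Finset.sum_ite_eq, Finset.sum_ite_eq', Finset.mem_univ, if_true] at h2
  by_contra h0
  have h3 : (wt y : ℂ) = wt x + 1 := mul_right_cancel₀ h0 (by linear_combination h2)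
  exact h (by exact_mod_cast h3)

theorem Sminus_apply (n : ℕ) (x y : Fin n → Fin 2) : Sminus n x y = star (Splus n y x) := by
  rw [← Splus_conjTranspose, Matrix.conjTranspose_apply]

/-- On vectors with `l - 1` spins down the commutation relation gives `‖S₋ w‖² = ‖S₊ w‖² + (n - 2l +
2) ‖w‖²`, and the coefficient is positive because `2l ≤ n`. -/
theorem eq_zero_of_Sminus_mulVec {n l : ℕ} (hl : 2 * l ≤ n) {w : (Fin n → Fin 2) → ℂ}
    (hw : ∀ x, wt x + 1 ≠ l → w x = 0) (h : Sminus n *ᵥ w = 0) : w = 0 := by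
  have h1 : star w ⬝ᵥ (Splus n * Sminus n) *ᵥ w = 0 := by
    rw [← Matrix.mulVec_mulVec, h]; simp
  have h2 : Sz n *ᵥ w = ((n : ℂ) / 2 - l + 1) • w := by
    ext x
    simp only [Matrix.mulVec, dotProduct, Sz_apply, ite_mul, zero_mul, Finset.sum_ite_eq,
      Finset.mem_univ, if_true, Pi.smul_apply, smul_eq_mul]
    by_cases hx : wt x + 1 = l
    · rw [← hx]; push_cast; ring
    · simp [hw x hx]
  have h3 : star w ⬝ᵥ (Sminus n * Splus n) *ᵥ w = star (Splus n *ᵥ w) ⬝ᵥ (Splus n *ᵥ w) := by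
    rw [← Matrix.mulVec_mulVec, Matrix.dotProduct_mulVec, Matrix.star_mulVec, Splus_conjTranspose]
  rw [Splus_mul_Sminus, Matrix.add_mulVec, dotProduct_add, h3, Matrix.smul_mulVec, h2, smul_smul,
    dotProduct_smul, star_dotProduct_self, star_dotProduct_self, smul_eq_mul] at h1
  have h4 : ∑ i, ‖(Splus n *ᵥ w) i‖ ^ 2 + ((n : ℝ) - 2 * l + 2) * ∑ i, ‖w i‖ ^ 2 = 0 := by
    rw [← Complex.ofReal_inj]
    push_cast at h1 ⊢
    linear_combination h1
  have h5 : 0 ≤ ∑ i, ‖(Splus n *ᵥ w) i‖ ^ 2 := Finset.sum_nonneg fun i _ => by positivity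
  have h6 : 0 ≤ ∑ i, ‖w i‖ ^ 2 := Finset.sum_nonneg fun i _ => by positivity
  have h7 : (2 * l : ℝ) ≤ n := by exact_mod_cast hl
  have h8 : ∑ i, ‖w i‖ ^ 2 = 0 := by nlinarith
  rw [Finset.sum_eq_zero_iff_of_nonneg fun i _ => by positivity] at h8
  ext i
  simpa using h8 i (Finset.mem_univ i)

/-- Extension by zero from the basis vectors with `p`. -/
def extendZero {n : ℕ} (p : (Fin n → Fin 2) → Prop) [DecidablePred p] :
    ({x // p x} → ℂ) →ₗ[ℂ] EuclideanSpace ℂ (Fin n → Fin 2) where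
  toFun v := WithLp.toLp 2 fun x => if h : p x then v ⟨x, h⟩ else 0
  map_add' v w := by ext x; by_cases h : p x <;> simp [h]
  map_smul' c v := by ext x; by_cases h : p x <;> simp [h]

theorem mulVec_extendZero {n : ℕ} (p : (Fin n → Fin 2) → Prop) [DecidablePred p] (A : SpinOp n)
    (v : {x // p x} → ℂ) (x : Fin n → Fin 2) :
    (A *ᵥ (extendZero p v).ofLp) x = ∑ y : {y // p y}, A x y * v y := by
  simp only [Matrix.mulVec, dotProduct, extendZero, LinearMap.coe_mk, AddHom.coe_mk]
  rw [← Fintype.sum_subtype_add_sum_subtype p]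
  have h : ∑ y : {y // ¬ p y}, A x y * (if h : p y then v ⟨y, h⟩ else 0) = 0 :=
    Finset.sum_eq_zero fun y _ => by simp [y.2]
  rw [h, add_zero]
  exact Finset.sum_congr rfl fun y _ => by simp [y.2]

open scoped ComplexOrder in
-- Rank-nullity for `S₊` from `l` spins down to `l - 1`: its kernel is the highest weight space, and
-- it is onto since its adjoint `S₋` is injective there. Writing `wt x + 1 = l` makes the target
-- empty for `l = 0`.
theorem mult_add_card {n l : ℕ} (hl : 2 * l ≤ n) :
    mult n (n - 2 * l) + Fintype.card {x : Fin n → Fin 2 // wt x + 1 = l} = n.choose l := by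
  classical
  set B : Matrix {x : Fin n → Fin 2 // wt x + 1 = l} {x : Fin n → Fin 2 // wt x = l} ℂ :=
    (Splus n).submatrix Subtype.val Subtype.val with hB
  have hrank : Module.finrank ℂ (LinearMap.range B.mulVecLin) =
      Fintype.card {x : Fin n → Fin 2 // wt x + 1 = l} := by
    change B.rank = _
    rw [← Matrix.rank_conjTranspose, Matrix.rank, LinearMap.finrank_range_of_inj,
      Module.finrank_fintype_fun_eq_card]
    rw [← LinearMap.ker_eq_bot, LinearMap.ker_eq_bot']
    intro w hw
    have h0 : (extendZero (fun x : Fin n → Fin 2 => wt x + 1 = l) w).ofLp = 0 := by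
      refine eq_zero_of_Sminus_mulVec hl (fun x hx => by simp [extendZero, hx]) ?_
      ext y
      rw [mulVec_extendZero]
      by_cases hy : wt y = l
      · have := congrFun hw ⟨y, hy⟩
        simpa [Matrix.mulVec, dotProduct, hB, Sminus_apply] using this
      · refine Finset.sum_eq_zero fun x _ => ?_
        rw [Sminus_apply, Splus_apply_eq_zero, star_zero, zero_mul]
        rw [x.2]; exact hy
    ext x
    have := congrFun h0 x
    simpa [extendZero, x.2] using this
  have hinj : Function.Injective (extendZero fun x : Fin n → Fin 2 => wt x = l) := by
    intro v w hvw
    ext x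
    have := congrArg (fun f => f.ofLp x.1) hvw
    simpa [extendZero, x.2] using this
  have hmap : Submodule.map (extendZero fun x : Fin n → Fin 2 => wt x = l)
      (LinearMap.ker B.mulVecLin) = highestWeight n (n - 2 * l) := by
    ext v
    rw [Submodule.mem_map]
    constructor
    · rintro ⟨w, hw, rfl⟩
      refine mem_highestWeight_iff.2 ⟨?_, ?_⟩
      · ext x
        simp only [Matrix.mulVec, dotProduct, Sz_apply, ite_mul, zero_mul, Finset.sum_ite_eq,
          Finset.mem_univ, if_true, Pi.smul_apply, smul_eq_mul]
        by_cases hx : wt x = l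
        · congr 1; rw [hx, Nat.cast_sub hl]; push_cast; ring
        · simp [hx]
      · ext x
        refine (mulVec_extendZero _ _ _ _).trans ?_
        by_cases hx : wt x + 1 = l
        · have := congrFun (LinearMap.mem_ker.1 hw) ⟨x, hx⟩
          simpa [Matrix.mulVec, dotProduct, hB] using this
        · refine Finset.sum_eq_zero fun y _ => ?_
          rw [Splus_apply_eq_zero, zero_mul]
          rw [y.2]; exact fun h => hx h.symm
    · intro hv
      obtain ⟨hz, hp⟩ := mem_highestWeight_iff.1 (show WithLp.toLp 2 v.ofLp ∈ _ from hv)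
      have hsupp : ∀ x, wt x ≠ l → v.ofLp x = 0 := by
        intro x hx
        have := congrFun hz x
        simp only [Matrix.mulVec, dotProduct, Sz_apply, ite_mul, zero_mul, Finset.sum_ite_eq,
          Finset.mem_univ, if_true, Pi.smul_apply, smul_eq_mul] at this
        by_contra h0
        have h1 := mul_right_cancel₀ h0 this
        rw [Nat.cast_sub hl] at h1
        push_cast at h1
        have h2 : (wt x : ℂ) = l := by linear_combination -h1
        exact hx (by exact_mod_cast h2)
      have hext : extendZero (fun x : Fin n → Fin 2 => wt x = l) (fun x => v.ofLp x.1) = v := by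
        ext x
        by_cases hx : wt x = l
        · simp [extendZero, hx]
        · simp [extendZero, hx, hsupp x hx]
      refine ⟨fun x => v.ofLp x.1, LinearMap.mem_ker.2 ?_, hext⟩
      ext x
      have := congrFun hp x.1
      rw [← hext, mulVec_extendZero] at this
      simpa [Matrix.mulVec, dotProduct, hB] using this
  have hker : mult n (n - 2 * l) = Module.finrank ℂ (LinearMap.ker B.mulVecLin) := by
    rw [mult, ← hmap]
    exact (Submodule.equivMapOfInjective _ hinj _).symm.finrank_eq
  have := LinearMap.finrank_range_add_finrank_ker B.mulVecLin
  rw [hrank, Module.finrank_fintype_fun_eq_card, ← hker, Fintype.card_subtype (fun x => wt x = l),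
    card_wt_eq] at this
  omega

theorem mult_zero (n : ℕ) : mult n n = 1 := by
  have := mult_add_card (n := n) (l := 0) (by omega)
  simpa using this

theorem mult_succ {n l : ℕ} (hl : 2 * (l + 1) ≤ n) :
    mult n (n - 2 * (l + 1)) + n.choose l = n.choose (l + 1) := by
  have := mult_add_card hl
  simpa [Fintype.card_subtype, card_wt_eq] using this

/-! ### The distribution of the block label -/

/-- The trace of the `d`-th symmetric power of `diag (a, b)`. -/
def symTrace (d : ℕ) (a b : ℝ) : ℝ := ∑ k ∈ Finset.range (d + 1), a ^ (d - k) * b ^ k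

theorem symTrace_add_two (d : ℕ) (a b : ℝ) :
    symTrace (d + 2) a b = a ^ (d + 2) + b ^ (d + 2) + a * b * symTrace d a b := by
  rw [symTrace, Finset.sum_range_succ, Finset.sum_range_succ', symTrace, Finset.mul_sum]
  have h : ∑ k ∈ Finset.range (d + 1), a ^ (d + 2 - (k + 1)) * b ^ (k + 1) =
      ∑ k ∈ Finset.range (d + 1), a * b * (a ^ (d - k) * b ^ k) := by
    refine Finset.sum_congr rfl fun k hk => ?_
    rw [Finset.mem_range] at hk
    rw [show d + 2 - (k + 1) = (d - k) + 1 by omega]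
    ring
  rw [h]
  simp
  ring

theorem sub_mul_symTrace (d : ℕ) (a b : ℝ) :
    (a - b) * symTrace d a b = a ^ (d + 1) - b ^ (d + 1) := by
  have := (Commute.all b a).geom_sum₂_mul (d + 1)
  have h : symTrace d a b = ∑ i ∈ Finset.range (d + 1), b ^ i * a ^ (d + 1 - 1 - i) :=
    Finset.sum_congr rfl fun k _ => by rw [mul_comm]; rfl
  rw [h]
  linear_combination -this

theorem pow_le_symTrace (d : ℕ) {a b : ℝ} (ha : 0 ≤ a) (hb : 0 ≤ b) : a ^ d ≤ symTrace d a b := by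
  have := Finset.single_le_sum (f := fun k => a ^ (d - k) * b ^ k) (s := Finset.range (d + 1))
    (fun k _ => by positivity) (Finset.mem_range.2 (Nat.succ_pos d))
  simpa [symTrace] using this

/-- Summation by parts: multiplicities are differences of binomial coefficients, and lowering `d` by
two splits the two extreme powers off the trace. -/
theorem sum_mult_mul_symTrace_aux {n : ℕ} (a b : ℝ) (L : ℕ) (hL : 2 * L ≤ n) :
    ∑ l ∈ Finset.range (L + 1), (mult n (n - 2 * l) : ℝ) * (a * b) ^ l * symTrace (n - 2 * l) a b =
      ∑ i ∈ Finset.range L, (n.choose i : ℝ) * (a ^ (n - i) * b ^ i + a ^ i * b ^ (n - i)) +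
        n.choose L * (a * b) ^ L * symTrace (n - 2 * L) a b := by
  induction L with
  | zero => simp [mult_zero]
  | succ L ih =>
    rw [Finset.sum_range_succ, ih (by omega), Finset.sum_range_succ _ L]
    have h1 : n - 2 * L = (n - 2 * (L + 1)) + 2 := by omega
    have h2 : (mult n (n - 2 * (L + 1)) : ℝ) + n.choose L = n.choose (L + 1) := by
      exact_mod_cast mult_succ hL
    rw [h1, symTrace_add_two, ← h2]
    have h3 : n - L = (n - 2 * (L + 1) + 2) + L := by omega
    rw [h3]
    ring

/-- The binomial theorem with the terms `i` and `n - i` paired. For `b = 1 - a` it says that the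
block probabilities add up to one. -/
theorem sum_mult_mul_symTrace (n : ℕ) (a b : ℝ) :
    ∑ l ∈ Finset.range (n / 2 + 1),
      (mult n (n - 2 * l) : ℝ) * (a * b) ^ l * symTrace (n - 2 * l) a b = (a + b) ^ n := by
  set L := n / 2 with hL
  rw [sum_mult_mul_symTrace_aux a b L (by omega), add_comm a b, add_pow]
  have hrefl : ∑ i ∈ Finset.range L, (n.choose i : ℝ) * (a ^ i * b ^ (n - i)) =
      ∑ i ∈ Finset.range L, b ^ (n + 1 - L + i) * a ^ (n - (n + 1 - L + i)) *
        (n.choose (n + 1 - L + i) : ℝ) := by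
    rw [← Finset.sum_range_reflect]
    refine Finset.sum_congr rfl fun i hi => ?_
    rw [Finset.mem_range] at hi
    rw [← Nat.choose_symm (show L - 1 - i ≤ n by omega),
      show n - (L - 1 - i) = n + 1 - L + i by omega,
      show n - (n + 1 - L + i) = L - 1 - i by omega]
    ring
  have hsplit : n + 1 = (n + 1 - L) + L := by omega
  simp only [mul_add, Finset.sum_add_distrib]
  rw [hrefl, hsplit, Finset.sum_range_add, ← hsplit]
  -- The last block has `d = 0` or `d = 1`; it supplies the one or two central binomial terms.
  rcases Nat.even_or_odd' n with ⟨c, hc | hc⟩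
  · rw [show n + 1 - L = L + 1 by omega, Finset.sum_range_succ _ L,
      show n - 2 * L = 0 by omega, show n - L = L by omega]
    simp [symTrace]
    have : ∀ i, (n.choose i : ℝ) * (a ^ (n - i) * b ^ i) = b ^ i * a ^ (n - i) * n.choose i := by
      intro i; ring
    simp only [this]
    ring
  · rw [show n + 1 - L = L + 1 + 1 by omega, Finset.sum_range_succ _ (L + 1),
      Finset.sum_range_succ _ L, show n - 2 * L = 1 by omega, show n - L = L + 1 by omega,
      show n - (L + 1) = L by omega, ← Nat.choose_symm (show L + 1 ≤ n by omega),
      show n - (L + 1) = L by omega]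
    simp [symTrace, Finset.sum_range_succ]
    have : ∀ i, (n.choose i : ℝ) * (a ^ (n - i) * b ^ i) = b ^ i * a ^ (n - i) * n.choose i := by
      intro i; ring
    simp only [this]
    ring

theorem blockWeight_nonneg {μ : ℝ} (h0 : 0 ≤ μ) (h1 : μ ≤ 1) (n l : ℕ) : 0 ≤ blockWeight μ n l := by
  have : 0 ≤ 1 - μ := by linarith
  rw [blockWeight]; positivity

theorem sum_blockWeight_mul_symTrace (μ : ℝ) (n : ℕ) :
    ∑ l ∈ Finset.range (n / 2 + 1), blockWeight μ n l * symTrace (n - 2 * l) μ (1 - μ) = 1 := by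
  have := sum_mult_mul_symTrace n μ (1 - μ)
  simpa [blockWeight] using this

theorem symTrace_le {μ : ℝ} (hμ : 1 / 2 < μ) (h1 : μ ≤ 1) (d : ℕ) :
    symTrace d μ (1 - μ) ≤ μ ^ d / (2 * μ - 1) := by
  have h := sub_mul_symTrace d μ (1 - μ)
  have h2 : 0 ≤ (1 - μ) ^ (d + 1) := pow_nonneg (by linarith) _
  have h3 : μ ^ (d + 1) ≤ μ ^ d := pow_le_pow_of_le_one (by linarith) h1 (by omega)
  rw [le_div_iff₀ (by linarith)]
  nlinarith

theorem blockWeight_mul_pow_le {μ : ℝ} (h0 : 0 ≤ μ) (h1 : μ ≤ 1) {n l : ℕ} (hl : 2 * l ≤ n) :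
    blockWeight μ n l * μ ^ (n - 2 * l) ≤ n.choose l * (1 - μ) ^ l * μ ^ (n - l) := by
  have h2 : 0 ≤ 1 - μ := by linarith
  have hm : (mult n (n - 2 * l) : ℝ) ≤ n.choose l := by
    exact_mod_cast le_of_le_of_eq (Nat.le_add_right _ _) (mult_add_card hl)
  rw [blockWeight, show n - l = l + (n - 2 * l) by omega, pow_add, mul_pow]
  calc _ = (mult n (n - 2 * l) : ℝ) * ((1 - μ) ^ l * (μ ^ l * μ ^ (n - 2 * l))) := by ring
    _ ≤ n.choose l * ((1 - μ) ^ l * (μ ^ l * μ ^ (n - 2 * l))) := by gcongr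
    _ = _ := by ring

/-- Block `l` has probability at most `1 / (2μ - 1)` times the binomial probability of `l` spins
down. The deviation of `d / n` is twice that of `l / n`, hence the `4` in Chebyshev's inequality;
the variance of `l / n` is bounded by `1 / n`. -/
theorem sum_blockWeight_tail_le {μ : ℝ} (hμ : 1 / 2 < μ) (h1 : μ ≤ 1) {n : ℕ} (hn : n ≠ 0)
    {δ : ℝ} (hδ : 0 < δ) :
    ∑ l ∈ (Finset.range (n / 2 + 1)).filter
        (fun l => δ ≤ |((n - 2 * l : ℕ) : ℝ) / n - (2 * μ - 1)|),
      blockWeight μ n l * symTrace (n - 2 * l) μ (1 - μ) ≤ 4 / (δ ^ 2 * n * (2 * μ - 1)) := by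
  have h2 : 0 ≤ 1 - μ := by linarith
  have hc : 0 < 2 * μ - 1 := by linarith
  have hn0 : (0 : ℝ) < n := by exact_mod_cast Nat.pos_of_ne_zero hn
  -- The Bernstein basis at `1 - μ` is the binomial law of the number of spins down.
  have hvar := bernstein.variance hn ⟨1 - μ, h2, by linarith⟩
  simp only [bernstein_apply] at hvar
  have hterm : ∀ l ∈ (Finset.range (n / 2 + 1)).filter
        (fun l => δ ≤ |((n - 2 * l : ℕ) : ℝ) / n - (2 * μ - 1)|),
      blockWeight μ n l * symTrace (n - 2 * l) μ (1 - μ) ≤ 4 / (δ ^ 2 * (2 * μ - 1)) *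
        ((1 - μ - (l : ℝ) / n) ^ 2 * (n.choose l * (1 - μ) ^ l * (1 - (1 - μ)) ^ (n - l))) := by
    intro l hl
    rw [Finset.mem_filter, Finset.mem_range] at hl
    obtain ⟨hl, hd⟩ := hl
    have hl2 : 2 * l ≤ n := by omega
    have e : ((n - 2 * l : ℕ) : ℝ) / n - (2 * μ - 1) = 2 * (1 - μ - (l : ℝ) / n) := by
      rw [Nat.cast_sub hl2]; push_cast; field_simp; ring
    rw [e] at hd
    have hsq : δ ^ 2 ≤ 4 * (1 - μ - (l : ℝ) / n) ^ 2 := by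
      have := pow_le_pow_left₀ hδ.le hd 2
      rw [sq_abs] at this
      linarith
    have hb : 0 ≤ (n.choose l : ℝ) * (1 - μ) ^ l * μ ^ (n - l) := by positivity
    calc blockWeight μ n l * symTrace (n - 2 * l) μ (1 - μ)
        ≤ blockWeight μ n l * (μ ^ (n - 2 * l) / (2 * μ - 1)) :=
          mul_le_mul_of_nonneg_left (symTrace_le hμ h1 _)
            (blockWeight_nonneg (by linarith) h1 _ _)
      _ = blockWeight μ n l * μ ^ (n - 2 * l) / (2 * μ - 1) := by ring
      _ ≤ n.choose l * (1 - μ) ^ l * μ ^ (n - l) / (2 * μ - 1) := by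
          exact div_le_div_of_nonneg_right (blockWeight_mul_pow_le (by linarith) h1 hl2) hc.le
      _ = δ ^ 2 * (n.choose l * (1 - μ) ^ l * μ ^ (n - l)) / (δ ^ 2 * (2 * μ - 1)) := by
          field_simp
      _ ≤ 4 * (1 - μ - (l : ℝ) / n) ^ 2 * (n.choose l * (1 - μ) ^ l * μ ^ (n - l)) /
            (δ ^ 2 * (2 * μ - 1)) := by gcongr
      _ = _ := by rw [sub_sub_cancel]; ring
  refine (Finset.sum_le_sum hterm).trans ?_
  rw [← Finset.mul_sum]
  have hsum : ∑ l ∈ (Finset.range (n / 2 + 1)).filter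
        (fun l => δ ≤ |((n - 2 * l : ℕ) : ℝ) / n - (2 * μ - 1)|),
      (1 - μ - (l : ℝ) / n) ^ 2 * (n.choose l * (1 - μ) ^ l * (1 - (1 - μ)) ^ (n - l)) ≤ 1 / (n : ℝ) := by
    refine (Finset.sum_le_sum_of_subset_of_nonneg (t := Finset.range (n + 1)) ?_ ?_).trans ?_
    · intro l hl
      rw [Finset.mem_filter, Finset.mem_range] at hl
      rw [Finset.mem_range]; omega
    · intro l _ _
      rw [sub_sub_cancel]
      have : 0 ≤ μ := by linarith
      positivity
    · rw [Finset.sum_range (n := n + 1)]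
      have : ∑ i : Fin (n + 1), (1 - μ - ((i : ℕ) : ℝ) / n) ^ 2 *
          ((n.choose i : ℝ) * (1 - μ) ^ (i : ℕ) * (1 - (1 - μ)) ^ (n - (i : ℕ))) =
          (1 - μ) * (1 - (1 - μ)) / n := hvar
      refine this.trans_le (div_le_div_of_nonneg_right ?_ hn0.le)
      nlinarith
  calc _ ≤ 4 / (δ ^ 2 * (2 * μ - 1)) * (1 / n) := by gcongr
    _ = _ := by field_simp

/-! ### The rotations `U u` -/

/-- The Euclidean norm on `ℝ × ℝ`. -/
def euclid (u : ℝ × ℝ) : ℝ := √(u.1 ^ 2 + u.2 ^ 2)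

theorem euclid_sq (u : ℝ × ℝ) : euclid u ^ 2 = u.1 ^ 2 + u.2 ^ 2 := Real.sq_sqrt (by positivity)

theorem euclid_nonneg (u : ℝ × ℝ) : 0 ≤ euclid u := Real.sqrt_nonneg _

theorem continuous_euclid : Continuous euclid := by unfold euclid; fun_prop

theorem continuous_alpha : Continuous alpha := by unfold alpha; fun_prop

theorem conj_alpha_mul_alpha (u : ℝ × ℝ) :
    (starRingEnd ℂ) (alpha u) * alpha u = (euclid u : ℂ) ^ 2 := by
  rw [← Complex.ofReal_pow, euclid_sq]
  simp [alpha]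
  linear_combination (-(u.1 : ℂ) ^ 2) * Complex.I_sq

theorem norm_alpha (u : ℝ × ℝ) : ‖alpha u‖ = euclid u := by
  have h := conj_alpha_mul_alpha u
  rw [Complex.conj_mul'] at h
  have h2 : ‖alpha u‖ ^ 2 = euclid u ^ 2 := by exact_mod_cast h
  exact (sq_eq_sq₀ (norm_nonneg _) (euclid_nonneg _)).1 h2

theorem mul_sinc (x : ℝ) : x * Real.sinc x = Real.sin x := by
  by_cases h : x = 0
  · simp [h]
  · rw [Real.sinc_of_ne_zero h]; field_simp

/-- The exponent has eigenvalues `± i |u|`, so it can be diagonalised away from `u = 0`. The form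
with `sinc` is also valid at `0`. -/
theorem U_eq (u : ℝ × ℝ) :
    U u = !![(Real.cos (euclid u) : ℂ), -(starRingEnd ℂ) (alpha u) * (Real.sinc (euclid u) : ℂ);
      alpha u * (Real.sinc (euclid u) : ℂ), (Real.cos (euclid u) : ℂ)] := by
  have hX : Complex.I • ((u.1 : ℂ) • σx + (u.2 : ℂ) • σy) =
      !![0, -(starRingEnd ℂ) (alpha u); alpha u, 0] := by
    ext i j
    fin_cases i <;> fin_cases j <;> simp [σx, σy, alpha] <;> ring_nf <;> simp <;> ring
  rw [U, hX]
  by_cases h0 : euclid u = 0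
  · have ha : alpha u = 0 := by rw [← norm_eq_zero, norm_alpha, h0]
    have hz : (!![0, -(starRingEnd ℂ) (alpha u); alpha u, 0] : QubitOp) = 0 := by
      ext i j; fin_cases i <;> fin_cases j <;> simp [ha]
    rw [hz, NormedSpace.exp_zero, h0, ha]
    ext i j; fin_cases i <;> fin_cases j <;> simp
  · have hr : (euclid u : ℂ) ≠ 0 := by exact_mod_cast h0
    have ha : alpha u ≠ 0 := by rw [← norm_ne_zero_iff, norm_alpha]; exact h0
    set r := euclid u with hrdef
    set a := alpha u with hadef
    have haa : (starRingEnd ℂ) a * a = (r : ℂ) ^ 2 := conj_alpha_mul_alpha u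
    have hI := Complex.I_sq
    -- The columns are eigenvectors of the exponent for `i r` and `-i r`.
    set P : QubitOp := !![(r : ℂ), r; -Complex.I * a, Complex.I * a] with hP
    have hdet : P.det ≠ 0 := by
      rw [hP, Matrix.det_fin_two_of]
      have : (r : ℂ) * (Complex.I * a) - r * (-Complex.I * a) = 2 * Complex.I * r * a := by ring
      rw [this]
      exact mul_ne_zero (mul_ne_zero (mul_ne_zero two_ne_zero Complex.I_ne_zero) hr) ha
    have hunit : IsUnit P := (Matrix.isUnit_iff_isUnit_det P).2 (isUnit_iff_ne_zero.2 hdet)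
    have hunit' : IsUnit P.det := isUnit_iff_ne_zero.2 hdet
    have hD : (!![0, -(starRingEnd ℂ) a; a, 0] : QubitOp) * P =
        P * Matrix.diagonal ![Complex.I * r, -Complex.I * r] := by
      ext i j
      fin_cases i <;> fin_cases j <;> simp [hP, Matrix.mul_apply, Fin.sum_univ_two]
      · linear_combination Complex.I * haa
      · linear_combination Complex.I * haa
      · linear_combination (a * r) * hI
      · linear_combination (a * r) * hI
    have hE : (!![(Real.cos r : ℂ), -(starRingEnd ℂ) a * (Real.sinc r : ℂ);
        a * (Real.sinc r : ℂ), (Real.cos r : ℂ)] : QubitOp) * P =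
        P * Matrix.diagonal ![Complex.exp (Complex.I * r), Complex.exp (-Complex.I * r)] := by
      have h1 : Complex.exp (Complex.I * r) = Real.cos r + Complex.I * (r * Real.sinc r) := by
        rw [mul_comm, Complex.exp_mul_I, ← Complex.ofReal_mul, mul_sinc]
        push_cast; ring
      have h2 : Complex.exp (-Complex.I * r) = Real.cos r - Complex.I * (r * Real.sinc r) := by
        rw [neg_mul, mul_comm, ← neg_mul, Complex.exp_mul_I, ← Complex.ofReal_mul, mul_sinc,
          Complex.cos_neg, Complex.sin_neg]
        push_cast; ring
      rw [h1, h2]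
      ext i j
      fin_cases i <;> fin_cases j <;> simp [hP, Matrix.mul_apply, Fin.sum_univ_two]
      · linear_combination (Complex.I * Real.sinc r) * haa
      · linear_combination (-Complex.I * Real.sinc r) * haa
      · linear_combination (a * r * Real.sinc r) * hI
      · linear_combination (a * r * Real.sinc r) * hI
    have hexp : Matrix.diagonal (NormedSpace.exp ![Complex.I * (r : ℂ), -Complex.I * r]) =
        Matrix.diagonal ![Complex.exp (Complex.I * r), Complex.exp (-Complex.I * r)] := by
      congr 1
      ext i
      rw [Pi.coe_exp]
      fin_cases i <;> simp [Complex.exp_eq_exp_ℂ]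
    rw [← Matrix.mul_nonsing_inv_cancel_right P !![0, -(starRingEnd ℂ) a; a, 0] hunit', hD,
      Matrix.exp_conj _ _ hunit, Matrix.exp_diagonal, hexp, ← hE,
      Matrix.mul_nonsing_inv_cancel_right P _ hunit']

theorem U_mul_conjTranspose (u : ℝ × ℝ) : U u * (U u)ᴴ = 1 := by
  have h : (Real.cos (euclid u) : ℂ) ^ 2 +
      (starRingEnd ℂ) (alpha u) * alpha u * (Real.sinc (euclid u) : ℂ) ^ 2 = 1 := by
    rw [conj_alpha_mul_alpha, ← mul_pow, ← Complex.ofReal_mul, mul_sinc]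
    exact_mod_cast Real.cos_sq_add_sin_sq (euclid u)
  rw [U_eq]
  ext i j
  fin_cases i <;> fin_cases j <;> simp [Matrix.mul_apply, Fin.sum_univ_two, Matrix.conjTranspose_apply, -Complex.ofReal_cos]
  · linear_combination h
  · ring
  · ring
  · linear_combination h

theorem continuous_U : Continuous U := by
  have h : U = fun u => !![(Real.cos (euclid u) : ℂ),
      -(starRingEnd ℂ) (alpha u) * (Real.sinc (euclid u) : ℂ);
      alpha u * (Real.sinc (euclid u) : ℂ), (Real.cos (euclid u) : ℂ)] := funext U_eq
  have he := continuous_euclid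
  have ha := continuous_alpha
  have hs := Real.continuous_sinc.comp he
  rw [h]
  refine continuous_matrix fun i j => ?_
  fin_cases i <;> fin_cases j <;> simp
  · fun_prop
  · exact ((Complex.continuous_conj.comp ha).mul (Complex.continuous_ofReal.comp hs)).neg
  · exact ha.mul (Complex.continuous_ofReal.comp hs)
  · fun_prop

theorem continuous_hetEstimate (n d : ℕ) : Continuous (hetEstimate n d) := by
  have h : Continuous fun u : ℝ × ℝ => U ((√(n : ℝ))⁻¹ • u) :=
    continuous_U.comp (continuous_const_smul _)
  exact (h.matrix_mul continuous_const).matrix_mul h.matrix_conjTranspose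

theorem continuous_covEstimate (n d : ℕ) : Continuous (covEstimate n d) := by
  unfold covEstimate
  fun_prop

/-! ### From polar coordinates on the sphere to the plane -/

/-- The point `u` of the plane such that the rotation `U (u / √n)` takes the north pole to `s`. -/
def sphereToPlane (n : ℕ) (s : ℝ × ℝ) : ℝ × ℝ :=
  (√(n : ℝ) * s.1 / 2 * Real.sin s.2, -(√(n : ℝ) * s.1 / 2 * Real.cos s.2))

theorem continuous_sphereToPlane (n : ℕ) : Continuous (sphereToPlane n) := by
  unfold sphereToPlane; fun_prop

/-- `U u` turns the Bloch sphere by the angle `2 |u|`, so the rescaled point has length `θ / 2`, and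
its `alpha` is `(θ / 2) e^{iφ}`. -/
theorem U_sphereToPlane {n : ℕ} (hn : n ≠ 0) (s : ℝ × ℝ) :
    U ((√(n : ℝ))⁻¹ • sphereToPlane n s) = rotFromUp s := by
  have hn0 : √(n : ℝ) ≠ 0 := by positivity
  have hv : (√(n : ℝ))⁻¹ • sphereToPlane n s =
      (s.1 / 2 * Real.sin s.2, -(s.1 / 2 * Real.cos s.2)) := by
    ext <;> simp [sphereToPlane] <;> field_simp
  have he : euclid (s.1 / 2 * Real.sin s.2, -(s.1 / 2 * Real.cos s.2)) = |s.1 / 2| := by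
    rw [euclid, ← Real.sqrt_sq_eq_abs]
    congr 1
    linear_combination (s.1 / 2) ^ 2 * Real.sin_sq_add_cos_sq s.2
  have ha : alpha (s.1 / 2 * Real.sin s.2, -(s.1 / 2 * Real.cos s.2)) =
      ((s.1 / 2 : ℝ) : ℂ) * Complex.exp (Complex.I * s.2) := by
    rw [mul_comm Complex.I, Complex.exp_mul_I, alpha]
    push_cast
    ring
  have hc : Real.cos |s.1 / 2| = Real.cos (s.1 / 2) := Real.cos_abs _
  have hs : Real.sinc |s.1 / 2| = Real.sinc (s.1 / 2) := by
    rcases abs_choice (s.1 / 2) with h | h <;> rw [h]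
    rw [Real.sinc_neg]
  have hm : ((s.1 / 2 : ℝ) : ℂ) * (Real.sinc (s.1 / 2) : ℂ) = (Real.sin (s.1 / 2) : ℂ) := by
    rw [← Complex.ofReal_mul, mul_sinc]
  have hconj : (starRingEnd ℂ) (Complex.exp (Complex.I * s.2)) = Complex.exp (-Complex.I * s.2) := by
    rw [← Complex.exp_conj]; simp
  rw [hv, U_eq, he, ha, hc, hs, rotFromUp, map_mul, Complex.conj_ofReal, hconj]
  ext i j
  fin_cases i <;> fin_cases j <;> simp only [Fin.zero_eta, Fin.mk_one, Matrix.of_apply,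
    Matrix.cons_val', Matrix.cons_val_zero, Matrix.cons_val_one, Matrix.cons_val_fin_one]
  · linear_combination (-Complex.exp (-Complex.I * s.2)) * hm
  · linear_combination (Complex.exp (Complex.I * s.2)) * hm

/-- After this identity both laws are images under the same map, so only the densities on the plane
have to be compared. -/
theorem hetEstimate_sphereToPlane {n : ℕ} (hn : n ≠ 0) (d : ℕ) (s : ℝ × ℝ) :
    hetEstimate n d (sphereToPlane n s) = covEstimate n d s := by
  rw [hetEstimate, U_sphereToPlane hn, rotFromUp, covEstimate]
  set c := Real.cos (s.1 / 2) with hc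
  set t := Real.sin (s.1 / 2) with ht
  have h1 : Real.cos s.1 = c ^ 2 - t ^ 2 := by
    rw [hc, ht, ← Real.cos_two_mul']; ring_nf
  have h2 : Real.sin s.1 = 2 * t * c := by
    rw [hc, ht, ← Real.sin_two_mul]; ring_nf
  have h3 : (c : ℂ) ^ 2 + (t : ℂ) ^ 2 = 1 := by
    exact_mod_cast Real.cos_sq_add_sin_sq (s.1 / 2)
  have hconj : (starRingEnd ℂ) (Complex.exp (Complex.I * s.2)) = Complex.exp (-Complex.I * s.2) := by
    rw [← Complex.exp_conj]; simp
  have hconj' : (starRingEnd ℂ) (Complex.exp (-Complex.I * s.2)) = Complex.exp (Complex.I * s.2) := by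
    rw [← Complex.exp_conj]; simp
  have e1 : Complex.exp (Complex.I * s.2) = Real.cos s.2 + Complex.I * Real.sin s.2 := by
    rw [mul_comm Complex.I, Complex.exp_mul_I]; push_cast; ring
  have e2 : Complex.exp (-Complex.I * s.2) = Real.cos s.2 - Complex.I * Real.sin s.2 := by
    rw [← hconj, e1]; simp [-Complex.ofReal_cos, -Complex.ofReal_sin]; ring
  have h4 : Complex.exp (Complex.I * s.2) * Complex.exp (-Complex.I * s.2) = 1 := by
    rw [← Complex.exp_add]; simp
  rw [h1, h2]
  ext i j
  fin_cases i <;> fin_cases j <;>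
    simp only [Fin.zero_eta, Fin.mk_one, Matrix.mul_apply, Fin.sum_univ_two, Matrix.of_apply,
      Matrix.cons_val', Matrix.cons_val_zero, Matrix.cons_val_one, Matrix.cons_val_fin_one,
      Matrix.conjTranspose_apply, RCLike.star_def, map_mul, map_neg, Complex.conj_ofReal, hconj,
      hconj', Matrix.smul_apply, Matrix.add_apply, σx, σy, σz, smul_eq_mul, Matrix.one_apply_eq,
      Matrix.one_apply_ne, ne_eq, zero_ne_one, one_ne_zero, not_false_eq_true, Complex.ofReal_mul,
      Complex.ofReal_sub, Complex.ofReal_pow, Complex.ofReal_ofNat]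
  · linear_combination (1 / 2 : ℂ) * h3 + ((t : ℂ) ^ 2 / 2 - (d : ℂ) / n * t ^ 2 / 2) * h4
  · linear_combination ((c : ℂ) * d / n * t) * e2
  · linear_combination ((c : ℂ) * d / n * t) * e1
  · linear_combination (1 / 2 : ℂ) * h3 + ((t : ℂ) ^ 2 / 2 + (d : ℂ) / n * t ^ 2 / 2) * h4

/-- The density of the uniform measure on the sphere in the coordinates of the plane. -/
def planeJacobian (n : ℕ) (u : ℝ × ℝ) : ℝ :=
  if euclid u < √(n : ℝ) * Real.pi / 2 then
    Real.sinc (2 * euclid u / √(n : ℝ)) / (n * Real.pi) else 0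

theorem measurable_planeJacobian (n : ℕ) : Measurable (planeJacobian n) := by
  unfold planeJacobian
  have he := continuous_euclid.measurable
  refine Measurable.ite (measurableSet_lt he measurable_const) ?_ measurable_const
  exact ((Real.continuous_sinc.measurable.comp
    ((he.const_mul 2).div_const _))).div_const _

/-- The quarter turn brings polar coordinates to `(-r sin φ, r cos φ)`; the shift by `π` in
`setLIntegral_Ioo_add_pi` then matches `sphereToPlane`. -/
theorem lintegral_rotate (f : ℝ × ℝ → ℝ≥0∞) (hf : Measurable f) :
    ∫⁻ u : ℝ × ℝ, f (-u.2, u.1) = ∫⁻ u, f u := by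
  have h : MeasurePreserving (fun u : ℝ × ℝ => (-u.2, u.1)) volume volume :=
    ((Measure.measurePreserving_neg (volume : Measure ℝ)).prod
      (MeasurePreserving.id (volume : Measure ℝ))).comp Measure.measurePreserving_swap
  exact h.lintegral_comp hf

theorem setLIntegral_Ioo_mul_left {c : ℝ} (hc : 0 < c) (R : ℝ) (g : ℝ → ℝ≥0∞) :
    ∫⁻ x in Set.Ioo 0 (c * R), g x = ∫⁻ x in Set.Ioo 0 R, ENNReal.ofReal c * g (c * x) := by
  have h := lintegral_image_eq_lintegral_abs_deriv_mul (s := Set.Ioo 0 R) (f := fun x => c * x)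
    (f' := fun _ => c) measurableSet_Ioo
    (fun x _ => by simpa using ((hasDerivAt_id x).const_mul c).hasDerivWithinAt)
    (fun x _ y _ hxy => mul_left_cancel₀ hc.ne' hxy) g
  rw [abs_of_pos hc, Set.image_mul_left_Ioo hc, mul_zero] at h
  exact h

theorem setLIntegral_Ioo_add_pi (g : ℝ → ℝ≥0∞) :
    ∫⁻ x in Set.Ioo 0 (2 * Real.pi), g x =
      ∫⁻ x in Set.Ioo (-Real.pi) Real.pi, g (x + Real.pi) := by
  have h := lintegral_image_eq_lintegral_abs_deriv_mul (s := Set.Ioo (-Real.pi) Real.pi)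
    (f := fun x => x + Real.pi) (f' := fun _ => 1) measurableSet_Ioo
    (fun x _ => by simpa using ((hasDerivAt_id x).add_const Real.pi).hasDerivWithinAt)
    (fun x _ y _ hxy => add_right_cancel hxy) g
  rw [Set.image_add_const_Ioo] at h
  simpa [two_mul] using h

theorem lintegral_sphereMeasure (f : ℝ × ℝ → ℝ≥0∞) (hf : Measurable f) :
    ∫⁻ s, f s ∂sphereMeasure = ∫⁻ θ in Set.Ioo 0 Real.pi,
      ENNReal.ofReal (Real.sin θ / (4 * Real.pi)) *
        ∫⁻ φ in Set.Ioo 0 (2 * Real.pi), f (θ, φ) := by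
  have hw : Measurable fun s : ℝ × ℝ => ENNReal.ofReal (Real.sin s.1 / (4 * Real.pi)) := by
    fun_prop
  rw [sphereMeasure, lintegral_withDensity_eq_lintegral_mul _ hw hf, Measure.volume_eq_prod,
    setLIntegral_prod _ (hw.mul hf).aemeasurable]
  refine lintegral_congr fun θ => ?_
  simp only [Pi.mul_apply]
  exact lintegral_const_mul _ (hf.comp measurable_prodMk_left)

theorem lintegral_polar (f : ℝ × ℝ → ℝ≥0∞) (hf : Measurable f) :
    ∫⁻ u, f u = ∫⁻ r in Set.Ioi (0 : ℝ), ENNReal.ofReal r *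
      ∫⁻ φ in Set.Ioo (-Real.pi) Real.pi, f (-(r * Real.sin φ), r * Real.cos φ) := by
  have hg : Measurable fun p : ℝ × ℝ => f (-(p.1 * Real.sin p.2), p.1 * Real.cos p.2) :=
    hf.comp (by fun_prop)
  rw [← lintegral_rotate f hf, ← lintegral_comp_polarCoord_symm, polarCoord_target,
    Measure.volume_eq_prod]
  simp only [polarCoord_symm_apply, smul_eq_mul]
  rw [setLIntegral_prod _ (Measurable.aemeasurable (by
    exact (ENNReal.measurable_ofReal.comp measurable_fst).mul hg))]
  refine lintegral_congr fun r => ?_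
  exact lintegral_const_mul (ENNReal.ofReal r)
    (f := fun y => f (-(r * Real.sin y), r * Real.cos y)) (hf.comp (by fun_prop))

theorem euclid_polar {r : ℝ} (hr : 0 ≤ r) (φ : ℝ) :
    euclid (-(r * Real.sin φ), r * Real.cos φ) = r := by
  rw [euclid]
  have : (-(r * Real.sin φ)) ^ 2 + (r * Real.cos φ) ^ 2 = r ^ 2 := by
    linear_combination r ^ 2 * Real.sin_sq_add_cos_sq φ
  rw [this, Real.sqrt_sq hr]

theorem setLIntegral_eq_of_subset {s t : Set ℝ} (hs : MeasurableSet s) (ht : MeasurableSet t)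
    (hst : s ⊆ t) {g : ℝ → ℝ≥0∞} (hg : ∀ x ∈ t \ s, g x = 0) :
    ∫⁻ x in s, g x = ∫⁻ x in t, g x := by
  rw [← lintegral_indicator hs, ← lintegral_indicator ht]
  refine lintegral_congr fun x => ?_
  by_cases h1 : x ∈ s
  · simp [h1, hst h1]
  · by_cases h2 : x ∈ t
    · simp [h1, h2, hg x ⟨h2, h1⟩]
    · simp [h1, h2]

/-- Substitute `θ = 2r / √n`: then `sin θ dθ dφ / (4π)` becomes `sinc θ / (nπ)` times `r dr dφ`, and
`θ < π` becomes the disc of radius `√n π / 2`. -/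
theorem lintegral_sphereToPlane {n : ℕ} (hn : n ≠ 0) (f : ℝ × ℝ → ℝ≥0∞) (hf : Measurable f) :
    ∫⁻ s, f (sphereToPlane n s) ∂sphereMeasure =
      ∫⁻ u, f u * ENNReal.ofReal (planeJacobian n u) := by
  have hn0 : 0 < √(n : ℝ) := by positivity
  have hsq : √(n : ℝ) * √(n : ℝ) = n := Real.mul_self_sqrt (by positivity)
  have hJ : Measurable fun u => ENNReal.ofReal (planeJacobian n u) :=
    (measurable_planeJacobian n).ennreal_ofReal
  rw [lintegral_sphereMeasure (fun s => f (sphereToPlane n s))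
    (hf.comp (continuous_sphereToPlane n).measurable),
    lintegral_polar (fun u => f u * ENNReal.ofReal (planeJacobian n u)) (hf.mul hJ)]
  have hpi : Real.pi = 2 / √(n : ℝ) * (√(n : ℝ) * Real.pi / 2) := by field_simp
  have hsub : Set.Ioo 0 (√(n : ℝ) * Real.pi / 2) ⊆ Set.Ioi (0 : ℝ) := fun x hx => hx.1
  rw [← setLIntegral_eq_of_subset measurableSet_Ioo measurableSet_Ioi hsub]
  · conv_lhs => rw [show Set.Ioo 0 Real.pi = Set.Ioo 0 (2 / √(n : ℝ) * (√(n : ℝ) * Real.pi / 2)) by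
      rw [← hpi]]
    rw [setLIntegral_Ioo_mul_left (by positivity)]
    refine setLIntegral_congr_fun measurableSet_Ioo fun r hr => ?_
    have hr0 : 0 < r := hr.1
    have hinner : ∀ φ, f (-(r * Real.sin φ), r * Real.cos φ) *
        ENNReal.ofReal (planeJacobian n (-(r * Real.sin φ), r * Real.cos φ)) =
        ENNReal.ofReal (Real.sinc (2 * r / √(n : ℝ)) / (n * Real.pi)) *
          f (-(r * Real.sin φ), r * Real.cos φ) := by
      intro φ
      rw [planeJacobian, euclid_polar hr0.le, if_pos hr.2, mul_comm]
    simp only [hinner]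
    have hmeas : Measurable fun φ => f (-(r * Real.sin φ), r * Real.cos φ) :=
      hf.comp (by fun_prop)
    rw [lintegral_const_mul _ hmeas, setLIntegral_Ioo_add_pi, ← mul_assoc,
      ← mul_assoc, ← ENNReal.ofReal_mul (by positivity), ← ENNReal.ofReal_mul hr0.le]
    congr 2
    · have hx : 2 * r / √(n : ℝ) ≠ 0 := by positivity
      rw [Real.sinc_of_ne_zero hx, show 2 / √(n : ℝ) * r = 2 * r / √(n : ℝ) by ring]
      field_simp
      linear_combination (-4 * Real.sin (2 * r / √(n : ℝ))) * hsq
    · ext φ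
      congr 1
      simp only [sphereToPlane, Real.sin_add_pi, Real.cos_add_pi]
      have h : √(n : ℝ) * (2 / √(n : ℝ) * r) / 2 = r := by field_simp
      rw [h]
      simp
  · intro r hr
    have hr0 : 0 < r := hr.1
    have hr1 : ¬ r < √(n : ℝ) * Real.pi / 2 := fun h => hr.2 ⟨hr0, h⟩
    simp [planeJacobian, euclid_polar hr0.le, hr1]

/-! ### Total masses -/

theorem continuous_symForm (d : ℕ) (μ : ℝ) (B : QubitOp) : Continuous (symForm d μ B) := by
  unfold symForm
  refine continuous_finsetSum _ fun k _ => continuous_const.mul ?_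
  have h : Continuous fun x : Fin (d + 1) → ℂ => symPow d Bᴴ *ᵥ x :=
    Continuous.matrix_mulVec continuous_const continuous_id
  exact (((continuous_apply k).comp h).norm).pow 2

theorem symForm_nonneg {μ : ℝ} (h0 : 0 ≤ μ) (h1 : μ ≤ 1) (d : ℕ) (B : QubitOp)
    (x : Fin (d + 1) → ℂ) : 0 ≤ symForm d μ B x := by
  have : 0 ≤ 1 - μ := by linarith
  exact Finset.sum_nonneg fun k _ => by positivity

theorem symPow_diag_re_eq (d : ℕ) (μ : ℝ) (B : QubitOp) (k : Fin (d + 1)) :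
    (symPow d (B * rho0 μ * Bᴴ) k k).re = symForm d μ B (Pi.single k 1) := by
  have h := star_dotProduct_symPow d μ B (Pi.single k 1)
  have h2 : star (Pi.single k 1 : Fin (d + 1) → ℂ) = Pi.single k 1 := by
    ext i; by_cases hi : i = k
    · subst hi; simp
    · simp [hi]
  rw [h2] at h
  simp only [Matrix.mulVec_single_one, single_dotProduct, one_mul] at h
  rw [← Complex.ofReal_re (symForm _ _ _ _), ← h]
  rfl

theorem sum_symPow_diag_re {μ : ℝ} {B : QubitOp} (hB : B * Bᴴ = 1) (d : ℕ) :
    ∑ k, (symPow d (B * rho0 μ * Bᴴ) k k).re = symTrace d μ (1 - μ) := by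
  have h : Matrix.trace (symPow d (B * rho0 μ * Bᴴ)) = symTrace d μ (1 - μ) := by
    rw [← symPow_mul, ← symPow_mul, Matrix.trace_mul_comm, ← mul_assoc, symPow_mul,
      mul_eq_one_comm.1 hB, symPow_one, one_mul, rho0, symPow_diagonal,
      Matrix.trace_diagonal, symTrace, Finset.sum_range]
    push_cast
    rfl
  rw [← Complex.ofReal_re (symTrace _ _ _), ← h, Matrix.trace, Complex.re_sum]
  rfl

theorem integral_phase (c : ℝ) (k k' : ℕ) :
    ∫ φ in c..(c + 2 * Real.pi), (starRingEnd ℂ) (Complex.exp (Complex.I * φ) ^ k) *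
      Complex.exp (Complex.I * φ) ^ k' = if k = k' then (2 * Real.pi : ℂ) else 0 := by
  have h : ∀ φ : ℝ, (starRingEnd ℂ) (Complex.exp (Complex.I * φ) ^ k) *
      Complex.exp (Complex.I * φ) ^ k' = Complex.exp ((k' - k : ℤ) * Complex.I * φ) := by
    intro φ
    rw [map_pow, ← Complex.exp_conj, ← Complex.exp_nat_mul, ← Complex.exp_nat_mul,
      ← Complex.exp_add]
    congr 1
    simp
    ring
  simp only [h]
  split_ifs with hk
  · subst hk; simp
  · have hne : ((k' - k : ℤ) : ℂ) ≠ 0 := by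
      rw [Int.cast_ne_zero]; omega
    rw [integral_exp_mul_complex (mul_ne_zero hne Complex.I_ne_zero)]
    have : ((k' - k : ℤ) : ℂ) * Complex.I * ((c + 2 * Real.pi : ℝ) : ℂ) =
        (k' - k : ℤ) * Complex.I * c + (k' - k : ℤ) * (2 * Real.pi * Complex.I) := by
      push_cast; ring
    rw [this, Complex.exp_add, Complex.exp_int_mul_two_pi_mul_I, mul_one, sub_self, zero_div]

/-- Integrating over the phase removes the off-diagonal entries. The starting point `c` is free
since the sphere uses `0` and the plane `-π`. -/
theorem lintegral_symForm_phase {μ : ℝ} (h0 : 0 ≤ μ) (h1 : μ ≤ 1) (d : ℕ) (B : QubitOp)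
    (a : Fin (d + 1) → ℝ) (c : ℝ) :
    ∫⁻ φ in Set.Ioo c (c + 2 * Real.pi), ENNReal.ofReal (symForm d μ B fun k =>
      a k * Complex.exp (Complex.I * φ) ^ (k : ℕ)) =
      ENNReal.ofReal (2 * Real.pi * ∑ k, a k ^ 2 * (symPow d (B * rho0 μ * Bᴴ) k k).re) := by
  set T := symPow d (B * rho0 μ * Bᴴ) with hT
  set g : ℝ → ℝ := fun φ => symForm d μ B fun k =>
      a k * Complex.exp (Complex.I * φ) ^ (k : ℕ) with hg
  have hle : c ≤ c + 2 * Real.pi := by linarith [Real.pi_pos]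
  have hgc : Continuous g := (continuous_symForm d μ B).comp (by fun_prop)
  have hint : IntegrableOn g (Set.Ioo c (c + 2 * Real.pi)) :=
    (hgc.integrableOn_Icc).mono_set Set.Ioo_subset_Icc_self
  rw [← ofReal_integral_eq_lintegral_ofReal hint
    (Eventually.of_forall fun φ => symForm_nonneg h0 h1 d B _)]
  congr 1
  rw [← integral_Ioc_eq_integral_Ioo, ← intervalIntegral.integral_of_le hle]
  have hexp : ∀ φ : ℝ, (g φ : ℂ) = ∑ k, ∑ k', (a k * T k k' * a k' : ℂ) *
      ((starRingEnd ℂ) (Complex.exp (Complex.I * φ) ^ (k : ℕ)) *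
        Complex.exp (Complex.I * φ) ^ (k' : ℕ)) := by
    intro φ
    rw [hg, ← star_dotProduct_symPow, ← hT]
    simp only [dotProduct, Matrix.mulVec, Finset.mul_sum, Pi.star_apply, star_mul', RCLike.star_def,
      Complex.conj_ofReal]
    exact Finset.sum_congr rfl fun k _ => Finset.sum_congr rfl fun k' _ => by ring
  have hI : ((∫ φ in c..(c + 2 * Real.pi), g φ : ℝ) : ℂ) =
      ∑ k, 2 * Real.pi * (a k ^ 2 * T k k) := by
    rw [← intervalIntegral.integral_ofReal]
    simp only [hexp]
    rw [intervalIntegral.integral_finsetSum]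
    · refine Finset.sum_congr rfl fun k _ => ?_
      rw [intervalIntegral.integral_finsetSum]
      · simp only [intervalIntegral.integral_const_mul, integral_phase, Fin.val_inj, mul_ite,
          mul_zero, Finset.sum_ite_eq, Finset.mem_univ, if_true]
        ring
      · intro k' _
        apply Continuous.intervalIntegrable
        exact continuous_const.mul ((Complex.continuous_conj.comp (by fun_prop)).mul (by fun_prop))
    · intro k _
      apply Continuous.intervalIntegrable
      refine continuous_finsetSum _ fun k' _ => ?_
      exact continuous_const.mul ((Complex.continuous_conj.comp (by fun_prop)).mul (by fun_prop))
  rw [← Complex.ofReal_re (∫ φ in c..(c + 2 * Real.pi), g φ), hI, Complex.re_sum, Finset.mul_sum]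
  refine Finset.sum_congr rfl fun k _ => ?_
  have : (2 * Real.pi * (a k ^ 2 * T k k) : ℂ) = ((2 * Real.pi * a k ^ 2 : ℝ) : ℂ) * T k k := by
    push_cast; ring
  rw [this, Complex.re_ofReal_mul]
  ring

theorem lintegral_ofReal_sum_of_integral_eq_one {m : ℕ} (s : Set ℝ) (hs : MeasurableSet s)
    (g : Fin m → ℝ → ℝ) (t : Fin m → ℝ) (ht : ∀ k, 0 ≤ t k) (hg : ∀ k, ∀ x ∈ s, 0 ≤ g k x)
    (hint : ∀ k, IntegrableOn (g k) s) (h1 : ∀ k, ∫ x in s, g k x = 1) :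
    ∫⁻ x in s, ENNReal.ofReal (∑ k, g k x * t k) = ENNReal.ofReal (∑ k, t k) := by
  rw [← ofReal_integral_eq_lintegral_ofReal
    (integrable_finsetSum _ fun k _ => (hint k).mul_const (t k)),
    integral_finsetSum _ fun k _ => (hint k).mul_const (t k)]
  · congr 1
    exact Finset.sum_congr rfl fun k _ => by rw [integral_mul_const, h1, one_mul]
  · refine (ae_restrict_iff' hs).2 (Eventually.of_forall fun x hx => ?_)
    exact Finset.sum_nonneg fun k _ => mul_nonneg (hg k x hx) (ht k)

/-! ### Radial Beta and Gamma integrals, and resolutions of the identity -/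

theorem integral_pow_mul_one_sub_pow (k m : ℕ) :
    ∫ x in (0 : ℝ)..1, x ^ k * (1 - x) ^ m =
      (k.factorial : ℝ) * m.factorial / (k + m + 1).factorial := by
  have h := Complex.Gamma_mul_Gamma_eq_betaIntegral (s := k + 1) (t := m + 1)
    (by simp; positivity) (by simp; positivity)
  rw [Complex.betaIntegral] at h
  have e : (k : ℂ) + 1 + (m + 1) = ((k + m + 1 : ℕ) : ℂ) + 1 := by push_cast; ring
  simp only [add_sub_cancel_right, Complex.cpow_natCast] at h
  rw [e, Complex.Gamma_nat_eq_factorial, Complex.Gamma_nat_eq_factorial,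
    Complex.Gamma_nat_eq_factorial] at h
  have h2 : ∫ x in (0 : ℝ)..1, (x : ℂ) ^ k * (1 - (x : ℂ)) ^ m =
      ((∫ x in (0 : ℝ)..1, x ^ k * (1 - x) ^ m : ℝ) : ℂ) := by
    rw [← intervalIntegral.integral_ofReal]
    push_cast
    rfl
  rw [h2] at h
  rw [eq_div_iff (by positivity), mul_comm]
  exact_mod_cast h.symm

/-- The substitution `x = sin² (θ / 2)` turns this into a Beta integral. -/
theorem integral_sin_mul_cos_pow_mul_sin_pow {d k : ℕ} (hk : k ≤ d) :
    ∫ θ in Set.Ioo 0 Real.pi, ((d : ℝ) + 1) * (Real.sin θ / 2) * ((d.choose k : ℝ) *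
      ((Real.cos (θ / 2) ^ 2) ^ (d - k) * (Real.sin (θ / 2) ^ 2) ^ k)) = 1 := by
  rw [← integral_Ioc_eq_integral_Ioo, ← intervalIntegral.integral_of_le Real.pi_pos.le]
  have hd : ∀ θ ∈ Set.uIcc 0 Real.pi,
      HasDerivAt (fun θ => Real.sin (θ / 2) ^ 2) (Real.sin θ / 2) θ := by
    intro θ _
    have h := (((hasDerivAt_id θ).div_const 2).sin).pow 2
    have h2 : Real.sin θ = 2 * Real.sin (θ / 2) * Real.cos (θ / 2) := by
      rw [← Real.sin_two_mul]; ring_nf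
    refine h.congr_deriv ?_
    rw [h2]
    simp
    ring
  have h := intervalIntegral.integral_comp_mul_deriv (a := 0) (b := Real.pi) hd
    (by fun_prop) (g := fun x => ((d : ℝ) + 1) * (d.choose k : ℝ) * (x ^ k * (1 - x) ^ (d - k)))
    (by fun_prop)
  have e : ∀ θ : ℝ, ((d : ℝ) + 1) * (Real.sin θ / 2) * ((d.choose k : ℝ) *
      ((Real.cos (θ / 2) ^ 2) ^ (d - k) * (Real.sin (θ / 2) ^ 2) ^ k)) =
      ((fun x => ((d : ℝ) + 1) * (d.choose k : ℝ) * (x ^ k * (1 - x) ^ (d - k))) ∘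
        fun θ => Real.sin (θ / 2) ^ 2) θ * (Real.sin θ / 2) := by
    intro θ
    simp only [Function.comp_apply, Real.cos_sq']
    ring
  simp only [e]
  rw [h]
  simp only [zero_div, Real.sin_zero, Real.sin_pi_div_two, one_pow, ne_eq, OfNat.ofNat_ne_zero,
    not_false_eq_true, zero_pow]
  rw [intervalIntegral.integral_const_mul, integral_pow_mul_one_sub_pow,
    show k + (d - k) + 1 = d + 1 by omega, Nat.choose_eq_factorial_div_factorial hk,
    Nat.cast_div (Nat.factorial_mul_factorial_dvd_factorial hk) (by positivity),
    Nat.factorial_succ]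
  push_cast
  field_simp

/-- In the variable `c r²` the integrand is the density of a Gamma law with shape `k + 1`. -/
theorem integrableOn_radial {c : ℝ} (hc : 0 < c) (k : ℕ) :
    IntegrableOn (fun r : ℝ => 2 * c * r * (Real.exp (-(c * r ^ 2)) * (c * r ^ 2) ^ k /
      k.factorial)) (Set.Ioi 0) ∧
    ∫ r in Set.Ioi (0 : ℝ), 2 * c * r * (Real.exp (-(c * r ^ 2)) * (c * r ^ 2) ^ k /
      k.factorial) = 1 := by
  have hq : (-1 : ℝ) < 2 * k + 1 := by
    have : (0 : ℝ) ≤ k := by positivity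
    linarith
  have hi := integrableOn_rpow_mul_exp_neg_mul_rpow hq (p := 2) two_pos hc
  have hv := integral_rpow_mul_exp_neg_mul_rpow (p := 2) two_pos hq hc
  have e : Set.EqOn (fun r : ℝ => 2 * c * r * (Real.exp (-(c * r ^ 2)) * (c * r ^ 2) ^ k /
      k.factorial)) (fun r => 2 * c ^ (k + 1) / k.factorial *
        (r ^ (2 * (k : ℝ) + 1) * Real.exp (-c * r ^ (2 : ℝ)))) (Set.Ioi 0) := by
    intro r hr
    have h1 : r ^ (2 * (k : ℝ) + 1) = r ^ (2 * k + 1) := by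
      rw [← Real.rpow_natCast]; push_cast; rfl
    have h2 : r ^ (2 : ℝ) = r ^ 2 := by rw [← Real.rpow_natCast]; norm_num
    simp only [h1, h2, neg_mul]
    ring
  refine ⟨IntegrableOn.congr_fun (hi.const_mul _) e.symm measurableSet_Ioi, ?_⟩
  rw [setIntegral_congr_fun measurableSet_Ioi e, integral_const_mul, hv]
  have h3 : (2 * (k : ℝ) + 1 + 1) / 2 = k + 1 := by ring
  have h4 : -(2 * (k : ℝ) + 1 + 1) / 2 = -((k + 1 : ℕ) : ℝ) := by push_cast; ring
  rw [h3, h4, Real.Gamma_nat_eq_factorial, Real.rpow_neg hc.le, Real.rpow_natCast]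
  field_simp

/-- Spin coherent vectors resolve the identity: the angle `φ` leaves the diagonal entries of the
symmetric power, and the angle `θ` gives each of them weight one. -/
theorem lintegral_covariant {μ : ℝ} (h0 : 0 ≤ μ) (h1 : μ ≤ 1) {B : QubitOp} (hB : B * Bᴴ = 1)
    (d : ℕ) :
    ∫⁻ s, ENNReal.ofReal (((d : ℝ) + 1) *
      symForm d μ B (spinCoherent d fun i => rotFromUp s i 0)) ∂sphereMeasure =
      ENNReal.ofReal (symTrace d μ (1 - μ)) := by
  have hmeas : Measurable fun s => ENNReal.ofReal (((d : ℝ) + 1) *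
      symForm d μ B (spinCoherent d fun i => rotFromUp s i 0)) := by
    refine (Continuous.measurable ?_).ennreal_ofReal
    refine continuous_const.mul ((continuous_symForm d μ B).comp ?_)
    refine continuous_pi fun k => ?_
    simp only [rotFromUp, spinCoherent]
    simp
    fun_prop
  rw [lintegral_sphereMeasure _ hmeas, ← sum_symPow_diag_re hB d,
    ← lintegral_ofReal_sum_of_integral_eq_one (Set.Ioo 0 Real.pi) measurableSet_Ioo
      (fun k θ => ((d : ℝ) + 1) * (Real.sin θ / 2) * ((d.choose k : ℝ) *
        ((Real.cos (θ / 2) ^ 2) ^ (d - (k : ℕ)) * (Real.sin (θ / 2) ^ 2) ^ (k : ℕ)))) _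
      (fun k => by rw [symPow_diag_re_eq]; exact symForm_nonneg h0 h1 d B _) ?_ ?_
      (fun k => integral_sin_mul_cos_pow_mul_sin_pow (by omega))]
  · refine setLIntegral_congr_fun measurableSet_Ioo fun θ hθ => ?_
    have hsin : 0 ≤ Real.sin θ := Real.sin_nonneg_of_mem_Icc ⟨hθ.1.le, hθ.2.le⟩
    have hp := lintegral_symForm_phase h0 h1 d B (fun k => √(d.choose k : ℝ) *
      (Real.cos (θ / 2) ^ (d - (k : ℕ)) * Real.sin (θ / 2) ^ (k : ℕ))) 0
    rw [zero_add] at hp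
    have hvec : ∀ φ : ℝ, (spinCoherent d fun i => rotFromUp (θ, φ) i 0) = fun k : Fin (d + 1) =>
        ((√(d.choose k : ℝ) * (Real.cos (θ / 2) ^ (d - (k : ℕ)) * Real.sin (θ / 2) ^ (k : ℕ)) : ℝ) : ℂ)
          * Complex.exp (Complex.I * φ) ^ (k : ℕ) := by
      intro φ; ext k
      simp [spinCoherent, rotFromUp]
      ring
    simp only [hvec]
    have hd : (0 : ℝ) ≤ (d : ℝ) + 1 := by positivity
    simp only [ENNReal.ofReal_mul hd]
    rw [lintegral_const_mul' _ _ ENNReal.ofReal_ne_top, hp, ← ENNReal.ofReal_mul hd,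
      ← ENNReal.ofReal_mul (by positivity)]
    congr 1
    rw [Finset.mul_sum, Finset.mul_sum, Finset.mul_sum]
    refine Finset.sum_congr rfl fun k _ => ?_
    rw [mul_pow, Real.sq_sqrt (by positivity)]
    field_simp
    ring
  · intro k θ hθ
    have hsin : 0 ≤ Real.sin θ := Real.sin_nonneg_of_mem_Icc ⟨hθ.1.le, hθ.2.le⟩
    positivity
  · intro k
    apply IntegrableOn.mono_set (t := Set.Icc 0 Real.pi) _ Set.Ioo_subset_Icc_self
    apply Continuous.integrableOn_Icc
    fun_prop

theorem continuous_truncCoherent (d : ℕ) : Continuous (truncCoherent d) := by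
  refine continuous_pi fun k => ?_
  change Continuous fun z : ℂ =>
    (Real.exp (-‖z‖ ^ 2 / 2) : ℂ) * z ^ (k : ℕ) / (√((k : ℕ).factorial : ℝ) : ℂ)
  fun_prop

/-- As on the sphere, each diagonal entry gets weight one. Truncation loses no mass, since the
coefficients up to `d` are normalised separately. -/
theorem lintegral_heterodyne {μ : ℝ} (hμ : 1 / 2 < μ) (h1 : μ ≤ 1) {B : QubitOp}
    (hB : B * Bᴴ = 1) (d : ℕ) :
    ∫⁻ u, ENNReal.ofReal ((2 * μ - 1) / Real.pi * symForm d μ B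
      (truncCoherent d ((√(2 * μ - 1) : ℂ) * alpha u))) =
      ENNReal.ofReal (symTrace d μ (1 - μ)) := by
  have h0 : 0 ≤ μ := by linarith
  have hc : 0 < 2 * μ - 1 := by linarith
  have hmeas : Measurable fun u => ENNReal.ofReal ((2 * μ - 1) / Real.pi * symForm d μ B
      (truncCoherent d ((√(2 * μ - 1) : ℂ) * alpha u))) := by
    refine (Continuous.measurable ?_).ennreal_ofReal
    exact continuous_const.mul ((continuous_symForm d μ B).comp
      ((continuous_truncCoherent d).comp (continuous_const.mul continuous_alpha)))
  rw [lintegral_polar _ hmeas, ← sum_symPow_diag_re hB d,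
    ← lintegral_ofReal_sum_of_integral_eq_one (Set.Ioi 0) measurableSet_Ioi
      (fun k r => 2 * (2 * μ - 1) * r * (Real.exp (-((2 * μ - 1) * r ^ 2)) *
        ((2 * μ - 1) * r ^ 2) ^ (k : ℕ) / (k : ℕ).factorial)) _
      (fun k => by rw [symPow_diag_re_eq]; exact symForm_nonneg h0 h1 d B _) ?_
      (fun k => (integrableOn_radial hc k).1) (fun k => (integrableOn_radial hc k).2)]
  · refine setLIntegral_congr_fun measurableSet_Ioi fun r hr => ?_
    have hr0 : 0 ≤ r := le_of_lt hr
    -- In these polar coordinates `alpha` equals `-r e^{iφ}`, whence the sign in the amplitudes.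
    have hp := lintegral_symForm_phase h0 h1 d B (fun k => Real.exp (-((2 * μ - 1) * r ^ 2) / 2) *
      (-(√(2 * μ - 1) * r)) ^ (k : ℕ) / √((k : ℕ).factorial : ℝ)) (-Real.pi)
    rw [show -Real.pi + 2 * Real.pi = Real.pi by ring] at hp
    have hvec : ∀ φ : ℝ, truncCoherent d ((√(2 * μ - 1) : ℂ) *
        alpha (-(r * Real.sin φ), r * Real.cos φ)) = fun k : Fin (d + 1) =>
        ((Real.exp (-((2 * μ - 1) * r ^ 2) / 2) * (-(√(2 * μ - 1) * r)) ^ (k : ℕ) /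
          √((k : ℕ).factorial : ℝ) : ℝ) : ℂ) * Complex.exp (Complex.I * φ) ^ (k : ℕ) := by
      intro φ; ext k
      have hz : (√(2 * μ - 1) : ℂ) * alpha (-(r * Real.sin φ), r * Real.cos φ) =
          ((-(√(2 * μ - 1) * r) : ℝ) : ℂ) * Complex.exp (Complex.I * φ) := by
        rw [mul_comm Complex.I, Complex.exp_mul_I, alpha]
        push_cast
        ring
      have hn : ‖(√(2 * μ - 1) : ℂ) * alpha (-(r * Real.sin φ), r * Real.cos φ)‖ ^ 2 =
          (2 * μ - 1) * r ^ 2 := by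
        rw [norm_mul, norm_alpha, euclid_polar hr0, mul_pow, Complex.norm_real, Real.norm_eq_abs,
          sq_abs, Real.sq_sqrt hc.le]
      change (Real.exp (-‖_‖ ^ 2 / 2) : ℂ) * _ ^ (k : ℕ) / (√((k : ℕ).factorial : ℝ) : ℂ) = _
      rw [hn, hz, mul_pow]
      push_cast
      ring
    simp only [hvec]
    have hd : (0 : ℝ) ≤ (2 * μ - 1) / Real.pi := by positivity
    simp only [ENNReal.ofReal_mul hd]
    rw [lintegral_const_mul' _ _ ENNReal.ofReal_ne_top, hp, ← ENNReal.ofReal_mul hd,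
      ← ENNReal.ofReal_mul hr0]
    congr 1
    rw [Finset.mul_sum, Finset.mul_sum, Finset.mul_sum]
    refine Finset.sum_congr rfl fun k _ => ?_
    have e1 : Real.exp (-((2 * μ - 1) * r ^ 2) / 2) ^ 2 = Real.exp (-((2 * μ - 1) * r ^ 2)) := by
      rw [← Real.exp_nat_mul]; congr 1; push_cast; ring
    have e2 : ((-(√(2 * μ - 1) * r)) ^ (k : ℕ)) ^ 2 = ((2 * μ - 1) * r ^ 2) ^ (k : ℕ) := by
      rw [← pow_mul, mul_comm (k : ℕ), pow_mul, neg_sq, mul_pow, Real.sq_sqrt hc.le]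
    rw [div_pow, mul_pow, Real.sq_sqrt (by positivity), e1, e2]
    field_simp
  · intro k r hr
    have hr0 : (0 : ℝ) ≤ r := le_of_lt hr
    positivity

/-! ### Limits -/

/-- Scheffé's lemma. -/
theorem tendsto_lintegral_sub_add_sub {X ι : Type*} [MeasurableSpace X] {ν : Measure X}
    {l : Filter ι} [l.IsCountablyGenerated] {f : ι → X → ℝ≥0∞} {G : X → ℝ≥0∞}
    (hf : ∀ i, Measurable (f i)) (hG : Measurable G) (hGfin : ∫⁻ x, G x ∂ν ≠ ∞)
    (hGtop : ∀ x, G x ≠ ∞)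
    (hlim : ∀ x, Tendsto (fun i => f i x) l (𝓝 (G x)))
    (hint : Tendsto (fun i => ∫⁻ x, f i x ∂ν) l (𝓝 (∫⁻ x, G x ∂ν))) :
    Tendsto (fun i => ∫⁻ x, (f i x - G x) + (G x - f i x) ∂ν) l (𝓝 0) := by
  -- The deficit `G - f i` is dominated by `G`. The excess is then recovered from the total masses
  -- through `f + (G - f) = G + (f - G)`.
  have h1 : Tendsto (fun i => ∫⁻ x, (G x - f i x) ∂ν) l (𝓝 0) := by
    have := tendsto_lintegral_filter_of_dominated_convergence (μ := ν) (l := l)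
      (F := fun i x => G x - f i x) (f := fun _ => 0) G
      (Eventually.of_forall fun i => hG.sub (hf i))
      (Eventually.of_forall fun i => Eventually.of_forall fun x => tsub_le_self) hGfin
      (Eventually.of_forall fun x => by
        have := ENNReal.Tendsto.sub (tendsto_const_nhds (x := G x)) (hlim x) (Or.inl (hGtop x))
        rwa [tsub_self] at this)
    simpa using this
  have h2 : Tendsto (fun i => ∫⁻ x, (f i x - G x) ∂ν) l (𝓝 0) := by
    have e : ∀ i, ∫⁻ x, (f i x - G x) ∂ν =
        (∫⁻ x, f i x ∂ν + ∫⁻ x, (G x - f i x) ∂ν) - ∫⁻ x, G x ∂ν := by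
      intro i
      rw [← lintegral_add_left (hf i)]
      have : ∀ x, f i x + (G x - f i x) = G x + (f i x - G x) := fun x => by
        rw [add_tsub_eq_max, add_tsub_eq_max, max_comm]
      simp only [this]
      rw [lintegral_add_left hG, ENNReal.add_sub_cancel_left hGfin]
    simp only [e]
    have := ENNReal.Tendsto.sub (hint.add h1) (tendsto_const_nhds (x := ∫⁻ x, G x ∂ν))
      (Or.inl (by simpa using hGfin))
    simpa using this
  have e : ∀ i, ∫⁻ x, (f i x - G x) + (G x - f i x) ∂ν =
      ∫⁻ x, (f i x - G x) ∂ν + ∫⁻ x, (G x - f i x) ∂ν := fun i =>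
    lintegral_add_left ((hf i).sub hG) _
  simp only [e]
  simpa using h2.add h1

/-- The logarithm is `(d / n) * t` times the slope of `log (1 + y)` between `0` and `t / n`. Using
`dslope` covers the indices where `t i = 0`. -/
theorem tendsto_one_add_div_pow {ι : Type*} {l : Filter ι} {n d : ι → ℕ} {t : ι → ℝ} {c T : ℝ}
    (hn : Tendsto n l atTop) (hd : Tendsto (fun i => (d i : ℝ) / n i) l (𝓝 c))
    (ht : Tendsto t l (𝓝 T)) :
    Tendsto (fun i => (1 + t i / n i) ^ d i) l (𝓝 (Real.exp (c * T))) := by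
  have hn' : Tendsto (fun i => (n i : ℝ)) l atTop := tendsto_natCast_atTop_atTop.comp hn
  have hy : Tendsto (fun i => t i / n i) l (𝓝 0) := ht.div_atTop hn'
  set f : ℝ → ℝ := fun y => Real.log (1 + y) with hf
  have hderiv : HasDerivAt f 1 0 := by
    have := ((hasDerivAt_id (0 : ℝ)).const_add 1).log (by simp)
    simpa using this
  have hds : Tendsto (fun i => dslope f 0 (t i / n i)) l (𝓝 1) := by
    have h1 := (continuousAt_dslope_same.2 hderiv.differentiableAt).tendsto
    rw [dslope_same, hderiv.deriv] at h1
    exact h1.comp hy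
  have hmain := (Real.continuous_exp.tendsto _).comp (hd.mul (ht.mul hds))
  rw [mul_one] at hmain
  refine hmain.congr' ?_
  filter_upwards [hn.eventually_gt_atTop 0, hy.eventually (lt_mem_nhds (show (-1 : ℝ) < 0 by norm_num))]
    with i hi hi2
  have hn0 : (n i : ℝ) ≠ 0 := by positivity
  have hpos : 0 < 1 + t i / n i := by linarith
  have h2 : f (t i / n i) = t i / n i * dslope f 0 (t i / n i) := by
    have := sub_smul_dslope f 0 (t i / n i)
    simp only [sub_zero, smul_eq_mul] at this
    rw [this]
    simp [hf]
  simp only [Function.comp_apply]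
  rw [← Real.exp_log (pow_pos hpos _), Real.log_pow]
  congr 1
  change _ = (d i : ℝ) * f (t i / n i)
  rw [h2]
  ring

theorem tendsto_nat_of_div {ι : Type*} {l : Filter ι} {n d : ι → ℕ} {c : ℝ} (hc : 0 < c)
    (hn : Tendsto n l atTop) (hd : Tendsto (fun i => (d i : ℝ) / n i) l (𝓝 c)) :
    Tendsto d l atTop := by
  have hn' : Tendsto (fun i => (n i : ℝ)) l atTop := tendsto_natCast_atTop_atTop.comp hn
  rw [← tendsto_natCast_atTop_iff (R := ℝ)]
  refine (hd.pos_mul_atTop hc hn').congr' ?_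
  filter_upwards [hn.eventually_gt_atTop 0] with i hi
  have hn0 : (n i : ℝ) ≠ 0 := by positivity
  field_simp

theorem tendsto_div_sqrt {ι : Type*} {l : Filter ι} {n : ι → ℕ} {x : ι → ℝ} {X : ℝ}
    (hn : Tendsto n l atTop) (hx : Tendsto x l (𝓝 X)) :
    Tendsto (fun i => x i / √(n i : ℝ)) l (𝓝 0) :=
  hx.div_atTop (Real.tendsto_sqrt_atTop.comp (tendsto_natCast_atTop_atTop.comp hn))

theorem one_sub_cos_eq (x : ℝ) : Real.cos x - 1 = -(x ^ 2 / 2) * Real.sinc (x / 2) ^ 2 := by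
  have h := Real.cos_two_mul (x / 2)
  have h2 := Real.sin_sq_add_cos_sq (x / 2)
  have h3 := mul_sinc (x / 2)
  rw [show 2 * (x / 2) = x by ring] at h
  rw [h]
  linear_combination 2 * (x / 2 * Real.sinc (x / 2) + Real.sin (x / 2)) * h3 + 2 * h2

theorem tendsto_cos_div_sqrt_pow {ι : Type*} {l : Filter ι} {n d : ι → ℕ} {c : ℝ} (e : ℝ)
    (hn : Tendsto n l atTop) (hd : Tendsto (fun i => (d i : ℝ) / n i) l (𝓝 c)) :
    Tendsto (fun i => Real.cos (e / √(n i : ℝ)) ^ d i) l (𝓝 (Real.exp (-(c * e ^ 2) / 2))) := by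
  have h0 : Tendsto (fun i => e / 2 / √(n i : ℝ)) l (𝓝 0) :=
    tendsto_div_sqrt hn tendsto_const_nhds
  have hs := ((Real.continuous_sinc.tendsto 0).comp h0)
  rw [Real.sinc_zero] at hs
  have ht : Tendsto (fun i => -(e ^ 2 / 2) * Real.sinc (e / 2 / √(n i : ℝ)) ^ 2) l
      (𝓝 (-(e ^ 2 / 2) * 1 ^ 2)) := (hs.pow 2).const_mul _
  have := tendsto_one_add_div_pow hn hd ht
  rw [show c * (-(e ^ 2 / 2) * 1 ^ 2) = -(c * e ^ 2) / 2 by ring] at this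
  refine this.congr' ?_
  filter_upwards [hn.eventually_gt_atTop 0] with i hi
  have hn0 : 0 < √(n i : ℝ) := by positivity
  have hsq : √(n i : ℝ) ^ 2 = n i := Real.sq_sqrt (by positivity)
  congr 1
  have h := one_sub_cos_eq (e / √(n i : ℝ))
  rw [div_pow, hsq, show e / √(n i : ℝ) / 2 = e / 2 / √(n i : ℝ) by ring] at h
  linear_combination -h

theorem tendsto_choose_div_pow {ι : Type*} {l : Filter ι} {n d : ι → ℕ} {c : ℝ} (hc : 0 < c)
    (hn : Tendsto n l atTop) (hd : Tendsto (fun i => (d i : ℝ) / n i) l (𝓝 c)) (k : ℕ) :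
    Tendsto (fun i => ((d i).choose k : ℝ) / (n i : ℝ) ^ k) l (𝓝 (c ^ k / k.factorial)) := by
  have hdt := tendsto_nat_of_div hc hn hd
  have h2 : Tendsto (fun m : ℕ => (m.choose k : ℝ) / ((m : ℝ) ^ k / k.factorial)) atTop (𝓝 1) := by
    have := (Asymptotics.isEquivalent_iff_tendsto_one (u := fun m : ℕ => (m.choose k : ℝ))
      (v := fun m : ℕ => (m : ℝ) ^ k / k.factorial) (l := atTop) (by
        filter_upwards [eventually_gt_atTop 0] with m hm
        positivity)).1 (isEquivalent_choose k)
    exact this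
  have h3 := (h2.comp hdt).mul ((hd.pow k).div_const (k.factorial : ℝ))
  rw [one_mul] at h3
  refine h3.congr' ?_
  filter_upwards [hn.eventually_gt_atTop 0, hdt.eventually_gt_atTop 0] with i hi hi2
  have hn0 : (n i : ℝ) ≠ 0 := by positivity
  have hd0 : (d i : ℝ) ≠ 0 := by positivity
  have hk0 : (k.factorial : ℝ) ≠ 0 := by positivity
  simp only [Function.comp_apply, div_pow]
  field_simp

/-- The terms of the overlap of a coherent vector and a spin coherent vector. -/
def overlapTerm (c e : ℝ) (n d k : ℕ) : ℝ :=
  Real.exp (-(c * e ^ 2) / 2) * √((d.choose k : ℝ) / (n : ℝ) ^ k / k.factorial) *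
    Real.cos (e / √(n : ℝ)) ^ (d - k) * (√c * e ^ 2 * Real.sinc (e / √(n : ℝ))) ^ k

/-- Termwise the limit is the Poisson weight of mean `c e²`, and these weights sum to one. Terms
with `k > d` vanish with the binomial coefficient, so the sum may be taken over all `k`. -/
theorem tendsto_sum_overlapTerm {ι : Type*} {l : Filter ι} {n d : ι → ℕ} {c : ℝ} (hc : 0 < c)
    (e : ℝ) (hn : Tendsto n l atTop) (hd : Tendsto (fun i => (d i : ℝ) / n i) l (𝓝 c)) :
    Tendsto (fun i => ∑ k : Fin (d i + 1), overlapTerm c e (n i) (d i) k) l (𝓝 1) := by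
  have htsum : ∀ i, ∑ k : Fin (d i + 1), overlapTerm c e (n i) (d i) k =
      ∑' k, overlapTerm c e (n i) (d i) k := by
    intro i
    rw [tsum_eq_sum (s := Finset.range (d i + 1)), Finset.sum_range]
    intro k hk
    rw [Finset.mem_range] at hk
    rw [overlapTerm, Nat.choose_eq_zero_of_lt (by omega)]
    simp
  simp only [htsum]
  have h0 : Tendsto (fun i => e / √(n i : ℝ)) l (𝓝 0) := tendsto_div_sqrt hn tendsto_const_nhds
  have hs : Tendsto (fun i => Real.sinc (e / √(n i : ℝ))) l (𝓝 1) := by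
    have := (Real.continuous_sinc.tendsto 0).comp h0
    rwa [Real.sinc_zero] at this
  have hcos : Tendsto (fun i => Real.cos (e / √(n i : ℝ))) l (𝓝 1) := by
    have := (Real.continuous_cos.tendsto 0).comp h0
    rwa [Real.cos_zero] at this
  have hdt := tendsto_nat_of_div hc hn hd
  have hsum1 : ∑' k : ℕ, Real.exp (-(c * e ^ 2)) * ((c * e ^ 2) ^ k / k.factorial) = 1 := by
    rw [tsum_mul_left]
    have : ∑' k : ℕ, (c * e ^ 2) ^ k / (k.factorial : ℝ) = Real.exp (c * e ^ 2) := by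
      rw [Real.exp_eq_exp_ℝ, NormedSpace.exp_eq_tsum_div]
    rw [this, ← Real.exp_add]
    simp
  rw [← hsum1]
  -- Eventually `d / n ≤ c + 1`, which bounds the binomial ratio by `(c + 1) ^ k / k!`. The
  -- exponential, the cosine and `sinc` are at most one in absolute value.
  refine tendsto_tsum_of_dominated_convergence
    (bound := fun k => (√(c + 1) * (√c * e ^ 2)) ^ k / (k.factorial : ℝ))
    (Real.summable_pow_div_factorial _) ?_ ?_
  · intro k
    have hch := tendsto_choose_div_pow hc hn hd k
    have hsq := (Real.continuous_sqrt.tendsto _).comp (hch.div_const (k.factorial : ℝ))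
    have hcd : Tendsto (fun i => Real.cos (e / √(n i : ℝ)) ^ (d i - k)) l
        (𝓝 (Real.exp (-(c * e ^ 2) / 2) / 1 ^ k)) := by
      refine ((tendsto_cos_div_sqrt_pow e hn hd).div (hcos.pow k) (by simp)).congr' ?_
      filter_upwards [hdt.eventually_ge_atTop k, hcos.eventually_ne (show (1 : ℝ) ≠ 0 by simp)]
        with i hi hi2
      simp only [Pi.div_apply]
      rw [pow_sub₀ _ hi2 hi]
      rfl
    have hm := ((hsq.const_mul (Real.exp (-(c * e ^ 2) / 2))).mul hcd).mul
      ((hs.const_mul (√c * e ^ 2)).pow k)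
    have e1 : Real.exp (-(c * e ^ 2) / 2) * √(c ^ k / k.factorial / k.factorial) *
        (Real.exp (-(c * e ^ 2) / 2) / 1 ^ k) * (√c * e ^ 2 * 1) ^ k =
        Real.exp (-(c * e ^ 2)) * ((c * e ^ 2) ^ k / k.factorial) := by
      have e2 : Real.exp (-(c * e ^ 2)) =
          Real.exp (-(c * e ^ 2) / 2) * Real.exp (-(c * e ^ 2) / 2) := by
        rw [← Real.exp_add]; ring_nf
      have e3 : √(c ^ k / k.factorial / k.factorial) = √c ^ k / k.factorial := by
        rw [div_div, Real.sqrt_div (by positivity), Real.sqrt_mul_self (by positivity)]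
        congr 1
        rw [Real.sqrt_eq_iff_mul_self_eq (by positivity) (by positivity), ← mul_pow,
          Real.mul_self_sqrt hc.le]
      have e4 : c ^ k = √c ^ k * √c ^ k := by rw [← mul_pow, Real.mul_self_sqrt hc.le]
      rw [e2, e3, mul_pow c, e4]
      ring
    rw [e1] at hm
    exact hm
  · filter_upwards [hd.eventually_le_const (show c < c + 1 by linarith),
      hn.eventually_gt_atTop 0] with i hi hi2 k
    have hn0 : (0 : ℝ) < n i := by exact_mod_cast hi2
    have b1 : Real.exp (-(c * e ^ 2) / 2) ≤ 1 := by
      rw [Real.exp_le_one_iff]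
      have : 0 ≤ c * e ^ 2 := by positivity
      linarith
    have b2 : √(((d i).choose k : ℝ) / (n i : ℝ) ^ k / k.factorial) ≤
        √(c + 1) ^ k / k.factorial := by
      rw [Real.sqrt_le_left (by positivity), div_pow, ← pow_mul, mul_comm k, pow_mul,
        Real.sq_sqrt (by positivity)]
      have h1 : ((d i).choose k : ℝ) / (n i : ℝ) ^ k ≤ (c + 1) ^ k / k.factorial := by
        rw [div_le_iff₀ (by positivity)]
        calc ((d i).choose k : ℝ) ≤ (d i : ℝ) ^ k / k.factorial := Nat.choose_le_pow_div k (d i)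
          _ ≤ ((c + 1) * n i) ^ k / k.factorial := by
              gcongr
              rwa [div_le_iff₀ hn0] at hi
          _ = _ := by rw [mul_pow]; ring
      calc _ ≤ (c + 1) ^ k / k.factorial / k.factorial := by gcongr
        _ = _ := by rw [div_div, pow_two]
    have b3 : |Real.cos (e / √(n i : ℝ))| ^ (d i - k) ≤ 1 :=
      pow_le_one₀ (abs_nonneg _) (Real.abs_cos_le_one _)
    have b4 : |√c * e ^ 2 * Real.sinc (e / √(n i : ℝ))| ^ k ≤ (√c * e ^ 2) ^ k := by
      rw [abs_mul, abs_of_nonneg (show 0 ≤ √c * e ^ 2 by positivity)]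
      exact pow_le_pow_left₀ (by positivity)
        (mul_le_of_le_one_right (by positivity) (Real.abs_sinc_le_one _)) _
    rw [overlapTerm, Real.norm_eq_abs, abs_mul, abs_mul, abs_mul, abs_pow, abs_pow,
      abs_of_pos (Real.exp_pos _), abs_of_nonneg (Real.sqrt_nonneg _)]
    calc _ ≤ 1 * (√(c + 1) ^ k / k.factorial) * 1 * (√c * e ^ 2) ^ k := by gcongr
      _ = _ := by rw [mul_pow (√(c + 1))]; ring

/-! ### Pointwise convergence of the densities -/

/-- The squared norm of a vector. -/
def normSq {m : ℕ} (x : Fin m → ℂ) : ℝ := ∑ k, ‖x k‖ ^ 2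

theorem star_dotProduct_self_eq_normSq {m : ℕ} (x : Fin m → ℂ) :
    star x ⬝ᵥ x = (normSq x : ℂ) := star_dotProduct_self x

theorem normSq_symPow_mulVec {B : QubitOp} (hB : B * Bᴴ = 1) (d : ℕ) (x : Fin (d + 1) → ℂ) :
    normSq (symPow d Bᴴ *ᵥ x) = normSq x := by
  rw [← Complex.ofReal_inj, ← star_dotProduct_self_eq_normSq, ← star_dotProduct_self_eq_normSq,
    Matrix.star_mulVec, ← Matrix.dotProduct_mulVec, Matrix.mulVec_mulVec, symPow_conjTranspose,
    symPow_mul, Matrix.conjTranspose_conjTranspose, hB, symPow_one, Matrix.one_mulVec]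

/-- Since `1 - μ ≤ μ`, no weight of the form exceeds `μ ^ d`. The rest is Cauchy–Schwarz, with norms
preserved by the rotation. -/
theorem sq_symForm_sub_le {μ : ℝ} (hμ : 1 / 2 ≤ μ) (h1 : μ ≤ 1) {B : QubitOp} (hB : B * Bᴴ = 1)
    (d : ℕ) (x y : Fin (d + 1) → ℂ) :
    (symForm d μ B x - symForm d μ B y) ^ 2 ≤
      (μ ^ d) ^ 2 * (normSq (x - y) * (2 * (normSq x + normSq y))) := by
  set S := symPow d Bᴴ with hS
  have h0 : 0 ≤ 1 - μ := by linarith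
  have hμ0 : 0 ≤ μ := by linarith
  set w : Fin (d + 1) → ℝ := fun k => μ ^ (d - (k : ℕ)) * (1 - μ) ^ (k : ℕ) with hw
  have hw0 : ∀ k, 0 ≤ w k := fun k => by positivity
  have hw1 : ∀ k, w k ≤ μ ^ d := by
    intro k
    calc w k ≤ μ ^ (d - (k : ℕ)) * μ ^ (k : ℕ) := by
          simp only [hw]; gcongr; linarith
      _ = μ ^ d := by rw [← pow_add]; congr 1; omega
  have habs : |symForm d μ B x - symForm d μ B y| ≤
      μ ^ d * ∑ k, ‖(S *ᵥ (x - y)) k‖ * (‖(S *ᵥ x) k‖ + ‖(S *ᵥ y) k‖) := by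
    rw [symForm, symForm, ← Finset.sum_sub_distrib, Finset.mul_sum]
    refine (Finset.abs_sum_le_sum_abs _ _).trans (Finset.sum_le_sum fun k _ => ?_)
    rw [← mul_sub, abs_mul]
    have e1 : |‖(S *ᵥ x) k‖ ^ 2 - ‖(S *ᵥ y) k‖ ^ 2| ≤
        ‖(S *ᵥ (x - y)) k‖ * (‖(S *ᵥ x) k‖ + ‖(S *ᵥ y) k‖) := by
      rw [sq_sub_sq, abs_mul, mul_comm, abs_of_nonneg (by positivity : (0 : ℝ) ≤ ‖_‖ + ‖_‖),
        Matrix.mulVec_sub, Pi.sub_apply]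
      gcongr
      exact abs_norm_sub_norm_le _ _
    have e2 : |w k| ≤ μ ^ d := by rw [abs_of_nonneg (hw0 k)]; exact hw1 k
    exact mul_le_mul e2 e1 (abs_nonneg _) (by positivity)
  have hcs := Finset.sum_mul_sq_le_sq_mul_sq Finset.univ (fun k => ‖(S *ᵥ (x - y)) k‖)
    (fun k => ‖(S *ᵥ x) k‖ + ‖(S *ᵥ y) k‖)
  have hsum : ∑ k, (‖(S *ᵥ x) k‖ + ‖(S *ᵥ y) k‖) ^ 2 ≤ 2 * (normSq x + normSq y) := by
    rw [← normSq_symPow_mulVec hB d x, ← normSq_symPow_mulVec hB d y, normSq, normSq,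
      ← Finset.sum_add_distrib, Finset.mul_sum]
    exact Finset.sum_le_sum fun k _ => by nlinarith [sq_nonneg (‖(S *ᵥ x) k‖ - ‖(S *ᵥ y) k‖)]
  rw [← sq_abs, ← normSq_symPow_mulVec hB d (x - y)]
  have hnn : 0 ≤ normSq (S *ᵥ (x - y)) := Finset.sum_nonneg fun k _ => by positivity
  calc |symForm d μ B x - symForm d μ B y| ^ 2
      ≤ (μ ^ d * ∑ k, ‖(S *ᵥ (x - y)) k‖ * (‖(S *ᵥ x) k‖ + ‖(S *ᵥ y) k‖)) ^ 2 := by gcongr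
    _ ≤ (μ ^ d) ^ 2 * (normSq (S *ᵥ (x - y)) * ∑ k, (‖(S *ᵥ x) k‖ + ‖(S *ᵥ y) k‖) ^ 2) := by
        rw [mul_pow]; gcongr; exact hcs
    _ ≤ _ := by gcongr

theorem euclid_smul (t : ℝ) (u : ℝ × ℝ) : euclid (t • u) = |t| * euclid u := by
  rw [euclid, euclid, ← Real.sqrt_sq_eq_abs, ← Real.sqrt_mul (by positivity)]
  congr 1
  simp
  ring

theorem alpha_smul (t : ℝ) (u : ℝ × ℝ) : alpha (t • u) = (t : ℂ) * alpha u := by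
  simp [alpha]; ring

theorem alpha_sub (u v : ℝ × ℝ) : alpha (u - v) = alpha u - alpha v := by
  simp [alpha]; ring

theorem normSq_column {M : QubitOp} (hM : Mᴴ * M = 1) : ‖M 0 0‖ ^ 2 + ‖M 1 0‖ ^ 2 = 1 := by
  have h := congrFun (congrFun hM 0) 0
  rw [Matrix.mul_apply, Fin.sum_univ_two, Matrix.conjTranspose_apply, Matrix.conjTranspose_apply,
    RCLike.star_def, Complex.conj_mul', Complex.conj_mul', Matrix.one_apply_eq] at h
  exact_mod_cast h

/-- The form is the `d`-th power of a qubit expectation; the spin-up probability is eliminated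
because the rotated vector has norm one. -/
theorem symForm_U_spinCoherent (d : ℕ) (μ : ℝ) (u v : ℝ × ℝ) :
    symForm d μ (U v) (spinCoherent d fun i => U u i 0) =
      (μ - (2 * μ - 1) * ‖(Real.cos (euclid v) * Real.sinc (euclid u) : ℝ) * alpha u -
        (Real.cos (euclid u) * Real.sinc (euclid v) : ℝ) * alpha v‖ ^ 2) ^ d := by
  have hUv : (U v)ᴴ * U v = 1 := mul_eq_one_comm.1 (U_mul_conjTranspose v)
  have hUu : (U u)ᴴ * U u = 1 := mul_eq_one_comm.1 (U_mul_conjTranspose u)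
  have hM : ((U v)ᴴ * U u)ᴴ * ((U v)ᴴ * U u) = 1 := by
    rw [Matrix.conjTranspose_mul, Matrix.conjTranspose_conjTranspose, Matrix.mul_assoc,
      ← Matrix.mul_assoc (U v), U_mul_conjTranspose, one_mul, hUu]
  have h := normSq_column hM
  have hc : ∀ j, ((U v)ᴴ *ᵥ fun i => U u i 0) j = ((U v)ᴴ * U u) j 0 := fun j => rfl
  have h1 : ((U v)ᴴ * U u) 1 0 = (Real.cos (euclid v) * Real.sinc (euclid u) : ℝ) * alpha u -
        (Real.cos (euclid u) * Real.sinc (euclid v) : ℝ) * alpha v := by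
    rw [U_eq, U_eq, Matrix.mul_apply, Fin.sum_univ_two]
    simp [Matrix.conjTranspose_apply]
    have hcos : (starRingEnd ℂ) (Complex.cos (euclid v)) = Complex.cos (euclid v) := by
      rw [← Complex.ofReal_cos, Complex.conj_ofReal]
    rw [hcos]
    ring
  rw [symForm_spinCoherent, hc, hc, ← h1]
  congr 1
  linear_combination μ * h

theorem normSq_spinCoherent (d : ℕ) (u : ℝ × ℝ) :
    normSq (spinCoherent d fun i => U u i 0) = 1 := by
  have hUu : (U u)ᴴ * U u = 1 := mul_eq_one_comm.1 (U_mul_conjTranspose u)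
  have h : (star fun i => U u i 0) ⬝ᵥ (fun i => U u i 0) = 1 := by
    have := congrFun (congrFun hUu 0) 0
    rwa [Matrix.mul_apply] at this
  rw [← Complex.ofReal_inj, ← star_dotProduct_self_eq_normSq, star_spinCoherent_dotProduct, h]
  simp

theorem truncCoherent_apply (d : ℕ) (z : ℂ) (k : Fin (d + 1)) : truncCoherent d z k =
    (Real.exp (-‖z‖ ^ 2 / 2) : ℂ) * z ^ (k : ℕ) / (√((k : ℕ).factorial : ℝ) : ℂ) := rfl

theorem normSq_truncCoherent_le (d : ℕ) (z : ℂ) : normSq (truncCoherent d z) ≤ 1 := by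
  have h : normSq (truncCoherent d z) = Real.exp (-‖z‖ ^ 2) *
      ∑ k ∈ Finset.range (d + 1), (‖z‖ ^ 2) ^ k / k.factorial := by
    rw [normSq, Finset.mul_sum, Finset.sum_range]
    refine Finset.sum_congr rfl fun k _ => ?_
    rw [truncCoherent_apply, norm_div, norm_mul, norm_pow, Complex.norm_real, Complex.norm_real,
      Real.norm_eq_abs, Real.norm_eq_abs, div_pow, mul_pow, sq_abs, sq_abs,
      Real.sq_sqrt (by positivity), ← Real.exp_nat_mul]
    push_cast
    rw [show 2 * (-‖z‖ ^ 2 / 2) = -‖z‖ ^ 2 by ring]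
    ring
  rw [h]
  calc _ ≤ Real.exp (-‖z‖ ^ 2) * Real.exp (‖z‖ ^ 2) := by
        gcongr; exact Real.sum_le_exp_of_nonneg (by positivity) _
    _ = 1 := by rw [← Real.exp_add]; simp

theorem normSq_sub {m : ℕ} (x y : Fin m → ℂ) :
    normSq (x - y) = normSq x + normSq y - 2 * (star x ⬝ᵥ y).re := by
  have : (star x ⬝ᵥ y).re = ∑ k, ((starRingEnd ℂ) (x k) * y k).re := by
    rw [dotProduct, Complex.re_sum]; rfl
  rw [this, normSq, normSq, normSq, ← Finset.sum_add_distrib, Finset.mul_sum,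
    ← Finset.sum_sub_distrib]
  refine Finset.sum_congr rfl fun k _ => ?_
  simp only [Pi.sub_apply, ← Complex.normSq_eq_norm_sq, Complex.normSq_apply, Complex.sub_re,
    Complex.sub_im, Complex.mul_re, Complex.conj_re, Complex.conj_im]
  ring

/-- Both vectors carry the phase of `alpha u` to the power `k`, so the phases cancel and the overlap
is real. -/
theorem star_truncCoherent_dotProduct {c : ℝ} (hc : 0 < c) {n : ℕ} (hn : n ≠ 0) (d : ℕ)
    (u : ℝ × ℝ) :
    star (truncCoherent d ((√c : ℂ) * alpha u)) ⬝ᵥ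
      (spinCoherent d fun i => U ((√(n : ℝ))⁻¹ • u) i 0) =
      ((∑ k : Fin (d + 1), overlapTerm c (euclid u) n d k : ℝ) : ℂ) := by
  have hn0 : 0 < √(n : ℝ) := by positivity
  rw [dotProduct]
  push_cast
  refine Finset.sum_congr rfl fun k _ => ?_
  have he : euclid ((√(n : ℝ))⁻¹ • u) = euclid u / √(n : ℝ) := by
    rw [euclid_smul, abs_of_pos (by positivity)]; ring
  have hz : ‖(√c : ℂ) * alpha u‖ ^ 2 = c * euclid u ^ 2 := by
    rw [norm_mul, norm_alpha, mul_pow, Complex.norm_real, Real.norm_eq_abs, sq_abs,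
      Real.sq_sqrt hc.le]
  have haa := conj_alpha_mul_alpha u
  have hsqrt : √((d.choose k : ℝ) / (n : ℝ) ^ (k : ℕ) / (k : ℕ).factorial) =
      √(d.choose k : ℝ) / √(n : ℝ) ^ (k : ℕ) / √((k : ℕ).factorial : ℝ) := by
    rw [Real.sqrt_div (by positivity), Real.sqrt_div (by positivity)]
    congr 2
    rw [Real.sqrt_eq_iff_mul_self_eq (by positivity) (by positivity), ← mul_pow,
      Real.mul_self_sqrt (by positivity)]
  rw [Pi.star_apply, truncCoherent_apply, hz, spinCoherent, U_eq, he, alpha_smul, overlapTerm,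
    hsqrt]
  simp only [RCLike.star_def, map_div₀, map_mul, map_pow, Complex.conj_ofReal, Matrix.of_apply,
    Matrix.cons_val', Matrix.cons_val_zero, Matrix.cons_val_one, Matrix.cons_val_fin_one]
  push_cast
  rw [show (√c * (euclid u : ℂ) ^ 2 * (Real.sinc (euclid u / √(n : ℝ)) : ℂ)) =
    √c * (starRingEnd ℂ) (alpha u) * (alpha u * Real.sinc (euclid u / √(n : ℝ))) by
      rw [← haa]; ring]
  simp only [mul_pow, inv_pow]
  ring

/-- One vector has norm one and the other at most one, so the squared distance is at most `2 - 2 *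
overlap`. -/
theorem tendsto_normSq_sub {ι : Type*} {l : Filter ι} {n d : ι → ℕ} {c : ℝ} (hc : 0 < c)
    (hn : Tendsto n l atTop) (hd : Tendsto (fun i => (d i : ℝ) / n i) l (𝓝 c)) (u : ℝ × ℝ) :
    Tendsto (fun i => normSq (truncCoherent (d i) ((√c : ℂ) * alpha u) -
      spinCoherent (d i) fun j => U ((√(n i : ℝ))⁻¹ • u) j 0)) l (𝓝 0) := by
  have h := (tendsto_sum_overlapTerm hc (euclid u) hn hd).const_mul 2
  have h2 := (tendsto_const_nhds (x := (2 : ℝ))).sub h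
  rw [mul_one, sub_self] at h2
  refine tendsto_of_tendsto_of_tendsto_of_le_of_le' tendsto_const_nhds h2
    (Eventually.of_forall fun i => Finset.sum_nonneg fun k _ => by positivity) ?_
  filter_upwards [hn.eventually_gt_atTop 0] with i hi
  rw [normSq_sub, star_truncCoherent_dotProduct hc (by omega), Complex.ofReal_re,
    normSq_spinCoherent]
  have := normSq_truncCoherent_le (d i) ((√c : ℂ) * alpha u)
  linarith

/-- The qubit expectation divided by `μ` is `1 + t / n`, with `t` tending to `-((2μ - 1) / μ) |u -
v₀|²`. -/
theorem tendsto_symForm_spinCoherent {ι : Type*} {l : Filter ι} {n d : ι → ℕ} {v : ι → ℝ × ℝ}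
    {v₀ : ℝ × ℝ} {μ : ℝ} (hμ : 0 < μ) {c : ℝ}
    (hn : Tendsto n l atTop) (hd : Tendsto (fun i => (d i : ℝ) / n i) l (𝓝 c))
    (hv : Tendsto v l (𝓝 v₀)) (u : ℝ × ℝ) :
    Tendsto (fun i => symForm (d i) μ (U ((√(n i : ℝ))⁻¹ • v i))
      (spinCoherent (d i) fun j => U ((√(n i : ℝ))⁻¹ • u) j 0) / μ ^ d i) l
      (𝓝 (Real.exp (c * (-((2 * μ - 1) / μ) * euclid (u - v₀) ^ 2)))) := by
  have hev : Tendsto (fun i => euclid (v i)) l (𝓝 (euclid v₀)) :=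
    (continuous_euclid.tendsto v₀).comp hv
  have hav : Tendsto (fun i => alpha (v i)) l (𝓝 (alpha v₀)) :=
    (continuous_alpha.tendsto v₀).comp hv
  have h1 : Tendsto (fun i => euclid u / √(n i : ℝ)) l (𝓝 0) :=
    tendsto_div_sqrt hn tendsto_const_nhds
  have h2 : Tendsto (fun i => euclid (v i) / √(n i : ℝ)) l (𝓝 0) := tendsto_div_sqrt hn hev
  have cos1 : ∀ {f : ι → ℝ}, Tendsto f l (𝓝 0) → Tendsto (fun i => Real.cos (f i)) l (𝓝 1) :=
    fun h => by
      have := (Real.continuous_cos.tendsto 0).comp h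
      rw [Real.cos_zero] at this
      exact this
  have sinc1 : ∀ {f : ι → ℝ}, Tendsto f l (𝓝 0) → Tendsto (fun i => Real.sinc (f i)) l (𝓝 1) :=
    fun h => by
      have := (Real.continuous_sinc.tendsto 0).comp h
      rw [Real.sinc_zero] at this
      exact this
  have hre : ∀ {f : ι → ℝ}, Tendsto f l (𝓝 1) → Tendsto (fun i => (f i : ℂ)) l (𝓝 1) :=
    fun h => by
      have := (Complex.continuous_ofReal.tendsto 1).comp h
      rw [Complex.ofReal_one] at this
      exact this
  have hA := (hre (by simpa using (cos1 h2).mul (sinc1 h1))).mul_const (alpha u)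
  have hB := (hre (by simpa using (cos1 h1).mul (sinc1 h2))).mul hav
  have hX := (((hA.sub hB).norm).pow 2).const_mul (-((2 * μ - 1) / μ))
  rw [one_mul, one_mul, ← alpha_sub, norm_alpha] at hX
  refine (tendsto_one_add_div_pow hn hd hX).congr' ?_
  filter_upwards [hn.eventually_gt_atTop 0] with i hi
  have hn0 : 0 < √(n i : ℝ) := by positivity
  have hsq : √(n i : ℝ) ^ 2 = n i := Real.sq_sqrt (by positivity)
  have he : ∀ w, euclid ((√(n i : ℝ))⁻¹ • w) = euclid w / √(n i : ℝ) := fun w => by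
    rw [euclid_smul, abs_of_pos (by positivity)]; ring
  rw [symForm_U_spinCoherent, he, he, alpha_smul, alpha_smul, ← div_pow]
  congr 1
  have hfac : ((Real.cos (euclid (v i) / √(n i : ℝ)) * Real.sinc (euclid u / √(n i : ℝ)) : ℝ) : ℂ) *
      ((((√(n i : ℝ))⁻¹ : ℝ) : ℂ) * alpha u) -
      ((Real.cos (euclid u / √(n i : ℝ)) * Real.sinc (euclid (v i) / √(n i : ℝ)) : ℝ) : ℂ) *
      ((((√(n i : ℝ))⁻¹ : ℝ) : ℂ) * alpha (v i)) = (((√(n i : ℝ))⁻¹ : ℝ) : ℂ) *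
      (((Real.cos (euclid (v i) / √(n i : ℝ)) * Real.sinc (euclid u / √(n i : ℝ)) : ℝ) : ℂ) * alpha u -
      ((Real.cos (euclid u / √(n i : ℝ)) * Real.sinc (euclid (v i) / √(n i : ℝ)) : ℝ) : ℂ) *
        alpha (v i)) := by ring
  rw [hfac, norm_mul, mul_pow, Complex.norm_real, Real.norm_eq_abs, sq_abs, inv_pow, hsq]
  have : (n i : ℝ) ≠ 0 := by positivity
  field_simp
  ring

theorem tendsto_symForm_truncCoherent {ι : Type*} {l : Filter ι} {n d : ι → ℕ} {v : ι → ℝ × ℝ}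
    {v₀ : ℝ × ℝ} {μ : ℝ} (hμ : 1 / 2 < μ) (h1 : μ ≤ 1)
    (hn : Tendsto n l atTop) (hd : Tendsto (fun i => (d i : ℝ) / n i) l (𝓝 (2 * μ - 1)))
    (hv : Tendsto v l (𝓝 v₀)) (u : ℝ × ℝ) :
    Tendsto (fun i => symForm (d i) μ (U ((√(n i : ℝ))⁻¹ • v i))
      (truncCoherent (d i) ((√(2 * μ - 1) : ℂ) * alpha u)) / μ ^ d i) l
      (𝓝 (Real.exp ((2 * μ - 1) * (-((2 * μ - 1) / μ) * euclid (u - v₀) ^ 2)))) := by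
  have hc : 0 < 2 * μ - 1 := by linarith
  have hμ0 : 0 < μ := by linarith
  have hs := tendsto_symForm_spinCoherent hμ0 hn hd hv u
  -- The factor `4` bounds `2 (‖x‖² + ‖y‖²)` in `sq_symForm_sub_le`.
  have hN := ((tendsto_normSq_sub hc hn hd u).mul_const 4).sqrt
  rw [zero_mul, Real.sqrt_zero] at hN
  have hdiff : Tendsto (fun i => symForm (d i) μ (U ((√(n i : ℝ))⁻¹ • v i))
      (truncCoherent (d i) ((√(2 * μ - 1) : ℂ) * alpha u)) / μ ^ d i -
      symForm (d i) μ (U ((√(n i : ℝ))⁻¹ • v i))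
      (spinCoherent (d i) fun j => U ((√(n i : ℝ))⁻¹ • u) j 0) / μ ^ d i) l (𝓝 0) := by
    refine squeeze_zero_norm (fun i => ?_) hN
    have hb := sq_symForm_sub_le hμ.le h1 (U_mul_conjTranspose ((√(n i : ℝ))⁻¹ • v i)) (d i)
      (truncCoherent (d i) ((√(2 * μ - 1) : ℂ) * alpha u))
      (spinCoherent (d i) fun j => U ((√(n i : ℝ))⁻¹ • u) j 0)
    rw [normSq_spinCoherent] at hb
    have hle := normSq_truncCoherent_le (d i) ((√(2 * μ - 1) : ℂ) * alpha u)
    have hnn : 0 ≤ normSq (truncCoherent (d i) ((√(2 * μ - 1) : ℂ) * alpha u) -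
      spinCoherent (d i) fun j => U ((√(n i : ℝ))⁻¹ • u) j 0) :=
      Finset.sum_nonneg fun k _ => by positivity
    refine Real.abs_le_sqrt ?_
    rw [← sub_div, div_pow, div_le_iff₀ (by positivity)]
    refine hb.trans ?_
    rw [mul_comm ((μ ^ d i) ^ 2)]
    gcongr
    linarith
  simpa using hdiff.add hs

theorem tendsto_planeJacobian {ι : Type*} {l : Filter ι} {n : ι → ℕ} (hn : Tendsto n l atTop)
    (u : ℝ × ℝ) :
    Tendsto (fun i => (n i : ℝ) * planeJacobian (n i) u) l (𝓝 (1 / Real.pi)) := by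
  have h0 : Tendsto (fun i => 2 * euclid u / √(n i : ℝ)) l (𝓝 0) :=
    tendsto_div_sqrt hn tendsto_const_nhds
  have h1 : Tendsto (fun i => Real.sinc (2 * euclid u / √(n i : ℝ)) / Real.pi) l
      (𝓝 (1 / Real.pi)) := by
    simpa using ((Real.continuous_sinc.tendsto 0).comp h0).div_const Real.pi
  refine h1.congr' ?_
  filter_upwards [hn.eventually_gt_atTop 0, h0.eventually (gt_mem_nhds Real.pi_pos)] with i hi hi2
  have hn0 : 0 < √(n i : ℝ) := by positivity
  have hn1 : (n i : ℝ) ≠ 0 := by positivity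
  rw [div_lt_iff₀ hn0] at hi2
  rw [planeJacobian, if_pos (by linarith)]
  field_simp

/-! ### Uniform convergence of the block laws in total variation -/

/-- The density on the plane of the covariant measurement in the block of spin `d/2`, for the
qubit rotation `B`. -/
def covPlane (μ : ℝ) (n d : ℕ) (B : QubitOp) (u : ℝ × ℝ) : ℝ :=
  ((d : ℝ) + 1) * symForm d μ B (spinCoherent d fun i => U ((√(n : ℝ))⁻¹ • u) i 0) *
    planeJacobian n u

/-- The density on the plane of the heterodyne measurement in the block of spin `d/2`, for the
qubit rotation `B`. -/
def hetPlane (μ : ℝ) (d : ℕ) (B : QubitOp) (u : ℝ × ℝ) : ℝ :=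
  (2 * μ - 1) / Real.pi * symForm d μ B (truncCoherent d ((√(2 * μ - 1) : ℂ) * alpha u))

/-- The common limit of the block densities. -/
def gaussPlane (μ : ℝ) (v u : ℝ × ℝ) : ℝ :=
  (2 * μ - 1) / Real.pi * Real.exp ((2 * μ - 1) * (-((2 * μ - 1) / μ) * euclid (u - v) ^ 2))

theorem continuous_spinCoherent (d : ℕ) : Continuous (spinCoherent d) := by
  unfold spinCoherent; fun_prop

theorem continuous_symForm_spinCoherent (μ : ℝ) (n d : ℕ) (B : QubitOp) :
    Continuous fun u : ℝ × ℝ =>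
      symForm d μ B (spinCoherent d fun i => U ((√(n : ℝ))⁻¹ • u) i 0) := by
  refine (continuous_symForm d μ B).comp ((continuous_spinCoherent d).comp ?_)
  have h : Continuous fun u : ℝ × ℝ => U ((√(n : ℝ))⁻¹ • u) :=
    continuous_U.comp (continuous_const_smul _)
  exact continuous_pi fun i => h.matrix_elem i 0

theorem measurable_covPlane (μ : ℝ) (n d : ℕ) (B : QubitOp) : Measurable (covPlane μ n d B) :=
  ((continuous_symForm_spinCoherent μ n d B).measurable.const_mul _).mul
    (measurable_planeJacobian n)

theorem continuous_hetPlane (μ : ℝ) (d : ℕ) (B : QubitOp) : Continuous (hetPlane μ d B) :=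
  continuous_const.mul ((continuous_symForm d μ B).comp
    ((continuous_truncCoherent d).comp (continuous_const.mul continuous_alpha)))

theorem continuous_gaussPlane (μ : ℝ) (v : ℝ × ℝ) : Continuous (gaussPlane μ v) := by
  have h : Continuous fun u : ℝ × ℝ => euclid (u - v) :=
    continuous_euclid.comp (continuous_id.sub continuous_const)
  unfold gaussPlane
  fun_prop

theorem lintegral_covPlane {μ : ℝ} (h0 : 0 ≤ μ) (h1 : μ ≤ 1) {B : QubitOp} (hB : B * Bᴴ = 1)
    {n : ℕ} (hn : n ≠ 0) (d : ℕ) :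
    ∫⁻ u, ENNReal.ofReal (covPlane μ n d B u) = ENNReal.ofReal (symTrace d μ (1 - μ)) := by
  have hm : Measurable fun u : ℝ × ℝ => ENNReal.ofReal
      (((d : ℝ) + 1) * symForm d μ B (spinCoherent d fun i => U ((√(n : ℝ))⁻¹ • u) i 0)) :=
    ((continuous_symForm_spinCoherent μ n d B).measurable.const_mul _).ennreal_ofReal
  rw [← lintegral_covariant h0 h1 hB d]
  have h := lintegral_sphereToPlane hn _ hm
  simp only [U_sphereToPlane hn] at h
  rw [h]
  refine lintegral_congr fun u => ?_
  rw [covPlane, ENNReal.ofReal_mul]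
  exact mul_nonneg (by positivity) (symForm_nonneg h0 h1 d B _)

/-- A product of two Gaussian integrals. The value agrees with the limit in `tendsto_symTrace_div`;
no mass escapes, as Scheffé's lemma requires. -/
theorem lintegral_gaussPlane {μ : ℝ} (hμ : 1 / 2 < μ) (v : ℝ × ℝ) :
    ∫⁻ u, ENNReal.ofReal (gaussPlane μ v u) = ENNReal.ofReal (μ / (2 * μ - 1)) := by
  have hc : 0 < 2 * μ - 1 := by linarith
  have hμ0 : 0 < μ := by linarith
  set b := (2 * μ - 1) ^ 2 / μ with hb
  have hb0 : 0 < b := by positivity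
  have hg : ∀ u, gaussPlane μ v u = (2 * μ - 1) / Real.pi *
      (Real.exp (-b * (u.1 - v.1) ^ 2) * Real.exp (-b * (u.2 - v.2) ^ 2)) := by
    intro u
    rw [gaussPlane, ← Real.exp_add, euclid_sq, hb]
    congr 2
    simp only [Prod.fst_sub, Prod.snd_sub]
    field_simp
    ring
  have hi : ∀ t : ℝ, Integrable fun x : ℝ => Real.exp (-b * (x - t) ^ 2) := fun t =>
    (integrable_exp_neg_mul_sq hb0).comp_sub_right t
  have he : ∀ t : ℝ, ∫ x : ℝ, Real.exp (-b * (x - t) ^ 2) = √(Real.pi / b) := fun t => by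
    rw [integral_sub_right_eq_self (fun x : ℝ => Real.exp (-b * x ^ 2)) t, integral_gaussian]
  have hint : Integrable (gaussPlane μ v) := by
    rw [funext hg]
    exact ((hi v.1).mul_prod (hi v.2)).const_mul _
  rw [← ofReal_integral_eq_lintegral_ofReal hint (Eventually.of_forall fun u => by
    rw [hg]; positivity)]
  congr 1
  simp only [hg]
  rw [integral_const_mul, Measure.volume_eq_prod, integral_prod_mul
    (fun x : ℝ => Real.exp (-b * (x - v.1) ^ 2)) (fun x : ℝ => Real.exp (-b * (x - v.2) ^ 2)),
    he, he, Real.mul_self_sqrt (by positivity), hb]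
  field_simp

theorem tendsto_symTrace_div {μ : ℝ} (hμ : 1 / 2 < μ) (h1 : μ ≤ 1) {ι : Type*} {l : Filter ι}
    {d : ι → ℕ} (hd : Tendsto d l atTop) :
    Tendsto (fun i => symTrace (d i) μ (1 - μ) / μ ^ d i) l (𝓝 (μ / (2 * μ - 1))) := by
  have hc : 0 < 2 * μ - 1 := by linarith
  have hμ0 : 0 < μ := by linarith
  have hr : Tendsto (fun i => ((1 - μ) / μ) ^ (d i)) l (𝓝 0) :=
    (tendsto_pow_atTop_nhds_zero_of_lt_one (div_nonneg (by linarith) hμ0.le)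
      ((div_lt_one hμ0).2 (by linarith))).comp hd
  have h := ((tendsto_const_nhds (x := μ)).sub (hr.const_mul (1 - μ))).div_const (2 * μ - 1)
  rw [mul_zero, sub_zero] at h
  refine h.congr fun i => ?_
  have hs := sub_mul_symTrace (d i) μ (1 - μ)
  have hs' : symTrace (d i) μ (1 - μ) = (μ ^ (d i + 1) - (1 - μ) ^ (d i + 1)) / (2 * μ - 1) := by
    rw [eq_div_iff hc.ne', ← hs]; ring
  rw [hs', div_pow]
  field_simp
  ring

/-- The prefactor is `(d + 1) / n`, tending to `2μ - 1`, times `n` times the Jacobian, tending to `1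
/ π`. -/
theorem tendsto_covPlane {ι : Type*} {l : Filter ι} {n d : ι → ℕ} {v : ι → ℝ × ℝ}
    {v₀ : ℝ × ℝ} {μ : ℝ} (hμ : 0 < μ)
    (hn : Tendsto n l atTop) (hd : Tendsto (fun i => (d i : ℝ) / n i) l (𝓝 (2 * μ - 1)))
    (hv : Tendsto v l (𝓝 v₀)) (u : ℝ × ℝ) :
    Tendsto (fun i => covPlane μ (n i) (d i) (U ((√(n i : ℝ))⁻¹ • v i)) u / μ ^ d i) l
      (𝓝 (gaussPlane μ v₀ u)) := by
  have hn' : Tendsto (fun i => (n i : ℝ)) l atTop := tendsto_natCast_atTop_atTop.comp hn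
  have hd1 : Tendsto (fun i => (d i : ℝ) / n i + (n i : ℝ)⁻¹) l (𝓝 (2 * μ - 1)) := by
    simpa using hd.add (tendsto_inv_atTop_zero.comp hn')
  have h := (hd1.mul (tendsto_planeJacobian hn u)).mul (tendsto_symForm_spinCoherent hμ hn hd hv u)
  rw [mul_one_div] at h
  refine h.congr' ?_
  filter_upwards [hn.eventually_gt_atTop 0] with i hi
  have hn1 : (n i : ℝ) ≠ 0 := by positivity
  rw [covPlane]
  field_simp

theorem tendsto_hetPlane {ι : Type*} {l : Filter ι} {n d : ι → ℕ} {v : ι → ℝ × ℝ}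
    {v₀ : ℝ × ℝ} {μ : ℝ} (hμ : 1 / 2 < μ) (h1 : μ ≤ 1)
    (hn : Tendsto n l atTop) (hd : Tendsto (fun i => (d i : ℝ) / n i) l (𝓝 (2 * μ - 1)))
    (hv : Tendsto v l (𝓝 v₀)) (u : ℝ × ℝ) :
    Tendsto (fun i => hetPlane μ (d i) (U ((√(n i : ℝ))⁻¹ • v i)) u / μ ^ d i) l
      (𝓝 (gaussPlane μ v₀ u)) := by
  refine ((tendsto_symForm_truncCoherent hμ h1 hn hd hv u).const_mul _).congr fun i => ?_
  rw [hetPlane, mul_div_assoc]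

/-- The distance between the two block laws, relative to the largest eigenvalue `μ ^ d` of the
block state. -/
def blockDist (μ : ℝ) (n d : ℕ) (B : QubitOp) : ℝ≥0∞ :=
  ∫⁻ u, (ENNReal.ofReal (covPlane μ n d B u / μ ^ d) - ENNReal.ofReal (hetPlane μ d B u / μ ^ d)) +
    (ENNReal.ofReal (hetPlane μ d B u / μ ^ d) - ENNReal.ofReal (covPlane μ n d B u / μ ^ d))

theorem tsub_add_tsub_le (a b c : ℝ≥0∞) :
    (a - b) + (b - a) ≤ ((a - c) + (c - a)) + ((b - c) + (c - b)) := by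
  have h1 : a - b ≤ (a - c) + (c - b) := tsub_le_tsub_add_tsub
  have h2 : b - a ≤ (b - c) + (c - a) := tsub_le_tsub_add_tsub
  calc (a - b) + (b - a) ≤ ((a - c) + (c - b)) + ((b - c) + (c - a)) := add_le_add h1 h2
    _ = _ := by ring

theorem lintegral_ofReal_div {X : Type*} [MeasurableSpace X] {ν : Measure X} (f : X → ℝ)
    {c : ℝ} (hc : 0 < c) :
    ∫⁻ x, ENNReal.ofReal (f x / c) ∂ν = (∫⁻ x, ENNReal.ofReal (f x) ∂ν) / ENNReal.ofReal c := by
  simp only [ENNReal.ofReal_div_of_pos hc]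
  simp only [div_eq_mul_inv]
  exact lintegral_mul_const' _ _ (ENNReal.inv_ne_top.2 (ENNReal.ofReal_pos.2 hc).ne')

/-- Scheffé's lemma for each measurement, then the triangle inequality through the Gaussian. The
general filter lets `n`, `d` and `v` vary together, which is what uniformity needs. -/
theorem tendsto_blockDist {ι : Type*} {l : Filter ι} [l.IsCountablyGenerated] {n d : ι → ℕ}
    {v : ι → ℝ × ℝ} {v₀ : ℝ × ℝ} {μ : ℝ} (hμ : 1 / 2 < μ) (h1 : μ ≤ 1)
    (hn : Tendsto n l atTop) (hd : Tendsto (fun i => (d i : ℝ) / n i) l (𝓝 (2 * μ - 1)))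
    (hv : Tendsto v l (𝓝 v₀)) :
    Tendsto (fun i => blockDist μ (n i) (d i) (U ((√(n i : ℝ))⁻¹ • v i))) l (𝓝 0) := by
  have hc : 0 < 2 * μ - 1 := by linarith
  have hμ0 : 0 < μ := by linarith
  have hG : Measurable fun u => ENNReal.ofReal (gaussPlane μ v₀ u) :=
    (continuous_gaussPlane μ v₀).measurable.ennreal_ofReal
  have hcm : ∀ i, Measurable fun u => ENNReal.ofReal
      (covPlane μ (n i) (d i) (U ((√(n i : ℝ))⁻¹ • v i)) u / μ ^ d i) := fun i =>
    ((measurable_covPlane _ _ _ _).div_const _).ennreal_ofReal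
  have hhm : ∀ i, Measurable fun u => ENNReal.ofReal
      (hetPlane μ (d i) (U ((√(n i : ℝ))⁻¹ • v i)) u / μ ^ d i) := fun i =>
    ((continuous_hetPlane _ _ _).measurable.div_const _).ennreal_ofReal
  have hGfin : ∫⁻ u, ENNReal.ofReal (gaussPlane μ v₀ u) ≠ ∞ := by
    rw [lintegral_gaussPlane hμ]; exact ENNReal.ofReal_ne_top
  have hmass : Tendsto (fun i => ENNReal.ofReal (symTrace (d i) μ (1 - μ)) /
      ENNReal.ofReal (μ ^ d i)) l (𝓝 (∫⁻ u, ENNReal.ofReal (gaussPlane μ v₀ u))) := by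
    rw [lintegral_gaussPlane hμ]
    refine (ENNReal.tendsto_ofReal (tendsto_symTrace_div hμ h1
      (tendsto_nat_of_div hc hn hd))).congr fun i => ?_
    rw [ENNReal.ofReal_div_of_pos (by positivity)]
  have hcov := tendsto_lintegral_sub_add_sub (l := l) hcm hG hGfin
    (fun u => ENNReal.ofReal_ne_top)
    (fun u => ENNReal.tendsto_ofReal (tendsto_covPlane hμ0 hn hd hv u))
    (hmass.congr' (by
      filter_upwards [hn.eventually_gt_atTop 0] with i hi
      rw [lintegral_ofReal_div _ (by positivity),
        lintegral_covPlane hμ0.le h1 (U_mul_conjTranspose _) (by omega)]))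
  have hhet := tendsto_lintegral_sub_add_sub (l := l) hhm hG hGfin
    (fun u => ENNReal.ofReal_ne_top)
    (fun u => ENNReal.tendsto_ofReal (tendsto_hetPlane hμ h1 hn hd hv u))
    (hmass.congr fun i => by
      rw [lintegral_ofReal_div _ (by positivity)]
      simp only [hetPlane]
      rw [lintegral_heterodyne hμ h1 (U_mul_conjTranspose _)])
  have hsum := hcov.add hhet
  rw [add_zero] at hsum
  refine tendsto_of_tendsto_of_tendsto_of_le_of_le tendsto_const_nhds hsum
    (fun i => zero_le) fun i => ?_
  exact (lintegral_mono fun u => tsub_add_tsub_le _ _ (ENNReal.ofReal (gaussPlane μ v₀ u))).trans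
    (lintegral_add_left (((hcm i).sub hG).add (hG.sub (hcm i))) _).le

theorem exists_forall_blockDist_lt {μ : ℝ} (hμ : 1 / 2 < μ) (h1 : μ ≤ 1) {K : Set (ℝ × ℝ)}
    (hK : IsCompact K) {ε : ℝ≥0∞} (hε : 0 < ε) :
    ∃ N : ℕ, ∃ δ : ℝ, 0 < δ ∧ ∀ n d : ℕ, N ≤ n → |(d : ℝ) / n - (2 * μ - 1)| < δ →
      ∀ v ∈ K, blockDist μ n d (U ((√(n : ℝ))⁻¹ • v)) < ε := by
  -- This filter on pairs `(n, d)` expresses `n → ∞` and `d / n → 2μ - 1`. Convergence along its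
  -- product with `𝓝 v₀` is uniform near `v₀`, and finitely many such neighbourhoods cover `K`.
  set A : Filter (ℕ × ℕ) := comap Prod.fst atTop ⊓
    comap (fun p : ℕ × ℕ => (p.2 : ℝ) / p.1) (𝓝 (2 * μ - 1)) with hA
  have key : ∀ v₀ ∈ K, ∀ᶠ z : (ℝ × ℝ) × (ℕ × ℕ) in 𝓝 v₀ ×ˢ A,
      blockDist μ z.2.1 z.2.2 (U ((√(z.2.1 : ℝ))⁻¹ • z.1)) < ε := by
    intro v₀ _
    have hn : Tendsto (fun z : (ℝ × ℝ) × (ℕ × ℕ) => z.2.1) (𝓝 v₀ ×ˢ A) atTop :=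
      (tendsto_comap.mono_left inf_le_left).comp tendsto_snd
    have hd : Tendsto (fun z : (ℝ × ℝ) × (ℕ × ℕ) => (z.2.2 : ℝ) / z.2.1) (𝓝 v₀ ×ˢ A)
        (𝓝 (2 * μ - 1)) := (tendsto_comap.mono_left inf_le_right).comp tendsto_snd
    exact (tendsto_blockDist hμ h1 hn hd tendsto_fst).eventually (gt_mem_nhds hε)
  have hall : ∀ᶠ p in A, ∀ v ∈ K, blockDist μ p.1 p.2 (U ((√(p.1 : ℝ))⁻¹ • v)) < ε := by
    have : ∀ v₀ ∈ K, ∃ s ∈ 𝓝 v₀, ∀ᶠ p in A, ∀ v ∈ s,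
        blockDist μ p.1 p.2 (U ((√(p.1 : ℝ))⁻¹ • v)) < ε := by
      intro v₀ hv₀
      obtain ⟨pa, ha, pb, hb, h⟩ := eventually_prod_iff.1 (key v₀ hv₀)
      exact ⟨{v | pa v}, ha, hb.mono fun p hp v hv => h hv hp⟩
    choose! s hs hs' using this
    obtain ⟨t, htK, ht⟩ := hK.elim_nhds_subcover s hs
    filter_upwards [(eventually_all_finset t).2 fun v hv => hs' v (htK v hv)] with p hp v hv
    obtain ⟨w, hw, hvw⟩ := Set.mem_iUnion₂.1 (ht hv)
    exact hp w hw v hvw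
  obtain ⟨s, hs, t, ht, hst⟩ := mem_inf_iff_superset.1 hall
  obtain ⟨s', hs', hs2⟩ := mem_comap.1 hs
  obtain ⟨t', ht', ht2⟩ := mem_comap.1 ht
  obtain ⟨N, hN⟩ := mem_atTop_sets.1 hs'
  obtain ⟨δ, hδ, hball⟩ := Metric.mem_nhds_iff.1 ht'
  refine ⟨N, δ, hδ, fun n d hn hd v hv => ?_⟩
  exact hst (show ((n, d) : ℕ × ℕ) ∈ s ∩ t from ⟨hs2 (hN n hn), ht2 (hball hd)⟩) v hv

/-! ### The laws of the outcomes -/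

theorem two_mul_le_of_mem_range {n l : ℕ} (hl : l ∈ Finset.range (n / 2 + 1)) : 2 * l ≤ n := by
  rw [Finset.mem_range] at hl; omega

theorem covLaw_eq {μ : ℝ} {B : QubitOp} (hB : B * Bᴴ = 1) (n : ℕ) :
    covLaw n (B * rho0 μ * Bᴴ) = ∑ l ∈ Finset.range (n / 2 + 1),
      Measure.map (covEstimate n (n - 2 * l)) (sphereMeasure.withDensity fun s =>
        ENNReal.ofReal (blockWeight μ n l * ((((n - 2 * l : ℕ) : ℝ) + 1) *
          symForm (n - 2 * l) μ B (spinCoherent (n - 2 * l) fun i => rotFromUp s i 0)))) :=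
by
  rw [covLaw, outcomeLaw]
  exact Finset.sum_congr rfl fun l hl => by
    simp only [trace_covDensity (two_mul_le_of_mem_range hl) hB]

theorem hetLaw_eq {μ : ℝ} {B : QubitOp} (hB : B * Bᴴ = 1) (n : ℕ) :
    hetLaw μ n (B * rho0 μ * Bᴴ) = ∑ l ∈ Finset.range (n / 2 + 1),
      Measure.map (hetEstimate n (n - 2 * l)) (volume.withDensity fun u =>
        ENNReal.ofReal (blockWeight μ n l * hetPlane μ (n - 2 * l) B u)) :=
by
  rw [hetLaw, outcomeLaw]
  exact Finset.sum_congr rfl fun l hl => by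
    simp only [trace_hetDensity (two_mul_le_of_mem_range hl) hB, hetPlane]

theorem lintegral_ofReal_const_mul {X : Type*} [MeasurableSpace X] {ν : Measure X} (f : X → ℝ)
    {c : ℝ} (hc : 0 ≤ c) :
    ∫⁻ x, ENNReal.ofReal (c * f x) ∂ν = ENNReal.ofReal c * ∫⁻ x, ENNReal.ofReal (f x) ∂ν := by
  simp only [ENNReal.ofReal_mul hc]
  exact lintegral_const_mul' _ _ ENNReal.ofReal_ne_top

theorem isProbabilityMeasure_sum_map {μ : ℝ} (h0 : 0 ≤ μ) (h1 : μ ≤ 1) {n : ℕ}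
    {X : Type} [MeasurableSpace X] {ν : Measure X} {e : ℕ → X → QubitOp}
    (he : ∀ l, Measurable (e l)) {f : ℕ → X → ℝ}
    (hf : ∀ l, ∫⁻ x, ENNReal.ofReal (f l x) ∂ν = ENNReal.ofReal (symTrace (n - 2 * l) μ (1 - μ))) :
    IsProbabilityMeasure (∑ l ∈ Finset.range (n / 2 + 1), Measure.map (e l)
      (ν.withDensity fun x => ENNReal.ofReal (blockWeight μ n l * f l x))) := by
  constructor
  rw [Measure.finsetSum_apply]
  have hterm : ∀ l ∈ Finset.range (n / 2 + 1), Measure.map (e l)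
      (ν.withDensity fun x => ENNReal.ofReal (blockWeight μ n l * f l x)) Set.univ =
      ENNReal.ofReal (blockWeight μ n l * symTrace (n - 2 * l) μ (1 - μ)) := fun l _ => by
    rw [Measure.map_apply (he l) MeasurableSet.univ, Set.preimage_univ,
      withDensity_apply _ MeasurableSet.univ, Measure.restrict_univ,
      lintegral_ofReal_const_mul _ (blockWeight_nonneg h0 h1 n l), hf,
      ENNReal.ofReal_mul (blockWeight_nonneg h0 h1 n l)]
  rw [Finset.sum_congr rfl hterm, ← ENNReal.ofReal_sum_of_nonneg, sum_blockWeight_mul_symTrace,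
    ENNReal.ofReal_one]
  exact fun l _ => mul_nonneg (blockWeight_nonneg h0 h1 n l)
    ((pow_nonneg h0 _).trans (pow_le_symTrace _ h0 (by linarith)))

/-- The mass is computed on the sphere, so `n = 0`, where the passage to the plane fails, is
included. -/
theorem isProbabilityMeasure_covLaw {μ : ℝ} (h0 : 0 ≤ μ) (h1 : μ ≤ 1) {B : QubitOp}
    (hB : B * Bᴴ = 1) (n : ℕ) : IsProbabilityMeasure (covLaw n (B * rho0 μ * Bᴴ)) := by
  rw [covLaw_eq hB]
  exact isProbabilityMeasure_sum_map h0 h1 (fun l => (continuous_covEstimate n _).measurable)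
    fun l => lintegral_covariant h0 h1 hB _

theorem isProbabilityMeasure_hetLaw {μ : ℝ} (hμ : 1 / 2 < μ) (h1 : μ ≤ 1) {B : QubitOp}
    (hB : B * Bᴴ = 1) (n : ℕ) : IsProbabilityMeasure (hetLaw μ n (B * rho0 μ * Bᴴ)) := by
  rw [hetLaw_eq hB]
  exact isProbabilityMeasure_sum_map (by linarith) h1
    (fun l => (continuous_hetEstimate n _).measurable) fun l => lintegral_heterodyne hμ h1 hB _

/-- For `n ≠ 0`, the law of the covariant measurement in the coordinates of the plane. -/
theorem covLaw_eq_plane {μ : ℝ} (h0 : 0 ≤ μ) (h1 : μ ≤ 1) {B : QubitOp} (hB : B * Bᴴ = 1) {n : ℕ}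
    (hn : n ≠ 0) :
    covLaw n (B * rho0 μ * Bᴴ) = ∑ l ∈ Finset.range (n / 2 + 1),
      Measure.map (hetEstimate n (n - 2 * l)) (volume.withDensity fun u =>
        ENNReal.ofReal (blockWeight μ n l * covPlane μ n (n - 2 * l) B u)) := by
  rw [covLaw_eq hB]
  refine Finset.sum_congr rfl fun l _ => Measure.ext fun A hA => ?_
  set d := n - 2 * l
  have hem := (continuous_hetEstimate n d).measurable hA
  have hcm := (continuous_covEstimate n d).measurable hA
  have hW := blockWeight_nonneg h0 h1 n l
  set q : ℝ × ℝ → ℝ≥0∞ := fun u => ENNReal.ofReal (blockWeight μ n l * (((d : ℝ) + 1) *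
    symForm d μ B (spinCoherent d fun i => U ((√(n : ℝ))⁻¹ • u) i 0))) with hq
  have hqm : Measurable q :=
    (((continuous_symForm_spinCoherent μ n d B).measurable.const_mul _).const_mul _).ennreal_ofReal
  have h := lintegral_sphereToPlane hn _ (hqm.indicator hem)
  rw [Measure.map_apply (continuous_covEstimate n d).measurable hA,
    Measure.map_apply (continuous_hetEstimate n d).measurable hA, withDensity_apply _ hem,
    withDensity_apply _ hcm, ← lintegral_indicator hem, ← lintegral_indicator hcm]
  refine Eq.trans (lintegral_congr fun s => ?_) (h.trans (lintegral_congr fun u => ?_))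
  · have hiff : sphereToPlane n s ∈ hetEstimate n d ⁻¹' A ↔ s ∈ covEstimate n d ⁻¹' A := by
      rw [Set.mem_preimage, Set.mem_preimage, hetEstimate_sphereToPlane hn]
    by_cases hs : s ∈ covEstimate n d ⁻¹' A
    · rw [Set.indicator_of_mem hs, Set.indicator_of_mem (hiff.2 hs), hq]
      simp only [U_sphereToPlane hn]
    · rw [Set.indicator_of_notMem hs, Set.indicator_of_notMem (mt hiff.1 hs)]
  · by_cases hu : u ∈ hetEstimate n d ⁻¹' A
    · rw [Set.indicator_of_mem hu, Set.indicator_of_mem hu, hq, covPlane, ← mul_assoc,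
        ENNReal.ofReal_mul]
      exact mul_nonneg hW (mul_nonneg (by positivity) (symForm_nonneg h0 h1 d B _))
    · rw [Set.indicator_of_notMem hu, Set.indicator_of_notMem hu, zero_mul]

theorem sum_map_withDensity_sub_le {Ω X ι : Type} [MeasurableSpace Ω] [MeasurableSpace X]
    {ν : Measure X} (s : Finset ι) {e : ι → X → Ω} (he : ∀ l, Measurable (e l))
    {f g : ι → X → ℝ≥0∞} (hg : ∀ l, Measurable (g l)) {A : Set Ω}
    (hA : MeasurableSet A) :
    (∑ l ∈ s, Measure.map (e l) (ν.withDensity (f l))) A -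
      (∑ l ∈ s, Measure.map (e l) (ν.withDensity (g l))) A ≤
      ∑ l ∈ s, ∫⁻ x, f l x - g l x ∂ν := by
  rw [Measure.finsetSum_apply, Measure.finsetSum_apply, tsub_le_iff_left,
    ← Finset.sum_add_distrib]
  refine Finset.sum_le_sum fun l _ => ?_
  rw [Measure.map_apply (he l) hA, Measure.map_apply (he l) hA, withDensity_apply _ (he l hA),
    withDensity_apply _ (he l hA)]
  calc ∫⁻ x in e l ⁻¹' A, f l x ∂ν ≤ ∫⁻ x in e l ⁻¹' A, g l x + (f l x - g l x) ∂ν :=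
        lintegral_mono fun x => le_add_tsub
    _ = ∫⁻ x in e l ⁻¹' A, g l x ∂ν + ∫⁻ x in e l ⁻¹' A, f l x - g l x ∂ν :=
        lintegral_add_left (hg l) _
    _ ≤ _ := by gcongr; exact Measure.restrict_le_self

/-- Images under a common map do not increase the distance. The factor `2` comes from bounding a set
and its complement separately. -/
theorem tvNorm_sum_map_withDensity_le {Ω X ι : Type} [MeasurableSpace Ω] [MeasurableSpace X]
    {ν : Measure X} (s : Finset ι) {e : ι → X → Ω} (he : ∀ l, Measurable (e l))
    {f g : ι → X → ℝ≥0∞} (hf : ∀ l, Measurable (f l)) (hg : ∀ l, Measurable (g l)) :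
    tvNorm (∑ l ∈ s, Measure.map (e l) (ν.withDensity (f l)))
      (∑ l ∈ s, Measure.map (e l) (ν.withDensity (g l))) ≤
      2 * ∑ l ∈ s, ∫⁻ x, (f l x - g l x) + (g l x - f l x) ∂ν := by
  have hsum : ∑ l ∈ s, ∫⁻ x, (f l x - g l x) + (g l x - f l x) ∂ν =
      ∑ l ∈ s, ∫⁻ x, f l x - g l x ∂ν + ∑ l ∈ s, ∫⁻ x, g l x - f l x ∂ν := by
    rw [← Finset.sum_add_distrib]
    exact Finset.sum_congr rfl fun l _ => lintegral_add_left ((hf l).sub (hg l)) _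
  rw [hsum, two_mul]
  exact iSup₂_le fun A hA => add_le_add
    (add_le_add (sum_map_withDensity_sub_le s he hg hA) (sum_map_withDensity_sub_le s he hf hA))
    (add_le_add (sum_map_withDensity_sub_le s he hg hA.compl)
      (sum_map_withDensity_sub_le s he hf hA.compl))

theorem tvNorm_covLaw_hetLaw_le {μ : ℝ} (h0 : 0 < μ) (h1 : μ ≤ 1) {B : QubitOp}
    (hB : B * Bᴴ = 1) {n : ℕ} (hn : n ≠ 0) :
    tvNorm (covLaw n (B * rho0 μ * Bᴴ)) (hetLaw μ n (B * rho0 μ * Bᴴ)) ≤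
      2 * ∑ l ∈ Finset.range (n / 2 + 1),
        ENNReal.ofReal (blockWeight μ n l * μ ^ (n - 2 * l)) * blockDist μ n (n - 2 * l) B := by
  rw [covLaw_eq_plane h0.le h1 hB hn, hetLaw_eq hB]
  refine (tvNorm_sum_map_withDensity_le _ (fun l => (continuous_hetEstimate n _).measurable)
    (fun l => ((measurable_covPlane _ _ _ _).const_mul _).ennreal_ofReal)
    (fun l => ((continuous_hetPlane _ _ _).measurable.const_mul _).ennreal_ofReal)).trans_eq ?_
  congr 1
  refine Finset.sum_congr rfl fun l _ => ?_
  have hc : 0 ≤ blockWeight μ n l * μ ^ (n - 2 * l) :=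
    mul_nonneg (blockWeight_nonneg h0.le h1 n l) (by positivity)
  rw [blockDist, ← lintegral_const_mul' _ _ ENNReal.ofReal_ne_top]
  refine lintegral_congr fun u => ?_
  have hx : ∀ x : ℝ, ENNReal.ofReal (blockWeight μ n l * x) =
      ENNReal.ofReal (blockWeight μ n l * μ ^ (n - 2 * l)) *
        ENNReal.ofReal (x / μ ^ (n - 2 * l)) := fun x => by
    rw [← ENNReal.ofReal_mul hc]
    congr 1
    field_simp
  rw [hx (covPlane _ _ _ _ _), hx (hetPlane _ _ _ _), mul_add, ENNReal.mul_sub fun _ _ => ENNReal.ofReal_ne_top,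
    ENNReal.mul_sub fun _ _ => ENNReal.ofReal_ne_top]

/-- The crude bound by the sum of the two masses, used for the atypical blocks. -/
theorem ofReal_mul_blockDist_le {μ : ℝ} (hμ : 1 / 2 < μ) (h1 : μ ≤ 1) {B : QubitOp}
    (hB : B * Bᴴ = 1) {n : ℕ} (hn : n ≠ 0) (d : ℕ) {w : ℝ} (hw : 0 ≤ w) :
    ENNReal.ofReal (w * μ ^ d) * blockDist μ n d B ≤
      2 * ENNReal.ofReal (w * symTrace d μ (1 - μ)) := by
  have h0 : 0 < μ := by linarith
  have hhet : ∫⁻ u, ENNReal.ofReal (hetPlane μ d B u) = ENNReal.ofReal (symTrace d μ (1 - μ)) :=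
    lintegral_heterodyne hμ h1 hB d
  have hle : blockDist μ n d B ≤ 2 * ENNReal.ofReal (symTrace d μ (1 - μ) / μ ^ d) := by
    calc blockDist μ n d B ≤ ∫⁻ u, ENNReal.ofReal (covPlane μ n d B u / μ ^ d) +
          ENNReal.ofReal (hetPlane μ d B u / μ ^ d) :=
          lintegral_mono fun u => add_le_add tsub_le_self tsub_le_self
      _ = 2 * ENNReal.ofReal (symTrace d μ (1 - μ) / μ ^ d) := by
          rw [lintegral_add_left ((measurable_covPlane _ _ _ _).div_const _).ennreal_ofReal,
            lintegral_ofReal_div _ (by positivity), lintegral_ofReal_div _ (by positivity),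
            lintegral_covPlane h0.le h1 hB hn, hhet, ← ENNReal.ofReal_div_of_pos (by positivity),
            two_mul]
  calc ENNReal.ofReal (w * μ ^ d) * blockDist μ n d B
      ≤ ENNReal.ofReal (w * μ ^ d) * (2 * ENNReal.ofReal (symTrace d μ (1 - μ) / μ ^ d)) := by
        gcongr
    _ = 2 * (ENNReal.ofReal (w * μ ^ d) * ENNReal.ofReal (symTrace d μ (1 - μ) / μ ^ d)) := by ring
    _ = _ := by
        rw [← ENNReal.ofReal_mul (by positivity)]
        congr 2
        field_simp

/-- A uniform bound on the total variation distance, with the blocks split according to whether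
`2j/n` is close to `2μ - 1`. -/
theorem tvNorm_le_of_forall_blockDist_lt {μ : ℝ} (hμ : 1 / 2 < μ) (h1 : μ ≤ 1) {B : QubitOp}
    (hB : B * Bᴴ = 1) {n : ℕ} (hn : n ≠ 0) {δ : ℝ} (hδ : 0 < δ) {ε : ℝ≥0∞}
    (h : ∀ d : ℕ, |(d : ℝ) / n - (2 * μ - 1)| < δ → blockDist μ n d B < ε) :
    tvNorm (covLaw n (B * rho0 μ * Bᴴ)) (hetLaw μ n (B * rho0 μ * Bᴴ)) ≤
      2 * ε + 4 * ENNReal.ofReal (4 / (δ ^ 2 * n * (2 * μ - 1))) := by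
  have h0 : 0 < μ := by linarith
  have hW := blockWeight_nonneg h0.le h1 n
  have hS : ∀ d, μ ^ d ≤ symTrace d μ (1 - μ) := fun d => pow_le_symTrace d h0.le (by linarith)
  have hS0 : ∀ d, 0 ≤ symTrace d μ (1 - μ) := fun d => (by positivity : 0 ≤ μ ^ d).trans (hS d)
  refine (tvNorm_covLaw_hetLaw_le h0 h1 hB hn).trans ?_
  rw [← Finset.sum_filter_add_sum_filter_not (Finset.range (n / 2 + 1))
    (fun l => δ ≤ |((n - 2 * l : ℕ) : ℝ) / n - (2 * μ - 1)|), mul_add, add_comm]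
  refine add_le_add ?_ ?_
  · gcongr
    calc _ ≤ ∑ l ∈ (Finset.range (n / 2 + 1)).filter
            (fun l => ¬ δ ≤ |((n - 2 * l : ℕ) : ℝ) / n - (2 * μ - 1)|),
            ENNReal.ofReal (blockWeight μ n l * symTrace (n - 2 * l) μ (1 - μ)) * ε := by
          refine Finset.sum_le_sum fun l hl => ?_
          gcongr
          · exact hW l
          · exact hS _
          · exact (h _ (not_le.1 (Finset.mem_filter.1 hl).2)).le
      _ ≤ ∑ l ∈ Finset.range (n / 2 + 1),
            ENNReal.ofReal (blockWeight μ n l * symTrace (n - 2 * l) μ (1 - μ)) * ε :=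
          Finset.sum_le_sum_of_subset (Finset.filter_subset _ _)
      _ = ε := by
          rw [← Finset.sum_mul, ← ENNReal.ofReal_sum_of_nonneg fun l _ => mul_nonneg (hW l) (hS0 _),
            sum_blockWeight_mul_symTrace, ENNReal.ofReal_one, one_mul]
  · calc _ ≤ 2 * ∑ l ∈ (Finset.range (n / 2 + 1)).filter
            (fun l => δ ≤ |((n - 2 * l : ℕ) : ℝ) / n - (2 * μ - 1)|),
            2 * ENNReal.ofReal (blockWeight μ n l * symTrace (n - 2 * l) μ (1 - μ)) := by
          gcongr 2 * ?_
          exact Finset.sum_le_sum fun l _ => ofReal_mul_blockDist_le hμ h1 hB hn _ (hW l)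
      _ = 4 * ENNReal.ofReal (∑ l ∈ (Finset.range (n / 2 + 1)).filter
            (fun l => δ ≤ |((n - 2 * l : ℕ) : ℝ) / n - (2 * μ - 1)|),
            blockWeight μ n l * symTrace (n - 2 * l) μ (1 - μ)) := by
          rw [← Finset.mul_sum, ENNReal.ofReal_sum_of_nonneg
            fun l _ => mul_nonneg (hW l) (hS0 _), ← mul_assoc]
          norm_num
      _ ≤ _ := by
          gcongr
          exact sum_blockWeight_tail_le hμ h1 hn hδ

theorem tendsto_iSup_tvNorm {μ : ℝ} (hμ : 1 / 2 < μ) (h1 : μ ≤ 1) {I : Set ℝ}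
    (hI : Bornology.IsBounded I) :
    Tendsto (fun n : ℕ => ⨆ ρ ∈ localFamily μ I n, tvNorm (covLaw n ρ) (hetLaw μ n ρ))
      atTop (𝓝 0) := by
  rw [ENNReal.tendsto_nhds_zero]
  intro ε hε
  have hc : 0 < 2 * μ - 1 := by linarith
  -- Boundedness of `I` gives a compact closure of `I ×ˢ I`. The tolerance `ε / 4` becomes `ε / 2`
  -- after the factor `2`, leaving `ε / 2` for the tail.
  obtain ⟨N, δ, hδ, hN⟩ := exists_forall_blockDist_lt hμ h1
    (hI.prod hI).isCompact_closure (ENNReal.div_pos hε.ne' (by norm_num : (4 : ℝ≥0∞) ≠ ∞))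
  have htail : Tendsto (fun n : ℕ => 4 * ENNReal.ofReal (4 / (δ ^ 2 * n * (2 * μ - 1)))) atTop
      (𝓝 0) := by
    have h : Tendsto (fun n : ℕ => 4 / (δ ^ 2 * (n : ℝ) * (2 * μ - 1))) atTop (𝓝 0) :=
      tendsto_const_nhds.div_atTop ((tendsto_natCast_atTop_atTop.const_mul_atTop
        (by positivity)).atTop_mul_const hc)
    have := ENNReal.Tendsto.const_mul (a := 4) (ENNReal.tendsto_ofReal h) (Or.inr (by norm_num))
    simpa using this
  filter_upwards [eventually_ge_atTop N, eventually_ne_atTop 0,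
    ENNReal.tendsto_nhds_zero.1 htail (ε / 2) (ENNReal.half_pos hε.ne')] with n hn hn0 ht
  refine iSup₂_le fun ρ hρ => ?_
  obtain ⟨v, hv, rfl⟩ := hρ
  refine (tvNorm_le_of_forall_blockDist_lt hμ h1 (U_mul_conjTranspose _) hn0 hδ
    fun d hd => hN n d hn hd v (subset_closure hv)).trans ?_
  calc 2 * (ε / 4) + 4 * ENNReal.ofReal (4 / (δ ^ 2 * n * (2 * μ - 1))) ≤ ε / 2 + ε / 2 := by
        refine add_le_add (le_of_eq ?_) ht
        rw [div_eq_mul_inv, div_eq_mul_inv, mul_left_comm]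
        congr 1
        rw [show (4 : ℝ≥0∞) = 2 * 2 by norm_num, ENNReal.mul_inv (by simp) (by simp), ← mul_assoc,
          ENNReal.mul_inv_cancel (by simp) (by simp), one_mul]
    _ = ε := ENNReal.add_halves ε

end QubitLAN

end

theorem mainTheorem3 (μ : ℝ) (hμ : 1 / 2 < μ) (hμ' : μ ≤ 1)
    (I : Set ℝ) (hI : Bornology.IsBounded I) (hI' : I.OrdConnected) :
    (∀ n : ℕ, ∀ ρ ∈ QubitLAN.localFamily μ I n,
      IsProbabilityMeasure (QubitLAN.covLaw n ρ) ∧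
      IsProbabilityMeasure (QubitLAN.hetLaw μ n ρ)) ∧
    Tendsto (fun n : ℕ => ⨆ ρ ∈ QubitLAN.localFamily μ I n,
        QubitLAN.tvNorm (QubitLAN.covLaw n ρ) (QubitLAN.hetLaw μ n ρ))
      atTop (𝓝 0) := by
  refine ⟨fun n ρ hρ => ?_, QubitLAN.tendsto_iSup_tvNorm hμ hμ' hI⟩
  obtain ⟨v, -, rfl⟩ := hρ
  exact ⟨QubitLAN.isProbabilityMeasure_covLaw (by linarith) hμ' (QubitLAN.U_mul_conjTranspose _) n,
    QubitLAN.isProbabilityMeasure_hetLaw hμ hμ' (QubitLAN.U_mul_conjTranspose _) n⟩
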